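/- Let $\mathbb K$ be an algebraically closed field of characteristic $0$, let $S=\mathbb K[x_1,\dots,x_n]$, write $S_d$ for the space of homogeneous polynomials (forms) of degree $d$ in $S$ (including $0$), and let $Q_1,Q_2\in S_2$. Here $\mathrm{span}$ is the $\mathbb K$-linear span, and a common factor means a non-unit of $S$ dividing both $Q_1$ and $Q_2$. Then one of the following holds. 1. The ideal $(Q_1,Q_2)$ is prime. 2. The ideal $(Q_1,Q_2)$ is radical but not prime, and at least one of the following occurs: (a) there are linearly independent $x,y\in S_1$ with $xy\in\mathrm{span}(Q_1,Q_2)$; (b) there are linearly independent $x,y\in S_1$ such that $(x,y)$ is a minimal prime of $(Q_1,Q_2)$. 3. The ideal $(Q_1,Q_2)$ is not radical, and one of the following occurs: (a) $Q_1,Q_2$ have a common factor and, after interchanging $Q_1$ and $Q_2$ if necessary, $Q_1=xy$ and $Q_2=x(\alpha x+\beta y)$ for some $x,y\in S_1$ with $x\neq 0$ and some $\alpha,\beta\in\mathbb K$; moreover $x^2\in\mathrm{span}(Q_1,Q_2)$; (b) $Q_1,Q_2$ have no common factor, and there are $0\ne x\in S_1$ and $Q\in S_2$ such that the image of $Q$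 in $S/(x)$ is irreducible, $(x,Q)$ is a minimal prime of $(Q_1,Q_2)$, and $x^2\in\mathrm{span}(Q_1,Q_2)$; (c) $Q_1,Q_2$ have no common factor, and there are linearly independent $x,y\in S_1$ such that $(x,y)$ is a minimal prime of $(Q_1,Q_2)$ and the $(x,y)$-primary component $\mathfrak q$ in an irredundant primary decomposition of $(Q_1,Q_2)$ has multiplicity $e(S/\mathfrak q)\ge 2$. Here $e(S/\mathfrak q)$ is the Hilbert–Samuel multiplicity of the localization $M=(S/\mathfrak q)_{\mathfrak m}$ at $\mathfrak m=(x_1,\dots,x_n)$, as a module over the local ring $S_{\mathfrak m}$; that is, $e(S/\mathfrak q)=\lim_{k\to\infty} d!\,\mathrm{length}(M/\mathfrak m^kM)/k^d$ with $d=\dim M$. -/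

import Mathlib

open scoped ENNReal

/-- The Hilbert-Samuel function of a module `M` over a local ring `(R, 𝔪)`, in its cumulative form
`k ↦ length (M / 𝔪 ^ k M)`; this is the sum of the lengths of `𝔪 ^ j M / 𝔪 ^ (j + 1) M` over
`j < k`. -/
noncomputable def hilbertSamuelFunction (R M : Type*) [CommRing R] [IsLocalRing R]
    [AddCommGroup M] [Module R M] (k : ℕ) : ℕ∞ :=
  Module.length R (M ⧸ ((IsLocalRing.maximalIdeal R) ^ k • (⊤ : Submodule R M)))

/-- The Hilbert-Samuel multiplicity `e(𝔪, M)` of a finitely generated module `M` of dimension `d`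
over a Noetherian local ring `(R, 𝔪)`:
`e(𝔪, M) = lim_k d! * length (M / 𝔪 ^ k M) / k ^ d`.
For large `k` the length of `M / 𝔪 ^ k M` is a polynomial in `k` with leading term
`(e(𝔪, M) / d!) k ^ d`, so that the limit exists, and the upper limit written here is that limit.
If `d ≥ 1`, it is `(d - 1)!` times the leading coefficient of the polynomial that agrees with
`k ↦ length (𝔪 ^ k M / 𝔪 ^ (k + 1) M)` for large `k`; if `d = 0`, it is the length of `M`. -/
noncomputable def hilbertSamuelMultiplicity (R M : Type*) [CommRing R] [IsLocalRing R]
    [AddCommGroup M] [Module R M] : ℝ≥0∞ :=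
  let d : ℕ := ((Module.supportDim R M).unbotD 0).toNat
  Filter.limsup
    (fun k : ℕ => (Nat.factorial d : ℝ≥0∞) * (hilbertSamuelFunction R M k : ℝ≥0∞) / (k : ℝ≥0∞) ^ d)
    Filter.atTop

/-- The ideal of `K[x₁, …, xₙ]` generated by the variables is prime. -/
instance idealOfVars_isPrime (K : Type*) [Field K] (n : ℕ) :
    (MvPolynomial.idealOfVars (Fin n) K).IsPrime := by
  have h : MvPolynomial.idealOfVars (Fin n) K =
      RingHom.ker (MvPolynomial.constantCoeff (σ := Fin n) (R := K)) := by
    ext p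
    rw [← pow_one (MvPolynomial.idealOfVars (Fin n) K), MvPolynomial.mem_pow_idealOfVars_iff']
    simp [RingHom.mem_ker, MvPolynomial.constantCoeff_eq, Finsupp.degree_eq_zero_iff]
  rw [h]
  exact RingHom.ker_isPrime _

/-- `e(S/I)` for an ideal `I` of `S = K[x₁, …, xₙ]`: the Hilbert-Samuel multiplicity of the
localization of `S/I` at `𝔪 = (x₁, …, xₙ)`, as a module over the local ring `S_𝔪`. -/
noncomputable def quotientMultiplicity {K : Type*} [Field K] {n : ℕ}
    (I : Ideal (MvPolynomial (Fin n) K)) : ℝ≥0∞ :=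
  hilbertSamuelMultiplicity
    (Localization.AtPrime (MvPolynomial.idealOfVars (Fin n) K))
    (LocalizedModule (MvPolynomial.idealOfVars (Fin n) K).primeCompl
      (MvPolynomial (Fin n) K ⧸ I))

/-! Write I = (Q₁, Q₂). If Q₁ and Q₂ share a factor, they are proportional or have the form xy, xz,
and everything is explicit (`pencil_of_not_isRelPrime`). Otherwise Krull's height theorem makes
every two-generated prime containing I a minimal prime (`Ideal.span_pair_mem_minimalPrimes`). What
remains is to find a linear prime P = (x, y) containing I and, when I is not radical, one with I S_P
≠ P S_P.

Suppose first that the pencil contains a product of linear forms. If it contains x², then I is not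
radical, and the other generator Q is either irreducible modulo x or splits there as uv; in the
latter case (x, u) is the nonreduced prime (`pencil_sq`). If it contains xy with x, y independent
and Q ∉ (x, y), then I = (x, Q) ∩ (y, Q), which fails to be radical only through a square factor of
Q modulo x or modulo y; if Q ∈ (x, y), that prime is itself nonreduced (`pencil_mul`).

If the pencil contains no product, project from a common zero that is not a vertex of both quadrics
(`exists_base_point`). In suitable coordinates Qᵢ = AᵢX + Gᵢ with A₁, A₂ not both zero. Inverting A₁
eliminates X and leaves the hypersurface c = A₂G₁ - A₁G₂, or a quadric c when A₁ and A₂ are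
proportional. Irreducibility or squarefreeness of c passes to the saturation of I by A₁
(`Polynomial.exists_saturation`), linear factors of c yield linear primes, and at most one linear
prime is hidden inside A₁ = 0. Reducedness along a linear prime is decided by a 2 × 2 determinant
(`Ideal.notReducedAt_of_det_mem`, `Ideal.mem_of_mul_mem_of_det_notMem`).

Finally, the isolated component q at a nonreduced linear P is homogeneous and omits some linear form
t ∈ P. Then S/q contains a copy of S/P and a shifted copy spanned by multiples of t, so its Hilbert
function grows at least twice as fast as that of S/P (`two_le_quotientMultiplicity`). -/

namespace MvPolynomial

/-! ### Factors of homogeneous polynomials are homogeneous. -/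

section Factors

variable {σ R : Type*} [CommRing R]

/-- The ring homomorphism `Xᵢ ↦ Xᵢ T`, which separates the homogeneous components. -/
noncomputable def gradingHom (σ R : Type*) [CommRing R] :
    MvPolynomial σ R →ₐ[R] Polynomial (MvPolynomial σ R) :=
  aeval fun i => Polynomial.C (X i) * Polynomial.X

theorem gradingHom_monomial (s : σ →₀ ℕ) (r : R) :
    gradingHom σ R (monomial s r) = Polynomial.monomial s.degree (monomial s r) := by
  rw [gradingHom, aeval_monomial, ← Polynomial.C_mul_X_pow_eq_monomial]
  simp only [mul_pow, Finsupp.prod_mul, ← Polynomial.C_pow]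
  rw [monomial_eq, Finsupp.degree, Finsupp.prod, Finsupp.prod, Finsupp.prod,
    Finset.prod_pow_eq_pow_sum, map_mul, map_prod, ← mul_assoc]
  rfl

theorem coeff_gradingHom (f : MvPolynomial σ R) (i : ℕ) :
    (gradingHom σ R f).coeff i = homogeneousComponent i f := by
  induction f using MvPolynomial.monomial_add_induction_on with
  | C a =>
    rw [C_apply, gradingHom_monomial, Polynomial.coeff_monomial,
      homogeneousComponent_of_mem (isHomogeneous_monomial a rfl)]
    simp [eq_comm]
  | monomial_add a b f _ _ ih =>
    rw [map_add, Polynomial.coeff_add, ih, map_add, gradingHom_monomial, Polynomial.coeff_monomial,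
      homogeneousComponent_of_mem (isHomogeneous_monomial b rfl)]
    simp [eq_comm]

/-- The image of f g under `gradingHom` is a monomial in T. Degree and trailing degree are both
additive over a domain, so they must coincide for each factor, which then has a single homogeneous
component. -/
theorem IsHomogeneous.exists_of_mul [IsDomain R] {f g : MvPolynomial σ R} {d : ℕ}
    (h : (f * g).IsHomogeneous d) (h0 : f * g ≠ 0) :
    ∃ i j, i + j = d ∧ f.IsHomogeneous i ∧ g.IsHomogeneous j := by
  have hinj : ∀ p : MvPolynomial σ R, gradingHom σ R p = 0 → p = 0 := fun p hp => by
    rw [← sum_homogeneousComponent p]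
    refine Finset.sum_eq_zero fun i _ => ?_
    rw [← coeff_gradingHom, hp, Polynomial.coeff_zero]
  have hf : gradingHom σ R f ≠ 0 := fun H => h0 (by rw [hinj f H, zero_mul])
  have hg : gradingHom σ R g ≠ 0 := fun H => h0 (by rw [hinj g H, mul_zero])
  have hfg : gradingHom σ R f * gradingHom σ R g = Polynomial.monomial d (f * g) := by
    rw [← map_mul]
    ext1 i
    rw [coeff_gradingHom, Polynomial.coeff_monomial, homogeneousComponent_of_mem h]
    simp [eq_comm]
  have h1 := Polynomial.natDegree_mul hf hg
  have h2 := Polynomial.natTrailingDegree_mul hf hg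
  rw [hfg, Polynomial.natDegree_monomial_eq _ h0] at h1
  rw [hfg, Polynomial.natTrailingDegree_monomial h0] at h2
  have h3 := Polynomial.natTrailingDegree_le_natDegree (gradingHom σ R f)
  have h4 := Polynomial.natTrailingDegree_le_natDegree (gradingHom σ R g)
  have key : ∀ p : MvPolynomial σ R,
      (gradingHom σ R p).natTrailingDegree = (gradingHom σ R p).natDegree →
      p.IsHomogeneous (gradingHom σ R p).natDegree := by
    intro p hp
    have : p = homogeneousComponent (gradingHom σ R p).natDegree p := by
      conv_lhs => rw [← sum_homogeneousComponent p]
      rw [Finset.sum_eq_single (gradingHom σ R p).natDegree]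
      · intro i _ hi
        rw [← coeff_gradingHom]
        rcases lt_or_gt_of_ne hi with hi | hi
        · exact Polynomial.coeff_eq_zero_of_lt_natTrailingDegree (hp ▸ hi)
        · exact Polynomial.coeff_eq_zero_of_natDegree_lt hi
      · intro hi
        apply homogeneousComponent_eq_zero
        simpa using hi
    rw [this]
    have h5 := homogeneousComponent_isHomogeneous (gradingHom σ R p).natDegree p
    rwa [← this] at h5 ⊢
  exact ⟨_, _, h1.symm, key f (by omega), key g (by omega)⟩

theorem IsHomogeneous.mul_right_cancel [IsDomain R] {f g : MvPolynomial σ R} {i j : ℕ}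
    (h : (f * g).IsHomogeneous (i + j)) (hf : f.IsHomogeneous i) (hf0 : f ≠ 0) :
    g.IsHomogeneous j := by
  rcases eq_or_ne g 0 with rfl | hg
  · exact isHomogeneous_zero _ _ _
  obtain ⟨a, b, hab, ha, hb⟩ := h.exists_of_mul (mul_ne_zero hf0 hg)
  obtain rfl := ha.inj_right hf hf0
  obtain rfl : b = j := by omega
  exact hb

end Factors

/-! ### Forms of low degree over a field. -/

section Field

variable {σ K : Type*} [Field K]

theorem IsHomogeneous.exists_eq_C {f : MvPolynomial σ K} (h : f.IsHomogeneous 0) :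
    ∃ c, f = C c :=
  ⟨_, totalDegree_eq_zero_iff_eq_C.mp (Nat.le_zero.mp h.totalDegree_le)⟩

theorem IsHomogeneous.isUnit {f : MvPolynomial σ K} (h : f.IsHomogeneous 0) (h0 : f ≠ 0) :
    IsUnit f := by
  obtain ⟨c, rfl⟩ := h.exists_eq_C
  exact (isUnit_iff_ne_zero.mpr (by simpa using h0)).map C

theorem IsHomogeneous.not_isUnit {f : MvPolynomial σ K} {d : ℕ} (h : f.IsHomogeneous d)
    (hd : d ≠ 0) : ¬ IsUnit f := by
  intro hu
  have h1 := (isUnit_iff_totalDegree_of_isReduced.mp hu).2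
  rw [h.totalDegree hu.ne_zero] at h1
  exact hd h1

theorem IsHomogeneous.irreducible {f : MvPolynomial σ K} (h : f.IsHomogeneous 1) (h0 : f ≠ 0) :
    Irreducible f := by
  refine ⟨h.not_isUnit one_ne_zero, fun a b hab => ?_⟩
  obtain ⟨i, j, hij, hi, hj⟩ := (hab ▸ h).exists_of_mul (hab ▸ h0)
  rw [hab] at h0
  rcases (by omega : i = 0 ∨ j = 0) with rfl | rfl
  · exact .inl (hi.isUnit (left_ne_zero_of_mul h0))
  · exact .inr (hj.isUnit (right_ne_zero_of_mul h0))

theorem IsHomogeneous.prime {f : MvPolynomial σ K} (h : f.IsHomogeneous 1) (h0 : f ≠ 0) :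
    Prime f :=
  (h.irreducible h0).prime

/-- A linear form dividing a nonzero linear form is proportional to it. -/
theorem IsHomogeneous.exists_C_mul_of_dvd {f g : MvPolynomial σ K} {d : ℕ} (hf : f.IsHomogeneous d)
    (hg : g.IsHomogeneous d) (hf0 : f ≠ 0) (h : f ∣ g) : ∃ c, g = C c * f := by
  obtain ⟨a, rfl⟩ := h
  obtain ⟨c, rfl⟩ := (IsHomogeneous.mul_right_cancel (j := 0) hg hf hf0).exists_eq_C
  exact ⟨c, mul_comm _ _⟩

/-- A nonzero homogeneous non-unit which is not irreducible is a product of two forms of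
positive degree. -/
theorem IsHomogeneous.exists_mul_of_not_irreducible {f : MvPolynomial σ K} {d : ℕ}
    (h : f.IsHomogeneous d) (hd : d ≠ 0) (h0 : f ≠ 0) (hirr : ¬ Irreducible f) :
    ∃ i j x y, 0 < i ∧ 0 < j ∧ i + j = d ∧ IsHomogeneous x i ∧ IsHomogeneous y j ∧
      f = x * y := by
  rw [irreducible_iff] at hirr
  push Not at hirr
  obtain ⟨x, y, rfl, hx, hy⟩ := hirr (h.not_isUnit hd)
  obtain ⟨i, j, hij, hi, hj⟩ := h.exists_of_mul h0
  refine ⟨i, j, x, y, ?_, ?_, hij, hi, hj, rfl⟩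
  · rcases Nat.eq_zero_or_pos i with rfl | h1
    · exact absurd (hi.isUnit (left_ne_zero_of_mul h0)) hx
    · exact h1
  · rcases Nat.eq_zero_or_pos j with rfl | h1
    · exact absurd (hj.isUnit (right_ne_zero_of_mul h0)) hy
    · exact h1

/-- The degree is at most 3, so one of two positive degrees adding up to it equals 1. It serves
quadrics and the cubic resultant alike. -/
theorem IsHomogeneous.exists_linear_mul_of_not_irreducible {f : MvPolynomial σ K} {d : ℕ}
    (h : f.IsHomogeneous (d + 1)) (hd : d ≤ 2) (h0 : f ≠ 0) (hirr : ¬ Irreducible f) :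
    ∃ x y, IsHomogeneous x 1 ∧ IsHomogeneous y d ∧ f = x * y := by
  obtain ⟨i, j, x, y, hi, hj, hij, hx, hy, rfl⟩ :=
    h.exists_mul_of_not_irreducible (by omega) h0 hirr
  rcases (by omega : i = 1 ∨ j = 1) with rfl | rfl
  · exact ⟨x, y, hx, (by omega : j = d) ▸ hy, rfl⟩
  · exact ⟨y, x, hy, (by omega : i = d) ▸ hx, mul_comm _ _⟩

/-- Two linear forms, the first nonzero, are independent unless the first divides the second. -/
theorem linearIndependent_pair_of_not_dvd {x y : MvPolynomial σ K} (hx : x ≠ 0)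
    (h : ¬ x ∣ y) : LinearIndependent K ![x, y] := by
  rw [LinearIndependent.pair_iff' hx]
  rintro a rfl
  exact h ⟨C a, by rw [smul_eq_C_mul, mul_comm]⟩

theorem IsHomogeneous.not_dvd_of_linearIndependent {x y : MvPolynomial σ K} {d : ℕ}
    (hx : x.IsHomogeneous d) (hy : y.IsHomogeneous d) (h : LinearIndependent K ![x, y]) :
    ¬ x ∣ y := by
  have hx0 : x ≠ 0 := h.ne_zero 0
  intro hd
  obtain ⟨c, rfl⟩ := hx.exists_C_mul_of_dvd hy hx0 hd
  rw [LinearIndependent.pair_iff' hx0] at h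
  exact h c (smul_eq_C_mul _ _)

end Field

end MvPolynomial

namespace MvPolynomial

/-! ### Eliminating a variable by a linear form. -/

section Elimination

variable {K : Type*} [Field K]

theorem isHomogeneous_one_eq_sum {n : ℕ} {x : MvPolynomial (Fin n) K} (hx : x.IsHomogeneous 1) :
    ∃ c : Fin n → K, x = ∑ i, c i • X i := by
  have h : x ∈ homogeneousSubmodule (Fin n) K 1 := hx
  rw [homogeneousSubmodule_one_eq_span_X, Submodule.mem_span_range_iff_exists_fun] at h
  obtain ⟨c, hc⟩ := h
  exact ⟨c, hc.symm⟩

/-- Elimination of one variable by means of a nonzero linear form `x`: the graded retraction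
`π` of `K[x₁, …, xₙ]` onto a polynomial ring in `n - 1` variables with kernel `(x)`, and a graded
section `ι` of it. -/
structure Elimination {n : ℕ} (x : MvPolynomial (Fin n) K) (m : ℕ) where
  π : MvPolynomial (Fin n) K →ₐ[K] MvPolynomial (Fin m) K
  ι : MvPolynomial (Fin m) K →ₐ[K] MvPolynomial (Fin n) K
  π_ι : ∀ a, π (ι a) = a
  π_eq_zero_iff : ∀ f, π f = 0 ↔ x ∣ f
  π_hom : ∀ {f d}, f.IsHomogeneous d → (π f).IsHomogeneous d
  ι_hom : ∀ {f d}, f.IsHomogeneous d → (ι f).IsHomogeneous d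

/-- A variable with nonzero coefficient in x is solved for from x = 0; π substitutes the solution
and ι reinserts the remaining variables. -/
theorem exists_elimination {m : ℕ} {x : MvPolynomial (Fin (m + 1)) K} (hx : x.IsHomogeneous 1)
    (hx0 : x ≠ 0) : Nonempty (Elimination x m) := by
  obtain ⟨c, hc⟩ := isHomogeneous_one_eq_sum hx
  obtain ⟨i, hi⟩ : ∃ i, c i ≠ 0 := by
    by_contra! h
    exact hx0 (by rw [hc]; simp [h])
  rw [Fin.sum_univ_succAbove _ i] at hc
  set y : MvPolynomial (Fin m) K := ∑ j, c (i.succAbove j) • X j with hy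
  have hyhom : y.IsHomogeneous 1 := IsHomogeneous.sum _ _ _ fun j _ => by
    rw [smul_eq_C_mul]; exact (isHomogeneous_X _ _).C_mul _
  set π : MvPolynomial (Fin (m + 1)) K →ₐ[K] MvPolynomial (Fin m) K :=
    aeval (i.insertNth (-((c i)⁻¹ • y)) X) with hπ
  set ι : MvPolynomial (Fin m) K →ₐ[K] MvPolynomial (Fin (m + 1)) K :=
    rename i.succAbove with hι
  have hπi : π (X i) = -((c i)⁻¹ • y) := by simp [hπ]
  have hπj : ∀ j, π (X (i.succAbove j)) = X j := fun j => by simp [hπ]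
  have hπι : ∀ a, π (ι a) = a := by
    intro a
    have : π.comp ι = AlgHom.id K _ := by
      ext j : 1
      simp [hι, hπj]
    exact DFunLike.congr_fun this a
  have hιy : x = c i • X i + ι y := by
    rw [hc, hy, map_sum]
    simp [hι]
  have hπx : π x = 0 := by
    rw [hιy, map_add, map_smul, hπι, hπi, smul_neg, smul_inv_smul₀ hi, neg_add_cancel]
  refine ⟨⟨π, ι, hπι, fun f => ⟨fun h => ?_, ?_⟩, fun {f d} hf => ?_, fun {f d} hf => ?_⟩⟩
  -- Checking on variables gives f ≡ ι (π f) modulo x for every f, so π f = 0 forces x ∣ f.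
  · have key : (Ideal.Quotient.mkₐ K (Ideal.span {x})).comp (ι.comp π) =
        Ideal.Quotient.mkₐ K (Ideal.span {x}) := by
      ext j : 1
      rcases Fin.eq_self_or_eq_succAbove i j with rfl | ⟨j, rfl⟩
      · simp only [AlgHom.comp_apply, hπi, Ideal.Quotient.mkₐ_eq_mk]
        rw [Ideal.Quotient.eq, Ideal.mem_span_singleton]
        refine ⟨C (-(c j)⁻¹), ?_⟩
        rw [hιy, map_neg, map_smul, smul_eq_C_mul, smul_eq_C_mul, map_neg]
        have : (C (c j)⁻¹ * C (c j) : MvPolynomial (Fin (m + 1)) K) = 1 := by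
          rw [← map_mul, inv_mul_cancel₀ hi, map_one]
        linear_combination (X j) * this
      · simp [hπj, hι]
    have h2 := DFunLike.congr_fun key f
    simp only [AlgHom.comp_apply, h, map_zero, Ideal.Quotient.mkₐ_eq_mk] at h2
    exact Ideal.mem_span_singleton.mp (Ideal.Quotient.eq_zero_iff_mem.mp h2.symm)
  · rintro ⟨g, rfl⟩
    rw [map_mul, hπx, zero_mul]
  · have := hf.aeval (n := 1) (i.insertNth (-((c i)⁻¹ • y)) X : Fin (m + 1) → _) (fun j => by
      rcases Fin.eq_self_or_eq_succAbove i j with rfl | ⟨j, rfl⟩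
      · rw [Fin.insertNth_apply_same, smul_eq_C_mul]
        exact (hyhom.C_mul _).neg
      · rw [Fin.insertNth_apply_succAbove]
        exact isHomogeneous_X _ _)
    rwa [one_mul] at this
  · exact hf.rename_isHomogeneous

namespace Elimination

variable {n m : ℕ} {x : MvPolynomial (Fin n) K} (E : Elimination x m)

include E

theorem π_surjective : Function.Surjective E.π := fun a => ⟨E.ι a, E.π_ι a⟩

theorem π_C (r : K) : E.π (C r) = C r := E.π.commutes r

theorem π_self : E.π x = 0 := (E.π_eq_zero_iff x).mpr dvd_rfl

theorem ker_π : RingHom.ker E.π = Ideal.span {x} := by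
  ext f
  rw [RingHom.mem_ker, E.π_eq_zero_iff, Ideal.mem_span_singleton]

/-- The preimage of `(π f)` is `(x, f)`. -/
theorem comap_span_π (f : MvPolynomial (Fin n) K) :
    (Ideal.span {E.π f}).comap E.π = Ideal.span {x, f} := by
  ext g
  rw [Ideal.mem_comap, Ideal.mem_span_singleton, Ideal.mem_span_pair]
  constructor
  · rintro ⟨a, ha⟩
    have : x ∣ g - E.ι a * f := by
      rw [← E.π_eq_zero_iff, map_sub, map_mul, E.π_ι, ha]; ring
    obtain ⟨b, hb⟩ := this
    exact ⟨b, E.ι a, by linear_combination -hb⟩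
  · rintro ⟨a, b, rfl⟩
    simp [E.π_self]

theorem isPrime_span_pair {f : MvPolynomial (Fin n) K} (hf : Prime (E.π f)) :
    (Ideal.span {x, f}).IsPrime := by
  rw [← E.comap_span_π]
  have := (Ideal.span_singleton_prime hf.ne_zero).mpr hf
  exact Ideal.comap_isPrime _ _

theorem π_ne_zero {y : MvPolynomial (Fin n) K} (hx : x.IsHomogeneous 1) (hy : y.IsHomogeneous 1)
    (h : LinearIndependent K ![x, y]) : E.π y ≠ 0 := by
  rw [Ne, E.π_eq_zero_iff]
  exact hx.not_dvd_of_linearIndependent hy h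

theorem isPrime_span_linear {y : MvPolynomial (Fin n) K} (hx : x.IsHomogeneous 1)
    (hy : y.IsHomogeneous 1) (h : LinearIndependent K ![x, y]) : (Ideal.span {x, y}).IsPrime :=
  E.isPrime_span_pair ((E.π_hom hy).prime (E.π_ne_zero hx hy h))

theorem linearIndependent_ι {u : MvPolynomial (Fin m) K} (hx : x ≠ 0) (hu : u ≠ 0) :
    LinearIndependent K ![x, E.ι u] :=
  linearIndependent_pair_of_not_dvd hx (by rwa [← E.π_eq_zero_iff, E.π_ι])

/-- If the image of a form factors as `u v`, then the form is `ι u * ι v + x w`. -/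
theorem exists_lift {f : MvPolynomial (Fin n) K} {d : ℕ} (hf : f.IsHomogeneous (d + 1))
    (hx : x.IsHomogeneous 1) (hx0 : x ≠ 0) {g : MvPolynomial (Fin n) K}
    (hg : g.IsHomogeneous (d + 1)) (h : E.π f = E.π g) :
    ∃ w, IsHomogeneous w d ∧ f = g + x * w := by
  obtain ⟨w, hw⟩ : x ∣ f - g := by rw [← E.π_eq_zero_iff, map_sub, h, sub_self]
  refine ⟨w, IsHomogeneous.mul_right_cancel (i := 1) ?_ hx hx0, by linear_combination hw⟩
  rw [← hw, add_comm]
  exact hf.sub hg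

end Elimination

theorem exists_elimination' {n : ℕ} {x : MvPolynomial (Fin n) K} (hx : x.IsHomogeneous 1)
    (hx0 : x ≠ 0) : ∃ m, n = m + 1 ∧ Nonempty (Elimination x m) := by
  cases n with
  | zero => exact absurd (hx.inj_right (isHomogeneous_of_isEmpty _ _ x) hx0) one_ne_zero
  | succ m => exact ⟨m, rfl, exists_elimination hx hx0⟩

theorem isPrime_span_linear_pair {n : ℕ} {x y : MvPolynomial (Fin n) K} (hx : x.IsHomogeneous 1)
    (hy : y.IsHomogeneous 1) (h : LinearIndependent K ![x, y]) : (Ideal.span {x, y}).IsPrime := by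
  obtain ⟨m, -, ⟨E⟩⟩ := exists_elimination' hx (h.ne_zero 0)
  exact E.isPrime_span_linear hx hy h

end Elimination

end MvPolynomial

/-! ### Two-generated ideals inside a prime (a, b): the determinant criterion. -/

namespace Ideal

variable {R : Type*} [CommRing R]

/-- `I R_P ≠ P R_P`, for a prime ideal `P` containing `I`. -/
def NotReducedAt (I P : Ideal R) : Prop :=
  ∃ f ∈ P, ∀ s, s * f ∈ I → s ∈ P

/-- The generators of I arise from a, b by the matrix with rows (p, z) and (k, v). If I and P agreed
locally at P, this matrix would be invertible modulo P, which a determinant in P forbids. -/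
theorem notReducedAt_of_det_mem [IsDomain R] {a b p z k v : R} (ha : Prime a) (hab : ¬ a ∣ b)
    (hP : (span {a, b}).IsPrime) (hdet : p * v - z * k ∈ span {a, b}) :
    NotReducedAt (span {p * a + z * b, k * a + v * b}) (span {a, b}) := by
  by_contra hcon
  unfold NotReducedAt at hcon
  push Not at hcon
  obtain ⟨s₁, h₁, hs₁⟩ := hcon a (subset_span (by simp))
  obtain ⟨s₂, h₂, hs₂⟩ := hcon b (subset_span (by simp))
  rw [mem_span_pair] at h₁ h₂
  obtain ⟨α, β, h₁⟩ := h₁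
  obtain ⟨γ, δ, h₂⟩ := h₂
  -- Only the Koszul relation holds between a and b, so coefficients of any relation lie in P.
  have key : ∀ u w, u * a + w * b = 0 → u ∈ span {a, b} ∧ w ∈ span {a, b} := by
    intro u w h
    obtain ⟨w', rfl⟩ : a ∣ w :=
      (ha.dvd_or_dvd (⟨-u, by linear_combination h⟩ : a ∣ w * b)).resolve_right hab
    have : u = -w' * b := mul_left_cancel₀ ha.ne_zero (by linear_combination h)
    exact ⟨mem_span_pair.mpr ⟨0, -w', by rw [this]; ring⟩, mem_span_pair.mpr ⟨w', 0, by ring⟩⟩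
  obtain ⟨e₁, e₂⟩ := key (α * p + β * k - s₁) (α * z + β * v) (by linear_combination h₁)
  obtain ⟨e₃, e₄⟩ := key (γ * p + δ * k) (γ * z + δ * v - s₂) (by linear_combination h₂)
  -- Modulo P, the matrix with rows (α, β), (γ, δ) times the given one is diag(s₁, s₂); take
  -- determinants.
  have : s₁ * s₂ ∈ span {a, b} := by
    have : s₁ * s₂ = (α * δ - β * γ) * (p * v - z * k)
        - (α * p + β * k - s₁) * (γ * z + δ * v - s₂) - (α * p + β * k - s₁) * s₂
        - s₁ * (γ * z + δ * v - s₂) + (α * z + β * v) * (γ * p + δ * k) := by ring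
    rw [this]
    exact add_mem (sub_mem (sub_mem (sub_mem (mul_mem_left _ _ hdet) (mul_mem_left _ _ e₄))
      (mul_mem_right _ _ e₁)) (mul_mem_left _ _ e₄)) (mul_mem_left _ _ e₃)
  rcases hP.mem_or_mem this with h | h
  exacts [hs₁ h, hs₂ h]

/-- `a` is a nonzerodivisor modulo `(f, g)` if `f, g` have no relations modulo `a` besides the
Koszul relation. -/
theorem mem_span_pair_of_mul_mem [IsDomain R] {a f g F : R} (ha : a ≠ 0)
    (h : ∀ α β, a ∣ α * f + β * g → ∃ e, a ∣ α - e * g ∧ a ∣ β + e * f)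
    (hF : a * F ∈ span {f, g}) : F ∈ span {f, g} := by
  rw [mem_span_pair] at hF ⊢
  obtain ⟨α, β, hF⟩ := hF
  obtain ⟨e, ⟨α', h₁⟩, ⟨β', h₂⟩⟩ := h α β ⟨F, hF⟩
  refine ⟨α', β', mul_left_cancel₀ ha ?_⟩
  linear_combination hF - f * h₁ - g * h₂

/-- This bounds the colon ideal (I : a) by I + (det). Modulo a the coefficients of aF form a
multiple e of (v, -z), and v(pa + zu) - z(ka + vu) = a · det. -/
theorem exists_sub_mul_det_mem [IsDomain R] {a u p z k v F : R} (ha : a ≠ 0)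
    (h : ∀ α β, a ∣ α * (u * z) + β * (u * v) → ∃ e, a ∣ α - e * v ∧ a ∣ β + e * z)
    (hF : a * F ∈ span {p * a + z * u, k * a + v * u}) :
    ∃ e, F - e * (p * v - z * k) ∈ span {p * a + z * u, k * a + v * u} := by
  rw [mem_span_pair] at hF
  obtain ⟨α, β, hF⟩ := hF
  obtain ⟨e, ⟨α', h₁⟩, ⟨β', h₂⟩⟩ := h α β ⟨F - α * p - β * k, by linear_combination hF⟩
  refine ⟨e, mem_span_pair.mpr ⟨α', β', mul_left_cancel₀ ha ?_⟩⟩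
  linear_combination hF - (p * a + z * u) * h₁ - (k * a + v * u) * h₂

/-- If `det ∉ P = (a, u)`, an element of `P` multiplied into `I` by `a` lies in `I`. -/
theorem mem_of_mul_mem_of_det_notMem [IsDomain R] {a u p z k v F : R} (ha : a ≠ 0)
    (h : ∀ α β, a ∣ α * (u * z) + β * (u * v) → ∃ e, a ∣ α - e * v ∧ a ∣ β + e * z)
    (hP : (span {a, u}).IsPrime) (hdet : p * v - z * k ∉ span {a, u}) (hFP : F ∈ span {a, u})
    (hF : a * F ∈ span {p * a + z * u, k * a + v * u}) :
    F ∈ span {p * a + z * u, k * a + v * u} := by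
  obtain ⟨e, he⟩ := exists_sub_mul_det_mem ha h hF
  have hle : span {p * a + z * u, k * a + v * u} ≤ span {a, u} := by
    rw [span_le]
    rintro _ (rfl | rfl)
    exacts [mem_span_pair.mpr ⟨_, _, rfl⟩, mem_span_pair.mpr ⟨_, _, rfl⟩]
  have heP : e ∈ span {a, u} := by
    have : e * (p * v - z * k) ∈ span {a, u} := by
      simpa using sub_mem hFP (hle he)
    exact (hP.mem_or_mem this).resolve_right hdet
  obtain ⟨c, d, rfl⟩ := mem_span_pair.mp heP
  -- Cramer's rule: the determinant multiplies a and u into I.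
  have : (c * a + d * u) * (p * v - z * k) ∈ span {p * a + z * u, k * a + v * u} :=
    mem_span_pair.mpr ⟨c * v - d * k, d * p - c * z, by ring⟩
  simpa using add_mem he this

end Ideal

/-! ### Coprimality and principal radical ideals. -/

theorem IsRelPrime.exists_of_mul_add_mul_eq_zero {R : Type*} [CommRing R] [IsDomain R]
    [DecompositionMonoid R] {r s α β : R}
    (h : IsRelPrime r s) (hs : s ≠ 0) (h0 : α * r + β * s = 0) : ∃ e, α = e * s ∧ β = -(e * r) := by
  obtain ⟨e, rfl⟩ : s ∣ α := h.symm.dvd_of_dvd_mul_right ⟨-β, by linear_combination h0⟩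
  exact ⟨e, mul_comm _ _, mul_left_cancel₀ hs (by linear_combination h0)⟩

theorem span_singleton_isRadical_of_squarefree {R : Type*} [CommRing R] [IsDomain R]
    [UniqueFactorizationMonoid R] {c : R} (hc : Squarefree c) :
    (Ideal.span {c}).IsRadical := by
  intro f hf
  obtain ⟨n, hn⟩ := hf
  rw [Ideal.mem_span_singleton] at hn ⊢
  exact hc.isRadical n f hn

/-- Coprimality depends only on the ideal, so it survives a change of basis of the pencil. -/
theorem isRelPrime_iff_span {R : Type*} [CommRing R] {f g : R} :
    IsRelPrime f g ↔ ∀ d, Ideal.span {f, g} ≤ Ideal.span {d} → IsUnit d := by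
  refine forall_congr' fun d => ?_
  rw [Ideal.span_le, Set.insert_subset_iff, Set.singleton_subset_iff, SetLike.mem_coe,
    SetLike.mem_coe, Ideal.mem_span_singleton, Ideal.mem_span_singleton, and_imp]

theorem irreducible_mk_iff {R S : Type*} [CommRing R] [CommRing S] {f : R →+* S} {I : Ideal R}
    (hf : Function.Surjective f) (hI : RingHom.ker f = I) (q : R) :
    Irreducible (Ideal.Quotient.mk I q) ↔ Irreducible (f q) := by
  subst hI
  exact (MulEquiv.irreducible_iff
    (RingHom.quotientKerEquivOfSurjective hf).toMulEquiv (x := Ideal.Quotient.mk _ q)).symm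

/-! ### Pencils containing a product of two linear forms. -/

namespace MvPolynomial

open Ideal

variable {K : Type*} [Field K] {n : ℕ}

/-- A form that is not squarefree is divisible by the square of a form of positive degree. -/
theorem IsHomogeneous.exists_sq_mul {f : MvPolynomial (Fin n) K} {d : ℕ} (h : f.IsHomogeneous d)
    (h0 : f ≠ 0) (hsq : ¬ Squarefree f) :
    ∃ i j u v, 0 < i ∧ i + i + j = d ∧ IsHomogeneous u i ∧ IsHomogeneous v j ∧ f = u * u * v := by
  simp only [Squarefree, not_forall] at hsq
  obtain ⟨u, ⟨v, rfl⟩, hu⟩ := hsq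
  obtain ⟨a, j, haj, ha, hj⟩ := h.exists_of_mul h0
  obtain ⟨i, i', hii, hi, hi'⟩ := ha.exists_of_mul (left_ne_zero_of_mul h0)
  have hu0 : u ≠ 0 := left_ne_zero_of_mul (left_ne_zero_of_mul h0)
  obtain rfl := hi.inj_right hi' hu0
  refine ⟨i, j, u, v, Nat.pos_of_ne_zero ?_, by omega, hi, hj, rfl⟩
  rintro rfl
  exact hu (hi.isUnit hu0)

/-- The case of a pencil of quadratic forms containing a square. -/
theorem pencil_sq {x Q : MvPolynomial (Fin n) K} (hx : x.IsHomogeneous 1) (hx0 : x ≠ 0)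
    (hQ : Q.IsHomogeneous 2) (hrel : IsRelPrime (x * x) Q) :
    (Irreducible (Ideal.Quotient.mk (span {x}) Q) ∧ (span {x, Q}).IsPrime) ∨
    ∃ u, IsHomogeneous u 1 ∧ LinearIndependent K ![x, u] ∧ span {x * x, Q} ≤ span {x, u} ∧
      NotReducedAt (span {x * x, Q}) (span {x, u}) := by
  obtain ⟨m, -, ⟨E⟩⟩ := exists_elimination' hx hx0
  have hxQ : ¬ x ∣ Q := fun h => (hx.irreducible hx0).not_isUnit (hrel (dvd_mul_right _ _) h)
  have hπQ : E.π Q ≠ 0 := by rwa [Ne, E.π_eq_zero_iff]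
  by_cases hirr : Irreducible (E.π Q)
  · refine .inl ⟨?_, E.isPrime_span_pair hirr.prime⟩
    exact (irreducible_mk_iff (f := E.π.toRingHom) E.π_surjective E.ker_π Q).mpr hirr
  · obtain ⟨u, v, hu, hv, huv⟩ :=
      (E.π_hom hQ).exists_linear_mul_of_not_irreducible (by norm_num) hπQ hirr
    have hu0 : u ≠ 0 := by rintro rfl; exact hπQ (by rw [huv, zero_mul])
    obtain ⟨w, -, hw⟩ := E.exists_lift hQ hx hx0 (g := E.ι u * E.ι v)
      ((E.ι_hom hu).mul (E.ι_hom hv)) (by rw [huv, map_mul, E.π_ι, E.π_ι])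
    -- Nonreducedness is witnessed by x itself: if s x = a x² + b Q, then x ∣ b, and cancelling x
    -- puts s in (x, Q) ⊆ (x, ι u).
    have hQP : Q ∈ span {x, E.ι u} := mem_span_pair.mpr ⟨w, E.ι v, by rw [hw]; ring⟩
    refine .inr ⟨E.ι u, E.ι_hom hu, E.linearIndependent_ι hx0 hu0, ?_, x,
      subset_span (by simp), fun s hs => ?_⟩
    · rw [span_le]
      rintro _ (rfl | rfl)
      exacts [mul_mem_left _ _ (subset_span (by simp)), hQP]
    · obtain ⟨a, b, hab⟩ := mem_span_pair.mp hs
      have hb : x ∣ b := by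
        exact ((hx.prime hx0).dvd_or_dvd
          (⟨s - a * x, by linear_combination hab⟩ : x ∣ b * Q)).resolve_right hxQ
      obtain ⟨b, rfl⟩ := hb
      have : s = a * x + b * Q := mul_left_cancel₀ hx0 (by linear_combination -hab)
      rw [this]
      exact add_mem (mul_mem_left _ _ (subset_span (by simp))) (mul_mem_left _ _ hQP)

/-- One of the two components of a pencil of quadratic forms containing `x y`. -/
theorem pencil_mul_component {x y Q : MvPolynomial (Fin n) K} (hx : x.IsHomogeneous 1)
    (hx0 : x ≠ 0) (hQ : Q.IsHomogeneous 2) (hxQ : ¬ x ∣ Q) :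
    (span {x, Q}).IsRadical ∨
    ∃ u, IsHomogeneous u 1 ∧ LinearIndependent K ![x, u] ∧ span {x * y, Q} ≤ span {x, u} ∧
      NotReducedAt (span {x * y, Q}) (span {x, u}) := by
  obtain ⟨m, -, ⟨E⟩⟩ := exists_elimination' hx hx0
  have hπQ : E.π Q ≠ 0 := by rwa [Ne, E.π_eq_zero_iff]
  by_cases hsq : Squarefree (E.π Q)
  · left
    rw [← E.comap_span_π]
    exact (span_singleton_isRadical_of_squarefree hsq).comap _
  · obtain ⟨i, j, u, v, hi, hij, hu, hv, huv⟩ := (E.π_hom hQ).exists_sq_mul hπQ hsq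
    obtain rfl : i = 1 := by omega
    obtain rfl : j = 0 := by omega
    have hu0 : u ≠ 0 := by rintro rfl; exact hπQ (by rw [huv]; ring)
    obtain ⟨w, -, hw⟩ := E.exists_lift hQ hx hx0 (g := E.ι u * E.ι u * E.ι v)
      (((E.ι_hom hu).mul (E.ι_hom hu)).mul (E.ι_hom hv)) (by simp only [huv, map_mul, E.π_ι])
    have hli := E.linearIndependent_ι hx0 hu0
    -- Here x y = y·x + 0·ιu and Q = w·x + (ιu ιv)·ιu; the determinant y ιu ιv is a multiple of ιu
    -- because u occurs twice in π Q.
    have h := notReducedAt_of_det_mem (p := y) (z := 0) (k := w) (v := E.ι u * E.ι v)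
      (hx.prime hx0) (hx.not_dvd_of_linearIndependent (E.ι_hom hu) hli)
      (isPrime_span_linear_pair hx (E.ι_hom hu) hli)
      (mem_span_pair.mpr ⟨0, y * E.ι v, by ring⟩)
    have e₁ : y * x + 0 * E.ι u = x * y := by ring
    have e₂ : w * x + E.ι u * E.ι v * E.ι u = Q := by rw [hw]; ring
    rw [e₁, e₂] at h
    refine .inr ⟨E.ι u, E.ι_hom hu, hli, ?_, h⟩
    rw [span_le]
    rintro _ (rfl | rfl)
    exacts [mem_span_pair.mpr ⟨y, 0, by ring⟩, mem_span_pair.mpr ⟨w, E.ι u * E.ι v, e₂⟩]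

/-- The case of a pencil of quadratic forms containing a product of independent linear forms. -/
theorem pencil_mul {x y Q : MvPolynomial (Fin n) K} (hx : x.IsHomogeneous 1)
    (hy : y.IsHomogeneous 1) (hxy : LinearIndependent K ![x, y])
    (hQ : Q.IsHomogeneous 2) (hrel : IsRelPrime (x * y) Q) :
    (span {x * y, Q}).IsRadical ∨
    ∃ u v, IsHomogeneous u 1 ∧ IsHomogeneous v 1 ∧ LinearIndependent K ![u, v] ∧
      span {x * y, Q} ≤ span {u, v} ∧ NotReducedAt (span {x * y, Q}) (span {u, v}) := by
  have hx0 : x ≠ 0 := hxy.ne_zero 0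
  have hy0 : y ≠ 0 := hxy.ne_zero 1
  have hxQ : ¬ x ∣ Q := fun h => (hx.irreducible hx0).not_isUnit (hrel (dvd_mul_right _ _) h)
  have hyQ : ¬ y ∣ Q := fun h => (hy.irreducible hy0).not_isUnit (hrel (dvd_mul_left _ _) h)
  have hP := isPrime_span_linear_pair hx hy hxy
  by_cases hQP : Q ∈ span {x, y}
  · obtain ⟨a, b, hab⟩ := mem_span_pair.mp hQP
    -- With Q = a x + b y the determinant is y b, which lies in (x, y).
    have h := notReducedAt_of_det_mem (p := y) (z := 0) (k := a) (v := b)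
      (hx.prime hx0) (hx.not_dvd_of_linearIndependent hy hxy) hP
      (mem_span_pair.mpr ⟨0, b, by ring⟩)
    have e₁ : y * x + 0 * y = x * y := by ring
    rw [e₁, hab] at h
    refine .inr ⟨x, y, hx, hy, hxy, ?_, h⟩
    rw [span_le]
    rintro _ (rfl | rfl)
    exacts [mem_span_pair.mpr ⟨y, 0, by ring⟩, hQP]
  rcases pencil_mul_component (y := y) hx hx0 hQ hxQ with h₁ | ⟨u, hu, h₁, h₂, h₃⟩
  swap
  · exact .inr ⟨x, u, hx, hu, h₁, h₂, h₃⟩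
  rcases pencil_mul_component (y := x) hy hy0 hQ hyQ with h₂ | ⟨u, hu, h₁, h₂, h₃⟩
  swap
  · rw [mul_comm] at h₂ h₃
    exact .inr ⟨y, u, hy, hu, h₁, h₂, h₃⟩
  left
  have : span {x * y, Q} = span {x, Q} ⊓ span {y, Q} := by
    apply le_antisymm
    · rw [le_inf_iff, span_le, span_le]
      constructor
      · rintro _ (rfl | rfl)
        exacts [mem_span_pair.mpr ⟨y, 0, by ring⟩, mem_span_pair.mpr ⟨0, 1, by ring⟩]
      · rintro _ (rfl | rfl)
        exacts [mem_span_pair.mpr ⟨x, 0, by ring⟩, mem_span_pair.mpr ⟨0, 1, by ring⟩]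
    · rintro f ⟨hf₁, hf₂⟩
      obtain ⟨a, b, rfl⟩ := mem_span_pair.mp hf₁
      obtain ⟨c, d, hcd⟩ := mem_span_pair.mp hf₂
      have : (b - d) * Q ∈ span {x, y} := mem_span_pair.mpr ⟨-a, c, by linear_combination hcd⟩
      obtain ⟨e, g, heg⟩ := mem_span_pair.mp ((hP.mem_or_mem this).resolve_right hQP)
      -- `x (a + e Q) = y (c - g Q)`
      obtain ⟨k, hk⟩ : y ∣ a + e * Q := by
        refine ((hy.prime hy0).dvd_or_dvd (⟨c - g * Q, ?_⟩ : y ∣ x * (a + e * Q))).resolve_left ?_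
        · linear_combination Q * heg - hcd
        · exact hy.not_dvd_of_linearIndependent hx (LinearIndependent.pair_symm_iff.mp hxy)
      exact mem_span_pair.mpr ⟨k, b - e * x, by linear_combination -x * hk⟩
  rw [this]
  exact h₁.inf h₂

end MvPolynomial

/-! ### Elimination of X from A X + G by inverting A. -/

namespace Polynomial

open Ideal

variable {R : Type*} [CommRing R]

/-- Pseudo-division: after multiplication by a power of A, the monomial Xⁿ may be replaced by (-G)ⁿ,
since AX + G divides (AX)ⁿ - (-G)ⁿ. -/
theorem exists_C_pow_mul_eq (A G : R) (F : R[X]) :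
    ∃ N b H, C A ^ N * F = C b + H * (C A * X + C G) := by
  induction F using Polynomial.induction_on' with
  | add p q hp hq =>
    obtain ⟨N, b, H, hp⟩ := hp
    obtain ⟨N', b', H', hq⟩ := hq
    refine ⟨N + N', A ^ N' * b + A ^ N * b', C A ^ N' * H + C A ^ N * H', ?_⟩
    simp only [C_add, C_mul, C_pow]
    linear_combination C A ^ N' * hp + C A ^ N * hq
  | monomial n a =>
    obtain ⟨H, hH⟩ := sub_dvd_pow_sub_pow (C A * X : R[X]) (-C G) n
    refine ⟨n, a * (-G) ^ n, C a * H, ?_⟩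
    rw [← C_mul_X_pow_eq_monomial]
    simp only [C_mul, C_pow, C_neg]
    linear_combination C a * hH

/-- The saturation with respect to `A` of an ideal `(A X + G, Q)` that contains a constant `c`
equal to `Q` up to a unit after the substitution `X = -G / A`: the preimage of `(c)` under
`R[X] → R[1 / A]`, `X ↦ -G / A`. -/
theorem exists_saturation [IsDomain R] {A G c d : R} {Q H : R[X]}
    (hc : C c ∈ span {C A * X + C G, Q}) (hQ : C A * Q = C (d * c) + H * (C A * X + C G)) :
    ∃ J : Ideal R[X], span {C A * X + C G, Q} ≤ J ∧
      (∀ F ∈ J, ∃ N, C A ^ N * F ∈ span {C A * X + C G, Q}) ∧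
      ((span {c}).IsRadical → J.IsRadical) ∧
      (Prime c → (∀ N, ¬ c ∣ A ^ N) → J.IsPrime) := by
  let L := Localization.Away A
  let a : R →+* L := algebraMap R L
  let i : L := IsLocalization.Away.invSelf A
  have hai : a A * i = 1 := IsLocalization.Away.mul_invSelf A
  let φ : R[X] →+* L := eval₂RingHom a (-(a G * i))
  have hφC : ∀ r, φ (C r) = a r := fun r => eval₂_C _ _
  have hφ1 : φ (C A * X + C G) = 0 := by
    simp only [φ, coe_eval₂RingHom, eval₂_add, eval₂_mul, eval₂_C, eval₂_X]
    linear_combination -(a G) * hai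
  have hφQ : φ Q ∈ (span {c}).map a := by
    have h1 : a A * φ Q = a (d * c) := by
      have := congrArg φ hQ
      rwa [map_mul, map_add, map_mul φ H, hφ1, hφC, hφC, mul_zero, add_zero] at this
    have h2 : φ Q = i * a (d * c) := by linear_combination i * h1 - φ Q * hai
    rw [h2]
    exact mul_mem_left _ _ (mem_map_of_mem _ (mem_span_singleton.mpr (dvd_mul_left _ _)))
  have hM : ∀ b, a b ∈ (span {c}).map a → ∃ N, c ∣ A ^ N * b := by
    intro b hb
    obtain ⟨_, ⟨n, rfl⟩, hs⟩ :=
      (IsLocalization.algebraMap_mem_map_algebraMap_iff (Submonoid.powers A) L _ b).mp hb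
    exact ⟨n, mem_span_singleton.mp hs⟩
  refine ⟨((span {c}).map a).comap φ, ?_, fun F hF => ?_, fun h => ?_, fun hp hd => ?_⟩
  · rw [span_le]
    rintro _ (rfl | rfl)
    · rw [SetLike.mem_coe, mem_comap]
      rw [hφ1]; exact zero_mem _
    · exact hφQ
  · obtain ⟨N, b, H', hN⟩ := exists_C_pow_mul_eq A G F
    have hb : a b ∈ (span {c}).map a := by
      have h1 : a b = a A ^ N * φ F := by
        have := congrArg φ hN
        rw [map_mul, map_add, map_mul φ H', map_pow, hφ1, hφC, hφC, mul_zero, add_zero] at this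
        exact this.symm
      rw [h1]
      exact mul_mem_left _ _ hF
    obtain ⟨M, e, he⟩ := hM b hb
    refine ⟨M + N, ?_⟩
    have : C A ^ (M + N) * F = C e * C c + C A ^ M * H' * (C A * X + C G) := by
      have he' := congrArg C he
      simp only [C_mul, C_pow] at he'
      rw [pow_add]
      linear_combination C A ^ M * hN + he'
    rw [this]
    exact add_mem (mul_mem_left _ _ hc) (mul_mem_left _ _ (subset_span (by simp)))
  · refine IsRadical.comap _ ?_
    rw [← h.radical]
    have := IsLocalization.map_radical (Submonoid.powers A) L (span {c})
    rw [show (span {c}).radical.map a = _ from this]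
    exact radical_isRadical _
  · have := (span_singleton_prime hp.ne_zero).mpr hp
    have : ((span {c}).map a).IsPrime := by
      refine IsLocalization.isPrime_of_isPrime_disjoint (Submonoid.powers A) L _ this ?_
      rw [Set.disjoint_left]
      rintro _ ⟨n, rfl⟩ hn
      exact hd n (mem_span_singleton.mp hn)
    exact comap_isPrime _ _

theorem isRelPrime_C_of_forall [IsDomain R] {g a h : R} (hg : g ≠ 0)
    (H : ∀ d, d ∣ g → d ∣ a → d ∣ h → IsUnit d) : IsRelPrime (C g) (C a * X + C h) := by
  intro d hd₁ hd₂
  have hdeg : d.natDegree = 0 := by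
    have := natDegree_le_of_dvd hd₁ (by simpa using hg)
    simpa using this
  obtain ⟨d, rfl⟩ : ∃ r, d = C r := ⟨_, eq_C_of_natDegree_eq_zero hdeg⟩
  rw [C_dvd_iff_dvd_coeff] at hd₁ hd₂
  exact (H d (by simpa using hd₁ 0) (by simpa using hd₂ 1) (by simpa using hd₂ 0)).map C

/-- If multiplication by A is injective on P/I, then any element of P in the A-saturation of I is
already in I. This recovers I as the saturation intersected with P. -/
theorem C_pow_mul_mem {I P : Ideal R[X]} {A : R}
    (h : ∀ F ∈ P, C A * F ∈ I → F ∈ I) {F : R[X]} (hFP : F ∈ P) {N : ℕ} (hF : C A ^ N * F ∈ I) :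
    F ∈ I := by
  induction N with
  | zero => simpa using hF
  | succ N ih =>
    refine ih (h _ (mul_mem_left _ _ hFP) ?_)
    rwa [← mul_assoc, ← pow_succ']

end Polynomial

/-! ### Relations modulo a linear form. -/

namespace MvPolynomial.Elimination

open Polynomial Ideal

variable {K : Type*} [Field K] {m n : ℕ} {x : MvPolynomial (Fin n) K} (E : Elimination x m)

include E

/-- The ring homomorphism underlying `π`. -/
noncomputable abbrev πRing : MvPolynomial (Fin n) K →+* MvPolynomial (Fin m) K := E.π

theorem C_dvd_iff (F : (MvPolynomial (Fin n) K)[X]) :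
    Polynomial.C x ∣ F ↔ F.map E.πRing = 0 := by
  rw [Polynomial.C_dvd_iff_dvd_coeff, Polynomial.ext_iff]
  refine forall_congr' fun i => ?_
  rw [Polynomial.coeff_map, Polynomial.coeff_zero, ← E.π_eq_zero_iff]
  rfl

/-- Modulo x one works in a polynomial ring over a field, where coprime elements have only Koszul
relations; the multiplier e is then lifted. -/
theorem exists_koszul {r s : (MvPolynomial (Fin n) K)[X]}
    (hrs : IsRelPrime (r.map E.πRing) (s.map E.πRing))
    (hs : s.map E.πRing ≠ 0) (α β : (MvPolynomial (Fin n) K)[X])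
    (h : Polynomial.C x ∣ α * r + β * s) :
    ∃ e, Polynomial.C x ∣ α - e * s ∧ Polynomial.C x ∣ β + e * r := by
  rw [E.C_dvd_iff, Polynomial.map_add, Polynomial.map_mul, Polynomial.map_mul] at h
  obtain ⟨e, he⟩ := hrs.exists_of_mul_add_mul_eq_zero hs h
  obtain ⟨e, rfl⟩ := Polynomial.map_surjective E.πRing E.π_surjective e
  refine ⟨e, ?_⟩
  simp [E.C_dvd_iff, he]

theorem exists_koszul' {u : MvPolynomial (Fin n) K} (hu : E.π u ≠ 0)
    {r s : (MvPolynomial (Fin n) K)[X]}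
    (hrs : IsRelPrime (r.map E.πRing) (s.map E.πRing))
    (hs : s.map E.πRing ≠ 0) (α β : (MvPolynomial (Fin n) K)[X])
    (h : Polynomial.C x ∣ α * (Polynomial.C u * r) + β * (Polynomial.C u * s)) :
    ∃ e, Polynomial.C x ∣ α - e * s ∧ Polynomial.C x ∣ β + e * r := by
  refine E.exists_koszul hrs hs α β ?_
  rw [E.C_dvd_iff] at h ⊢
  have e₁ : α * (Polynomial.C u * r) + β * (Polynomial.C u * s) =
    Polynomial.C u * (α * r + β * s) := by ring
  rw [e₁, Polynomial.map_mul, Polynomial.map_C] at h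
  exact (mul_eq_zero.mp h).resolve_left (Polynomial.C_ne_zero.mpr hu)

theorem isPrime_span_C_X (k : MvPolynomial (Fin n) K) :
    (span {Polynomial.C x, Polynomial.X + Polynomial.C k}).IsPrime := by
  let φ : (MvPolynomial (Fin n) K)[X] →+* MvPolynomial (Fin m) K :=
    E.πRing.comp (Polynomial.evalRingHom (-k))
  have : span {Polynomial.C x, Polynomial.X + Polynomial.C k} = RingHom.ker φ := by
    apply le_antisymm
    · rw [span_le]
      rintro _ (rfl | rfl)
      · simp [φ, RingHom.mem_ker, E.π_self]
      · simp [φ, RingHom.mem_ker]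
    · intro f hf
      obtain ⟨a, ha⟩ : x ∣ f.eval (-k) := by
        rw [← E.π_eq_zero_iff]
        exact hf
      obtain ⟨b, hb⟩ := Polynomial.X_sub_C_dvd_sub_C_eval (p := f) (a := -k)
      rw [ha] at hb
      refine mem_span_pair.mpr ⟨Polynomial.C a, b, ?_⟩
      simp only [Polynomial.C_mul, Polynomial.C_neg] at hb
      linear_combination -hb
  rw [this]
  exact RingHom.ker_isPrime _

end MvPolynomial.Elimination

/-! ### Pencils spanned by A₁X + G₁ and A₂X + G₂. -/

namespace MvPolynomial

open Ideal

variable {K : Type*} [Field K] {m : ℕ}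

/-- The polynomial `A X + G` over `K[x₁, …, xₘ]`. -/
noncomputable abbrev line (A G : MvPolynomial (Fin m) K) : Polynomial (MvPolynomial (Fin m) K) :=
  Polynomial.C A * Polynomial.X + Polynomial.C G

/-- `a` and `b` are non-proportional linear forms in the variables `x₁, …, xₘ, X`. -/
def IsLinearPair (a b : Polynomial (MvPolynomial (Fin m) K)) : Prop :=
  a ≠ 0 ∧ ¬ a ∣ b ∧ (∃ c ℓ, IsHomogeneous ℓ 1 ∧ a = line (C c) ℓ) ∧
    ∃ c ℓ, IsHomogeneous ℓ 1 ∧ b = line (C c) ℓ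

theorem isLinearPair_C_C {x y : MvPolynomial (Fin m) K} (hx : x.IsHomogeneous 1)
    (hy : y.IsHomogeneous 1) (hx0 : x ≠ 0) (hxy : ¬ x ∣ y) :
    IsLinearPair (Polynomial.C x) (Polynomial.C y) := by
  refine ⟨by simpa using hx0, ?_, ⟨0, x, hx, by simp [line]⟩, 0, y, hy, by simp [line]⟩
  rw [Polynomial.C_dvd_iff_dvd_coeff]
  exact fun h => hxy (by simpa using h 0)

theorem isLinearPair_C_X {x k : MvPolynomial (Fin m) K} (hx : x.IsHomogeneous 1)
    (hk : k.IsHomogeneous 1) (hx0 : x ≠ 0) :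
    IsLinearPair (Polynomial.C x) (Polynomial.X + Polynomial.C k) := by
  refine ⟨by simpa using hx0, ?_, ⟨0, x, hx, by simp [line]⟩, 1, k, hk, by simp [line]⟩
  rw [Polynomial.C_dvd_iff_dvd_coeff]
  intro h
  have := h 1
  simp only [Polynomial.coeff_add, Polynomial.coeff_X_one, Polynomial.coeff_C_succ, add_zero]
    at this
  exact hx.not_isUnit one_ne_zero (isUnit_of_dvd_one this)

theorem span_C_C (x y : MvPolynomial (Fin m) K) :
    span {Polynomial.C x, Polynomial.C y} =
      (span {x, y}).map (Polynomial.C : _ →+* Polynomial (MvPolynomial (Fin m) K)) := by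
  rw [map_span, Set.image_pair]

theorem isPrime_span_C_C {x y : MvPolynomial (Fin m) K} (h : (span {x, y}).IsPrime) :
    (span {Polynomial.C x, Polynomial.C y}).IsPrime := by
  rw [span_C_C]
  infer_instance

/-- No nonzero member of the pencil spanned by `A₁ X + G₁` and `A₂ X + G₂` has a linear factor
in `K[x₁, …, xₘ]`. -/
def NoLinearFactor (A₁ G₁ A₂ G₂ : MvPolynomial (Fin m) K) : Prop :=
  ∀ s t : K, s ≠ 0 ∨ t ≠ 0 → ∀ a, IsHomogeneous a 1 → a ≠ 0 →
    a ∣ C s * A₁ + C t * A₂ → ¬ a ∣ C s * G₁ + C t * G₂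

/-- The conclusion about a pencil without reducible members. -/
def LinearPrimeAlternative (I : Ideal (Polynomial (MvPolynomial (Fin m) K))) : Prop :=
  I.IsPrime ∨ ((∃ a b, IsLinearPair a b ∧ I ≤ span {a, b}) ∧
    (I.IsRadical ∨ ∃ a b, IsLinearPair a b ∧ I ≤ span {a, b} ∧ NotReducedAt I (span {a, b})))

/-! ### Independent coefficients A₁, A₂: the cubic resultant. -/

section Independent

variable {A₁ G₁ A₂ G₂ : MvPolynomial (Fin m) K}

/-- Modulo x one has A₂G₁ = A₁G₂ with A₁, A₂ still independent, so both Gᵢ are Aᵢ times a common k.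
Thus (x, X + k) contains the pencil. Independence persists because a combination sA₁ + tA₂ divisible
by x would, by `NoLinearFactor`, force x to divide both A₁ and A₂. -/
theorem exists_of_linear_dvd_resultant (hA₁ : A₁.IsHomogeneous 1) (hA₂ : A₂.IsHomogeneous 1)
    (hG₁ : G₁.IsHomogeneous 2) (hG₂ : G₂.IsHomogeneous 2) (hA₁0 : A₁ ≠ 0) (hA : ¬ A₁ ∣ A₂)
    (H : NoLinearFactor A₁ G₁ A₂ G₂) {x : MvPolynomial (Fin m) K} (hx : x.IsHomogeneous 1)
    (hx0 : x ≠ 0) (hdvd : x ∣ A₂ * G₁ - A₁ * G₂) :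
    ∃ k r₁ r₂, IsHomogeneous k 1 ∧ G₁ = A₁ * k + x * r₁ ∧ G₂ = A₂ * k + x * r₂ := by
  obtain ⟨m', -, ⟨E⟩⟩ := exists_elimination' hx hx0
  have hnd : ∀ s t : K, s ≠ 0 ∨ t ≠ 0 → ¬ x ∣ C s * A₁ + C t * A₂ := by
    intro s t hst hd
    have hG := H s t hst x hx hx0 hd
    have h₁ : x ∣ A₂ := by
      refine ((hx.prime hx0).dvd_or_dvd (?_ : x ∣ A₂ * _)).resolve_right hG
      have : A₂ * (C s * G₁ + C t * G₂) =
        C s * (A₂ * G₁ - A₁ * G₂) + G₂ * (C s * A₁ + C t * A₂) := by ring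
      rw [this]
      exact dvd_add (hdvd.mul_left _) (hd.mul_left _)
    have h₂ : x ∣ A₁ := by
      refine ((hx.prime hx0).dvd_or_dvd (?_ : x ∣ A₁ * _)).resolve_right hG
      have : A₁ * (C s * G₁ + C t * G₂) =
        -(C t * (A₂ * G₁ - A₁ * G₂)) + G₁ * (C s * A₁ + C t * A₂) := by ring
      rw [this]
      exact dvd_add (hdvd.mul_left _).neg_right (hd.mul_left _)
    have h₃ : Associated x A₁ :=
      (hx.irreducible hx0).associated_of_dvd (hA₁.irreducible hA₁0) h₂
    exact hA (h₃.symm.dvd.trans h₁)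
  have hπ₁ : E.π A₁ ≠ 0 := by
    rw [Ne, E.π_eq_zero_iff]
    simpa using hnd 1 0 (by simp)
  have hπ : ¬ E.π A₁ ∣ E.π A₂ := by
    intro h
    obtain ⟨t, ht⟩ := (E.π_hom hA₁).exists_C_mul_of_dvd (E.π_hom hA₂) hπ₁ h
    refine hnd (-t) 1 (by simp) ?_
    rw [← E.π_eq_zero_iff, map_add, map_mul, map_mul, ht, E.π_C, E.π_C]
    simp
  have hrel : E.π A₂ * E.π G₁ = E.π A₁ * E.π G₂ := by
    rw [← sub_eq_zero, ← map_mul, ← map_mul, ← map_sub, E.π_eq_zero_iff]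
    exact hdvd
  obtain ⟨k, hk⟩ : E.π A₁ ∣ E.π G₁ :=
    (((E.π_hom hA₁).prime hπ₁).dvd_or_dvd ⟨_, hrel⟩).resolve_left hπ
  have hk₂ : E.π G₂ = E.π A₂ * k :=
    mul_left_cancel₀ hπ₁ (by linear_combination -hrel + E.π A₂ * hk)
  have hkhom : k.IsHomogeneous 1 :=
    IsHomogeneous.mul_right_cancel (i := 1) (hk ▸ E.π_hom hG₁) (E.π_hom hA₁) hπ₁
  obtain ⟨r₁, -, h₁⟩ := E.exists_lift hG₁ hx hx0 (hA₁.mul (E.ι_hom hkhom))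
    (by rw [map_mul, E.π_ι, hk])
  obtain ⟨r₂, -, h₂⟩ := E.exists_lift hG₂ hx hx0 (hA₂.mul (E.ι_hom hkhom))
    (by rw [map_mul, E.π_ι, hk₂])
  exact ⟨E.ι k, r₁, r₂, E.ι_hom hkhom, h₁, h₂⟩

/-- Off A₁ = 0 the scheme is that of the cubic c. Inside A₁ = 0 the only possible extra component is
(A₁, A₂), and I is always reduced along it, so nonreducedness comes only from a repeated factor of
c. -/
theorem linearPrimeAlternative_of_independent (hA₁ : A₁.IsHomogeneous 1)
    (hA₂ : A₂.IsHomogeneous 1) (hG₁ : G₁.IsHomogeneous 2) (hG₂ : G₂.IsHomogeneous 2)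
    (hA₁0 : A₁ ≠ 0) (hA : ¬ A₁ ∣ A₂) (H : NoLinearFactor A₁ G₁ A₂ G₂) :
    LinearPrimeAlternative (span {line A₁ G₁, line A₂ G₂}) := by
  set I := span {line A₁ G₁, line A₂ G₂} with hI
  set c := A₂ * G₁ - A₁ * G₂ with hc
  have hchom : c.IsHomogeneous 3 := (hA₂.mul hG₁).sub (hA₁.mul hG₂)
  have hA₁G₁ : ¬ A₁ ∣ G₁ := by simpa using H 1 0 (by simp) A₁ hA₁ hA₁0 (by simp)
  have hA₁c : ¬ A₁ ∣ c := by
    intro h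
    have : A₁ ∣ A₂ * G₁ := by
      have := dvd_add h (dvd_mul_right A₁ G₂)
      rwa [hc, sub_add_cancel] at this
    exact ((hA₁.prime hA₁0).dvd_or_dvd this).elim hA hA₁G₁
  have hc0 : c ≠ 0 := fun h => hA₁c (h ▸ dvd_zero _)
  obtain ⟨m', -, ⟨E⟩⟩ := exists_elimination' hA₁ hA₁0
  have hπA₂ : E.π A₂ ≠ 0 := by rwa [Ne, E.π_eq_zero_iff]
  have hπG₁ : E.π G₁ ≠ 0 := by rwa [Ne, E.π_eq_zero_iff]
  -- components coming from linear factors of the resultant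
  have hlin : ∀ x, IsHomogeneous x 1 → x ∣ c → ∃ k r₁ r₂,
      IsLinearPair (Polynomial.C x) (Polynomial.X + Polynomial.C k) ∧
      I ≤ span {Polynomial.C x, Polynomial.X + Polynomial.C k} ∧
      c = x * (A₂ * r₁ - A₁ * r₂) ∧
      (x ∣ A₂ * r₁ - A₁ * r₂ →
        NotReducedAt I (span {Polynomial.C x, Polynomial.X + Polynomial.C k})) := by
    intro x hx hxc
    have hx0 : x ≠ 0 := by rintro rfl; exact hc0 (zero_dvd_iff.mp hxc)
    obtain ⟨k, r₁, r₂, hk, h₁, h₂⟩ :=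
      exists_of_linear_dvd_resultant hA₁ hA₂ hG₁ hG₂ hA₁0 hA H hx hx0 hxc
    have hpair := isLinearPair_C_X hx hk hx0
    have e₁ : Polynomial.C r₁ * Polynomial.C x + Polynomial.C A₁ *
        (Polynomial.X + Polynomial.C k) = line A₁ G₁ := by
      simp only [line, h₁, Polynomial.C_add, Polynomial.C_mul]; ring
    have e₂ : Polynomial.C r₂ * Polynomial.C x + Polynomial.C A₂ *
        (Polynomial.X + Polynomial.C k) = line A₂ G₂ := by
      simp only [line, h₂, Polynomial.C_add, Polynomial.C_mul]; ring
    refine ⟨k, r₁, r₂, hpair, ?_, by rw [hc, h₁, h₂]; ring, fun hd => ?_⟩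
    · rw [hI, span_le]
      rintro _ (rfl | rfl)
      exacts [mem_span_pair.mpr ⟨_, _, e₁⟩, mem_span_pair.mpr ⟨_, _, e₂⟩]
    -- The determinant at (x, X + k) is r₁A₂ - A₁r₂ = c / x; it lies in the prime when x² divides c.
    · obtain ⟨m'', -, ⟨E'⟩⟩ := exists_elimination' hx hx0
      have := notReducedAt_of_det_mem (p := Polynomial.C r₁) (z := Polynomial.C A₁)
        (k := Polynomial.C r₂) (v := Polynomial.C A₂) (Polynomial.prime_C_iff.mpr (hx.prime hx0))
        hpair.2.1 (E'.isPrime_span_C_X k) (by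
          refine mem_of_dvd _ ?_ (subset_span (Set.mem_insert _ _))
          have := map_dvd (Polynomial.C : _ →+* Polynomial (MvPolynomial (Fin m) K)) hd
          rw [Polynomial.C_sub, Polynomial.C_mul, Polynomial.C_mul] at this
          rwa [mul_comm (Polynomial.C r₁)])
      rwa [e₁, e₂] at this
  have hrad : Squarefree c ∨ ∃ a b, IsLinearPair a b ∧ I ≤ span {a, b} ∧
      NotReducedAt I (span {a, b}) := by
    by_cases hsq : Squarefree c
    · exact .inl hsq
    obtain ⟨i, j, u, v, hi, hij, hu, hv, huv⟩ := hchom.exists_sq_mul hc0 hsq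
    obtain rfl : i = 1 := by omega
    have hu0 : u ≠ 0 := by rintro rfl; exact hc0 (by rw [huv]; ring)
    obtain ⟨k, r₁, r₂, h₁, h₂, h₃, h₄⟩ := hlin u hu ⟨u * v, by rw [huv]; ring⟩
    refine .inr ⟨_, _, h₁, h₂, h₄ ⟨v, mul_left_cancel₀ hu0 ?_⟩⟩
    rw [← h₃, huv]; ring
  have hcI : Polynomial.C c ∈ I := mem_span_pair.mpr ⟨Polynomial.C A₂, -Polynomial.C A₁, by
    simp only [line, hc, Polynomial.C_sub, Polynomial.C_mul]; ring⟩
  obtain ⟨J, hIJ, hJ, hJrad, hJprime⟩ := Polynomial.exists_saturation (d := -1)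
    (H := Polynomial.C A₂) hcI (by
      simp only [line, hc, Polynomial.C_sub, Polynomial.C_mul, Polynomial.C_neg,
        Polynomial.C_1]
      ring)
  have hCA : Polynomial.C A₁ ≠ 0 := Polynomial.C_ne_zero.mpr hA₁0
  by_cases hP : E.π A₂ ∣ E.π G₁ ∧ E.π A₂ ∣ E.π G₂
  · -- `(A₁, A₂)` is a component
    obtain ⟨⟨b, hb⟩, ⟨d, hd⟩⟩ := hP
    have hbhom : b.IsHomogeneous 1 :=
      IsHomogeneous.mul_right_cancel (i := 1) (hb ▸ E.π_hom hG₁) (E.π_hom hA₂) hπA₂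
    have hdhom : d.IsHomogeneous 1 :=
      IsHomogeneous.mul_right_cancel (i := 1) (hd ▸ E.π_hom hG₂) (E.π_hom hA₂) hπA₂
    obtain ⟨p, -, hp⟩ := E.exists_lift hG₁ hA₁ hA₁0 (hA₂.mul (E.ι_hom hbhom))
      (by rw [map_mul, E.π_ι, hb])
    obtain ⟨q, -, hq⟩ := E.exists_lift hG₂ hA₁ hA₁0 (hA₂.mul (E.ι_hom hdhom))
      (by rw [map_mul, E.π_ι, hd])
    have e₁ : (Polynomial.X + Polynomial.C p) * Polynomial.C A₁ + Polynomial.C (E.ι b) *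
        Polynomial.C A₂ = line A₁ G₁ := by
      simp only [line, hp, Polynomial.C_add, Polynomial.C_mul]; ring
    have e₂ : Polynomial.C q * Polynomial.C A₁ + (Polynomial.X + Polynomial.C (E.ι d)) *
        Polynomial.C A₂ = line A₂ G₂ := by
      simp only [line, hq, Polynomial.C_add, Polynomial.C_mul]; ring
    have hpair := isLinearPair_C_C hA₁ hA₂ hA₁0 hA
    have hle : I ≤ span {Polynomial.C A₁, Polynomial.C A₂} := by
      rw [hI, span_le]
      rintro _ (rfl | rfl)
      exacts [mem_span_pair.mpr ⟨_, _, e₁⟩, mem_span_pair.mpr ⟨_, _, e₂⟩]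
    refine .inr ⟨⟨_, _, hpair, hle⟩, hrad.imp_left fun hsq => ?_⟩
    have hPB : (span {A₁, A₂}).IsPrime :=
      isPrime_span_linear_pair hA₁ hA₂ (linearIndependent_pair_of_not_dvd hA₁0 hA)
    have hPprime := isPrime_span_C_C hPB
    -- The determinant is monic of degree 2 in X, so it avoids the extension of the proper ideal
    -- (A₁, A₂).
    have hdet : (Polynomial.X + Polynomial.C p) * (Polynomial.X + Polynomial.C (E.ι d)) -
        Polynomial.C (E.ι b) * Polynomial.C q ∉ span {Polynomial.C A₁, Polynomial.C A₂} := by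
      rw [span_C_C, Ideal.mem_map_C_iff]
      intro h
      have h2 := h 2
      have e : (Polynomial.X + Polynomial.C p) * (Polynomial.X + Polynomial.C (E.ι d)) -
          Polynomial.C (E.ι b) * Polynomial.C q = Polynomial.X ^ 2 +
          (Polynomial.C (p + E.ι d) * Polynomial.X + Polynomial.C (p * E.ι d - E.ι b * q)) := by
        simp only [Polynomial.C_add, Polynomial.C_mul, Polynomial.C_sub]; ring
      rw [e] at h2
      simp only [Polynomial.coeff_add, Polynomial.coeff_X_pow_self, Polynomial.coeff_C_mul,
        Polynomial.coeff_C_succ, Polynomial.coeff_X, OfNat.one_ne_ofNat, if_false, mul_zero,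
        add_zero] at h2
      exact hPB.ne_top ((eq_top_iff_one _).mpr h2)
    have hstep : ∀ F ∈ span {Polynomial.C A₁, Polynomial.C A₂}, Polynomial.C A₁ * F ∈ I →
        F ∈ I := by
      intro F hFP hF
      rw [hI, ← e₁, ← e₂] at hF ⊢
      refine mem_of_mul_mem_of_det_notMem hCA ?_ hPprime hdet hFP hF
      have hb0 : b ≠ 0 := by rintro rfl; exact hπG₁ (by rw [hb, mul_zero])
      refine E.exists_koszul' hπA₂ ?_ ?_
      · have := Polynomial.isRelPrime_C_of_forall (a := 1) (h := d) hb0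
          fun _ _ h _ => isUnit_of_dvd_one h
        simpa [E.π_ι] using this
      · simpa [E.π_ι] using Polynomial.X_add_C_ne_zero d
    have hIeq : I = J ⊓ span {Polynomial.C A₁, Polynomial.C A₂} := by
      refine le_antisymm (le_inf hIJ hle) fun F hF => ?_
      obtain ⟨N, hN⟩ := hJ F hF.1
      exact Polynomial.C_pow_mul_mem hstep hF.2 hN
    rw [hIeq]
    exact (hJrad (span_singleton_isRadical_of_squarefree hsq)).inf hPprime.isRadical
  -- Otherwise A₁ is a nonzerodivisor modulo I. Modulo A₁ the generators become G₁ and A₂X + G₂; a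
  -- nonunit common divisor would be associated to A₂ and divide both Gᵢ, the excluded case.
  · have hstep : ∀ F ∈ (⊤ : Ideal _), Polynomial.C A₁ * F ∈ I → F ∈ I := by
      intro F _ hF
      refine mem_span_pair_of_mul_mem hCA (E.exists_koszul ?_ ?_) hF
      · have e₁ : (line A₁ G₁).map E.πRing = Polynomial.C (E.π G₁) := by
          simp [line, E.π_self]
        have e₂ : (line A₂ G₂).map E.πRing = Polynomial.C (E.π A₂) * Polynomial.X +
          Polynomial.C (E.π G₂) := by simp [line]
        rw [e₁, e₂]
        refine Polynomial.isRelPrime_C_of_forall hπG₁ fun d h₁ h₂ h₃ => ?_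
        obtain ⟨w, hw⟩ := h₂
        rcases ((E.π_hom hA₂).irreducible hπA₂).isUnit_or_isUnit hw with hu | hu
        · exact hu
        · have : E.π A₂ ∣ d := by
            rw [hw]; exact (hu.mul_right_dvd).mpr dvd_rfl
          exact absurd ⟨this.trans h₁, this.trans h₃⟩ hP
      · intro h
        have := congrArg (fun p => Polynomial.coeff p 1) h
        simp [line] at this
        exact hπA₂ this
    have hIeq : I = J := by
      refine le_antisymm hIJ fun F hF => ?_
      obtain ⟨N, hN⟩ := hJ F hF
      exact Polynomial.C_pow_mul_mem hstep Submodule.mem_top hN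
    by_cases hirr : Irreducible c
    · left
      rw [hIeq]
      refine hJprime hirr.prime fun N hN => ?_
      obtain ⟨w, hw⟩ := hirr.prime.dvd_of_dvd_pow hN
      rcases (hA₁.irreducible hA₁0).isUnit_or_isUnit hw with hu | hu
      · exact hirr.not_isUnit hu
      · exact hA₁c (by rw [hw]; exact (hu.mul_right_dvd).mpr dvd_rfl)
    · obtain ⟨x, y, hx, -, hxy⟩ :=
        hchom.exists_linear_mul_of_not_irreducible le_rfl hc0 hirr
      obtain ⟨k, r₁, r₂, h₁, h₂, -⟩ := hlin x hx ⟨y, hxy⟩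
      refine .inr ⟨⟨_, _, h₁, h₂⟩, hrad.imp_left fun hsq => ?_⟩
      rw [hIeq]
      exact hJrad (span_singleton_isRadical_of_squarefree hsq)

end Independent

end MvPolynomial

/-! ### Proportional coefficients: a cone over an irreducible quadric. -/

namespace MvPolynomial

open Ideal

variable {K : Type*} [Field K] {m : ℕ} {A₁ G₁ A₂ G₂ : MvPolynomial (Fin m) K}

/-- G₂ must be irreducible, so the saturation J by A₁ is prime. If G₁, G₂ remain coprime modulo A₁,
then I = J. If they acquire a common linear factor u, the prime (A₁, u) also contains I, and the
determinant decides between I = J ∩ (A₁, u) and nonreducedness there. -/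
theorem linearPrimeAlternative_of_constant (hA : A₁.IsHomogeneous 1)
    (hG₁ : G₁.IsHomogeneous 2) (hG₂ : G₂.IsHomogeneous 2)
    (hA0 : A₁ ≠ 0) (H : NoLinearFactor A₁ G₁ 0 G₂) :
    LinearPrimeAlternative (span {line A₁ G₁, line 0 G₂}) := by
  set I := span {line A₁ G₁, line 0 G₂} with hI
  have hAG₁ : ∀ s, ¬ A₁ ∣ G₁ + C s * G₂ := fun s => by
    simpa using H 1 s (by simp) A₁ hA hA0 (by simp)
  have hAG₂ : ¬ A₁ ∣ G₂ := by simpa using H 0 1 (by simp) A₁ hA hA0 (by simp)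
  have hG₂0 : G₂ ≠ 0 := fun h => hAG₂ (h ▸ dvd_zero _)
  have hirr : Irreducible G₂ := by
    by_contra hirr
    obtain ⟨x, y, hx, -, hxy⟩ := hG₂.exists_linear_mul_of_not_irreducible one_le_two hG₂0 hirr
    have hx0 : x ≠ 0 := by rintro rfl; exact hG₂0 (by rw [hxy, zero_mul])
    exact H 0 1 (by simp) x hx hx0 (by simp) (by simp [hxy])
  obtain ⟨m', -, ⟨E⟩⟩ := exists_elimination' hA hA0
  have hCA : Polynomial.C A₁ ≠ 0 := Polynomial.C_ne_zero.mpr hA0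
  have hπG₂ : E.π G₂ ≠ 0 := by rwa [Ne, E.π_eq_zero_iff]
  have hπG₁ : E.π G₁ ≠ 0 := by
    rw [Ne, E.π_eq_zero_iff]; simpa using hAG₁ 0
  have hprop : ∀ s, E.π G₁ ≠ C s * E.π G₂ := by
    intro s hs
    refine hAG₁ (-s) ((E.π_eq_zero_iff _).mp ?_)
    rw [map_add, map_mul, hs, E.π_C]
    simp
  obtain ⟨J, hIJ, hJ, -, hJprime⟩ := Polynomial.exists_saturation (A := A₁) (G := G₁)
    (Q := line 0 G₂) (c := G₂) (d := A₁) (H := 0)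
    (mem_span_pair.mpr ⟨0, 1, by simp [line]⟩) (by simp [line])
  replace hJprime : J.IsPrime := by
    refine hJprime hirr.prime fun N hN => ?_
    obtain ⟨w, hw⟩ := hirr.prime.dvd_of_dvd_pow hN
    rcases (hA.irreducible hA0).isUnit_or_isUnit hw with hu | hu
    · exact hirr.not_isUnit hu
    · exact hAG₂ (by rw [hw]; exact (hu.mul_right_dvd).mpr dvd_rfl)
  by_cases hrel : IsRelPrime (E.π G₁) (E.π G₂)
  · left
    have hstep : ∀ F ∈ (⊤ : Ideal _), Polynomial.C A₁ * F ∈ I → F ∈ I := by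
      intro F _ hF
      have e₁ : (line A₁ G₁).map E.πRing = Polynomial.C (E.π G₁) := by
        simp [line, E.π_self]
      have e₂ : (line 0 G₂).map E.πRing = Polynomial.C (E.π G₂) := by
        simp [line]
      refine mem_span_pair_of_mul_mem hCA (E.exists_koszul ?_ ?_) hF
      · rw [e₁, e₂]
        simpa using Polynomial.isRelPrime_C_of_forall (a := 0) hπG₁
          fun d h₁ _ h₂ => hrel h₁ h₂
      · rw [e₂]
        simpa using hπG₂
    have hIeq : I = J := by
      refine le_antisymm hIJ fun F hF => ?_
      obtain ⟨N, hN⟩ := hJ F hF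
      exact Polynomial.C_pow_mul_mem hstep Submodule.mem_top hN
    rw [hIeq]
    exact hJprime
  · simp only [IsRelPrime, not_forall] at hrel
    obtain ⟨u, ⟨z, hz⟩, ⟨v, hv⟩, hu⟩ := hrel
    obtain ⟨i, j, hij, hui, hzj⟩ := (hz ▸ E.π_hom hG₁).exists_of_mul (hz ▸ hπG₁)
    obtain ⟨i', j', hij', hui', hvj⟩ := (hv ▸ E.π_hom hG₂).exists_of_mul (hv ▸ hπG₂)
    have hu0 : u ≠ 0 := by rintro rfl; exact hπG₁ (by rw [hz, zero_mul])
    have hz0 : z ≠ 0 := by rintro rfl; exact hπG₁ (by rw [hz, mul_zero])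
    have hv0 : v ≠ 0 := by rintro rfl; exact hπG₂ (by rw [hv, mul_zero])
    obtain rfl := hui.inj_right hui' hu0
    obtain rfl : j = j' := by omega
    -- Proportional v and z would make some G₁ - sG₂ divisible by A₁. Hence the common divisor u has
    -- degree exactly 1.
    have hvz : ¬ v ∣ z := by
      intro h
      obtain ⟨s, hs⟩ := hvj.exists_C_mul_of_dvd hzj hv0 h
      exact hprop s (by rw [hz, hv, hs]; ring)
    have hi0 : i ≠ 0 := by rintro rfl; exact hu (hui.isUnit hu0)
    have hj0 : j ≠ 0 := by rintro rfl; exact hvz (hvj.isUnit hv0).dvd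
    obtain rfl : i = 1 := by omega
    obtain rfl : j = 1 := by omega
    obtain ⟨y, -, hy⟩ := E.exists_lift hG₁ hA hA0 ((E.ι_hom hui).mul (E.ι_hom hzj))
      (by rw [map_mul, E.π_ι, E.π_ι, hz])
    obtain ⟨k, -, hk⟩ := E.exists_lift hG₂ hA hA0 ((E.ι_hom hui).mul (E.ι_hom hvj))
      (by rw [map_mul, E.π_ι, E.π_ι, hv])
    have e₁ : (Polynomial.X + Polynomial.C y) * Polynomial.C A₁ + Polynomial.C (E.ι z) *
        Polynomial.C (E.ι u) = line A₁ G₁ := by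
      simp only [line, hy, Polynomial.C_add, Polynomial.C_mul]; ring
    have e₂ : Polynomial.C k * Polynomial.C A₁ + Polynomial.C (E.ι v) *
        Polynomial.C (E.ι u) = line 0 G₂ := by
      simp only [line, hk, Polynomial.C_add, Polynomial.C_mul, Polynomial.C_0]; ring
    have hAu : ¬ A₁ ∣ E.ι u := by rwa [← E.π_eq_zero_iff, E.π_ι]
    have hpair := isLinearPair_C_C hA (E.ι_hom hui) hA0 hAu
    have hle : I ≤ span {Polynomial.C A₁, Polynomial.C (E.ι u)} := by
      rw [hI, span_le]
      rintro _ (rfl | rfl)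
      exacts [mem_span_pair.mpr ⟨_, _, e₁⟩, mem_span_pair.mpr ⟨_, _, e₂⟩]
    have hP := isPrime_span_C_C (isPrime_span_linear_pair hA (E.ι_hom hui)
      (linearIndependent_pair_of_not_dvd hA0 hAu))
    refine .inr ⟨⟨_, _, hpair, hle⟩, ?_⟩
    by_cases hdet : (Polynomial.X + Polynomial.C y) * Polynomial.C (E.ι v) -
        Polynomial.C (E.ι z) * Polynomial.C k ∈ span {Polynomial.C A₁, Polynomial.C (E.ι u)}
    · have := notReducedAt_of_det_mem (Polynomial.prime_C_iff.mpr (hA.prime hA0)) hpair.2.1 hP hdet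
      rw [e₁, e₂] at this
      exact .inr ⟨_, _, hpair, hle, this⟩
    · left
      have hstep : ∀ F ∈ span {Polynomial.C A₁, Polynomial.C (E.ι u)},
          Polynomial.C A₁ * F ∈ I → F ∈ I := by
        intro F hFP hF
        rw [hI, ← e₁, ← e₂] at hF ⊢
        refine mem_of_mul_mem_of_det_notMem hCA (E.exists_koszul' ?_ ?_ ?_) hP hdet hFP hF
        · rwa [E.π_ι]
        · have := Polynomial.isRelPrime_C_of_forall (a := 0) (h := v) hz0 fun d h₁ _ h₂ => by
            obtain ⟨w, hw⟩ := h₂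
            rcases (hvj.irreducible hv0).isUnit_or_isUnit hw with hu | hu
            · exact hu
            · have : v ∣ d := by rw [hw]; exact (hu.mul_right_dvd).mpr dvd_rfl
              exact absurd (this.trans h₁) hvz
          simpa [E.π_ι] using this
        · simpa [E.π_ι] using hv0
      have hIeq : I = J ⊓ span {Polynomial.C A₁, Polynomial.C (E.ι u)} := by
        refine le_antisymm (le_inf hIJ hle) fun F hF => ?_
        obtain ⟨N, hN⟩ := hJ F hF.1
        exact Polynomial.C_pow_mul_mem hstep hF.2 hN
      rw [hIeq]
      exact hJprime.isRadical.inf hP.isRadical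

/-- Proportional coefficients are reduced to A₂ = 0 by subtracting r times the first generator.
`NoLinearFactor` concerns the whole pencil, so it survives with s replaced by s - t r. -/
theorem linearPrimeAlternative_aux (hA₁ : A₁.IsHomogeneous 1)
    (hA₂ : A₂.IsHomogeneous 1) (hG₁ : G₁.IsHomogeneous 2) (hG₂ : G₂.IsHomogeneous 2)
    (hA₁0 : A₁ ≠ 0) (H : NoLinearFactor A₁ G₁ A₂ G₂) :
    LinearPrimeAlternative (span {line A₁ G₁, line A₂ G₂}) := by
  by_cases hA : A₁ ∣ A₂
  · obtain ⟨r, rfl⟩ := hA₁.exists_C_mul_of_dvd hA₂ hA₁0 hA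
    have := linearPrimeAlternative_of_constant (G₂ := G₂ - C r * G₁) hA₁ hG₁
      (hG₂.sub (hG₁.C_mul r)) hA₁0 fun s t hst a ha ha0 hd hd' => by
        refine H (s - t * r) t ?_ a ha ha0 ?_ ?_
        · by_cases ht : t = 0
          · simpa [ht] using hst
          · exact .inr ht
        · simp only [C_sub, C_mul]
          have e : (C s - C t * C r) * A₁ + C t * (C r * A₁) = C s * A₁ + C t * 0 := by ring
          rwa [e]
        · simp only [C_sub, C_mul]
          have e : (C s - C t * C r) * G₁ + C t * G₂ = C s * G₁ + C t * (G₂ - C r * G₁) := by ring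
          rwa [e]
    have e : span {line A₁ G₁, line 0 (G₂ - C r * G₁)} =
        span {line A₁ G₁, line (C r * A₁) G₂} := by
      have e' : line 0 (G₂ - C r * G₁) =
          line (C r * A₁) G₂ + Polynomial.C (C (-r)) * line A₁ G₁ := by
        simp only [line, Polynomial.C_sub, Polynomial.C_mul, Polynomial.C_0, C_neg,
          Polynomial.C_neg]
        ring
      rw [e', mul_comm (Polynomial.C _), span_pair_add_left_mul]
    rwa [e] at this
  · exact linearPrimeAlternative_of_independent hA₁ hA₂ hG₁ hG₂ hA₁0 hA H

theorem linearPrimeAlternative (hA₁ : A₁.IsHomogeneous 1)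
    (hA₂ : A₂.IsHomogeneous 1) (hG₁ : G₁.IsHomogeneous 2) (hG₂ : G₂.IsHomogeneous 2)
    (hA : A₁ ≠ 0 ∨ A₂ ≠ 0) (H : NoLinearFactor A₁ G₁ A₂ G₂) :
    LinearPrimeAlternative (span {line A₁ G₁, line A₂ G₂}) := by
  by_cases hA₁0 : A₁ = 0
  · rw [span_pair_comm]
    refine linearPrimeAlternative_aux hA₂ hA₁ hG₂ hG₁ (hA.resolve_left (· hA₁0))
      fun s t hst a ha ha0 hd => ?_
    rw [add_comm] at hd ⊢
    exact H t s hst.symm a ha ha0 hd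
  · exact linearPrimeAlternative_aux hA₁ hA₂ hG₁ hG₂ hA₁0 H

end MvPolynomial

/-! ### Common zeros of two quadratic forms. -/

section BinaryForms

variable {K : Type*} [Field K] [IsAlgClosed K] [CharZero K]

theorem exists_quadratic_root {a : K} (ha : a ≠ 0) (b c : K) :
    ∃ x, a * (x * x) + b * x + c = 0 := by
  obtain ⟨s, hs⟩ := IsAlgClosed.exists_pow_nat_eq (discrim a b c) (n := 2) two_pos
  exact exists_quadratic_eq_zero ha ⟨s, by rw [← hs, sq]⟩

theorem exists_binary_quadratic_zero (a b c : K) :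
    ∃ α β : K, (α ≠ 0 ∨ β ≠ 0) ∧ a * α ^ 2 + b * (α * β) + c * β ^ 2 = 0 := by
  by_cases ha : a = 0
  · exact ⟨1, 0, by simp, by simp [ha]⟩
  · obtain ⟨x, hx⟩ := exists_quadratic_root ha b c
    exact ⟨x, 1, by simp, by linear_combination hx⟩

theorem exists_binary_quadratic_factor (a b c : K) :
    ∃ α β γ δ : K, α * γ = a ∧ α * δ + β * γ = b ∧ β * δ = c := by
  by_cases ha : a = 0
  · exact ⟨0, 1, b, c, by simp [ha], by simp, by simp⟩
  · obtain ⟨x, hx⟩ := exists_quadratic_root ha b c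
    exact ⟨1, -x, a, b + a * x, by ring, by ring, by linear_combination -hx⟩

end BinaryForms

section Bilinear

variable {K E : Type*} [Field K] [IsAlgClosed K] [CharZero K] [AddCommGroup E] [Module K E]
  [FiniteDimensional K E]

open Module

/-- Two linear maps between spaces of the same nonzero dimension have a linear combination with
a nontrivial kernel. -/
theorem exists_pencil_kernel {F : Type*} [AddCommGroup F] [Module K F] [FiniteDimensional K F]
    [Nontrivial E] (h : finrank K E = finrank K F) (f g : E →ₗ[K] F) :
    ∃ s t : K, (s ≠ 0 ∨ t ≠ 0) ∧ ∃ v ≠ 0, s • f v + t • g v = 0 := by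
  by_cases hg : Function.Injective g
  · let e := LinearEquiv.ofInjectiveOfFinrankEq g hg h
    have he : ∀ v, e v = g v := fun v => rfl
    obtain ⟨μ, hμ⟩ := Module.End.exists_eigenvalue (e.symm.toLinearMap ∘ₗ f)
    obtain ⟨v, hv⟩ := hμ.exists_hasEigenvector
    refine ⟨1, -μ, .inl one_ne_zero, v, hv.2, ?_⟩
    have h1 : f v = μ • g v := by
      have h2 := congrArg e hv.apply_eq_smul
      rwa [LinearMap.comp_apply, LinearEquiv.coe_coe, LinearEquiv.apply_symm_apply, map_smul,
        he] at h2
    rw [h1]; simp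
  · rw [← LinearMap.ker_eq_bot, Submodule.eq_bot_iff] at hg
    push Not at hg
    obtain ⟨v, hv, hv0⟩ := hg
    exact ⟨0, 1, .inr one_ne_zero, v, hv0, by rw [LinearMap.mem_ker.mp hv]; simp⟩

/-- Two quadratic forms have a common zero outside the common kernel, unless this kernel has
codimension at most two. -/
theorem exists_common_zero (b₁ b₂ : LinearMap.BilinForm K E) (h₁ : ∀ u v, b₁ u v = b₁ v u)
    (h₂ : ∀ u v, b₂ u v = b₂ v u) :
    (∃ p, b₁ p p = 0 ∧ b₂ p p = 0 ∧ ∃ u, b₁ p u ≠ 0 ∨ b₂ p u ≠ 0) ∨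
    ∃ u₁ u₂, ∀ v, ∃ s t : K, ∀ w, b₁ (v - (s • u₁ + t • u₂)) w = 0 := by
  let V : Submodule K E := LinearMap.ker b₁ ⊓ LinearMap.ker b₂
  have hV : ∀ v, v ∈ V ↔ (∀ w, b₁ v w = 0) ∧ ∀ w, b₂ v w = 0 := fun v => by
    simp only [V, Submodule.mem_inf, LinearMap.mem_ker, LinearMap.ext_iff, LinearMap.zero_apply]
  by_cases hspan : ∃ u₁ u₂, V ⊔ Submodule.span K {u₁, u₂} = ⊤
  · right
    obtain ⟨u₁, u₂, hu⟩ := hspan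
    refine ⟨u₁, u₂, fun v => ?_⟩
    obtain ⟨w, hw, z, hz, rfl⟩ := Submodule.mem_sup.mp (hu ▸ Submodule.mem_top : v ∈ _)
    obtain ⟨s, t, rfl⟩ := Submodule.mem_span_pair.mp hz
    exact ⟨s, t, by simpa using ((hV w).mp hw).1⟩
  left
  push Not at hspan
  obtain ⟨W, hW⟩ := V.exists_isCompl
  have hWspan : ∀ u v, ∃ w ∈ W, w ∉ Submodule.span K {u, v} := by
    intro u v
    by_contra! h
    exact hspan u v (eq_top_iff.mpr (hW.sup_eq_top ▸ sup_le_sup_left h V))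
  have : Nontrivial W := by
    obtain ⟨w, hw, hw'⟩ := hWspan 0 0
    refine ⟨⟨w, hw⟩, 0, fun h => hw' ?_⟩
    rw [show w = 0 from congrArg Subtype.val h]
    exact zero_mem _
  -- On the complement W of the common kernel V, both forms are maps from W to its dual, so some
  -- combination is degenerate, with kernel vector v; adding back V changes nothing.
  obtain ⟨s, t, hst, v, hv0, hv⟩ := exists_pencil_kernel (K := K) (E := W) (F := Dual K W)
    Subspace.dual_finrank_eq.symm (b₁.domRestrict₁₂ W W) (b₂.domRestrict₁₂ W W)
  have hvM : ∀ w, s * b₁ v w + t * b₂ v w = 0 := by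
    intro w
    obtain ⟨x, hx, y, hy, rfl⟩ := Submodule.mem_sup.mp (hW.sup_eq_top ▸ Submodule.mem_top : w ∈ _)
    have h3 := LinearMap.congr_fun hv ⟨y, hy⟩
    simp only [LinearMap.add_apply, LinearMap.smul_apply, LinearMap.domRestrict₁₂_apply,
      smul_eq_mul, LinearMap.zero_apply] at h3
    rw [map_add, map_add, h₁ _ x, h₂ _ x, ((hV x).mp hx).1, ((hV x).mp hx).2, zero_add, zero_add]
    exact h3
  -- The vectors v, u₁, u₂ are independent, so any nontrivial combination of u₁, u₂ is independent
  -- of v; one such u is isotropic for the degenerate form.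
  obtain ⟨u₁, hu₁, hu₁'⟩ := hWspan v v
  obtain ⟨u₂, hu₂, hu₂'⟩ := hWspan v u₁
  obtain ⟨α, β, hαβ, hab⟩ := exists_binary_quadratic_zero (s * b₁ u₁ u₁ + t * b₂ u₁ u₁)
    (2 * (s * b₁ u₁ u₂ + t * b₂ u₁ u₂)) (s * b₁ u₂ u₂ + t * b₂ u₂ u₂)
  set u := α • u₁ + β • u₂ with hu
  have huW : u ∈ W := add_mem (W.smul_mem _ hu₁) (W.smul_mem _ hu₂)
  have huv : ∀ γ : K, u ≠ γ • (v : E) := by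
    intro γ h
    by_cases hβ : β = 0
    · have hα : α ≠ 0 := by simpa [hβ] using hαβ
      refine hu₁' (Submodule.mem_span_pair.mpr ⟨α⁻¹ * γ, 0, ?_⟩)
      rw [zero_smul, add_zero, mul_smul, ← h, hu, hβ, zero_smul, add_zero, inv_smul_smul₀ hα]
    · refine hu₂' (Submodule.mem_span_pair.mpr ⟨β⁻¹ * γ, -(β⁻¹ * α), ?_⟩)
      rw [mul_smul, ← h, hu, smul_add, inv_smul_smul₀ hβ, neg_smul, mul_smul]
      abel
  have huM : s * b₁ u u + t * b₂ u u = 0 := by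
    simp only [hu, map_add, map_smul, LinearMap.add_apply, LinearMap.smul_apply, smul_eq_mul,
      h₁ u₂ u₁, h₂ u₂ u₁]
    linear_combination hab
  have hline : ∀ γ δ : K, s * b₁ (γ • (v : E) + δ • u) (γ • (v : E) + δ • u) +
      t * b₂ (γ • (v : E) + δ • u) (γ • (v : E) + δ • u) = 0 := by
    intro γ δ
    simp only [map_add, map_smul, LinearMap.add_apply, LinearMap.smul_apply, smul_eq_mul,
      h₁ u v, h₂ u v]
    linear_combination γ ^ 2 * hvM v + 2 * γ * δ * hvM u + δ ^ 2 * huM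
  -- The combination s b₁ + t b₂ vanishes on the plane spanned by v and u. Since s or t is nonzero,
  -- an isotropic vector there for one suitably chosen form is isotropic for both.
  have hfinal : ∃ γ δ : K, (γ ≠ 0 ∨ δ ≠ 0) ∧
      b₁ (γ • (v : E) + δ • u) (γ • (v : E) + δ • u) = 0 ∧
      b₂ (γ • (v : E) + δ • u) (γ • (v : E) + δ • u) = 0 := by
    have key : ∀ b : LinearMap.BilinForm K E, (∀ x y, b x y = b y x) →
        ∃ γ δ : K, (γ ≠ 0 ∨ δ ≠ 0) ∧ b (γ • (v : E) + δ • u) (γ • (v : E) + δ • u) = 0 := by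
      intro b hb
      obtain ⟨γ, δ, hγδ, h⟩ := exists_binary_quadratic_zero (b v v) (2 * b v u) (b u u)
      refine ⟨γ, δ, hγδ, ?_⟩
      simp only [map_add, map_smul, LinearMap.add_apply, LinearMap.smul_apply, smul_eq_mul,
        hb u v]
      linear_combination h
    by_cases hs : s = 0
    · have ht : t ≠ 0 := by simpa [hs] using hst
      obtain ⟨γ, δ, hγδ, h⟩ := key b₁ h₁
      refine ⟨γ, δ, hγδ, h, ?_⟩
      have := hline γ δ
      rw [h, mul_zero, zero_add] at this
      exact (mul_eq_zero.mp this).resolve_left ht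
    · obtain ⟨γ, δ, hγδ, h⟩ := key b₂ h₂
      refine ⟨γ, δ, hγδ, ?_, h⟩
      have := hline γ δ
      rw [h, mul_zero, add_zero] at this
      exact (mul_eq_zero.mp this).resolve_left hs
  obtain ⟨γ, δ, hγδ, hp₁, hp₂⟩ := hfinal
  refine ⟨_, hp₁, hp₂, ?_⟩
  by_contra! hcon
  have hpV : γ • (v : E) + δ • u ∈ V := (hV _).mpr ⟨fun w => (hcon w).1, fun w => (hcon w).2⟩
  have hpW : γ • (v : E) + δ • u ∈ W := add_mem (W.smul_mem _ v.2) (W.smul_mem _ huW)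
  have hp0 : γ • (v : E) + δ • u = 0 := by
    have := hW.inf_eq_bot ▸ Submodule.mem_inf.mpr ⟨hpV, hpW⟩
    simpa using this
  by_cases hδ : δ = 0
  · have hγ : γ ≠ 0 := by simpa [hδ] using hγδ
    rw [hδ, zero_smul, add_zero] at hp0
    exact hv0 (Subtype.ext ((smul_eq_zero.mp hp0).resolve_left hγ))
  · refine huv (-(δ⁻¹ * γ)) ?_
    rw [neg_smul, mul_smul, eq_neg_iff_add_eq_zero, add_comm, ← inv_smul_smul₀ hδ u, ← smul_add,
      hp0, smul_zero]

end Bilinear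

/-! ### Quadrics as symmetric bilinear forms, and base points. -/

namespace MvPolynomial

variable {K : Type*} [Field K]

theorem IsHomogeneous.exists_bilinForm [CharZero K] {n : ℕ} {Q : MvPolynomial (Fin n) K}
    (hQ : Q.IsHomogeneous 2) :
    ∃ b : LinearMap.BilinForm K (Fin n → K), (∀ u v, b u v = b v u) ∧
      ∀ v, eval v Q = b v v := by
  have key : ∀ i, ∃ c : Fin n → K, pderiv i Q = ∑ j, c j • X j := fun i =>
    isHomogeneous_one_eq_sum hQ.pderiv
  choose c hc using key
  -- By Euler's identity the coefficients c of the partial derivatives satisfy ∑ c i j vᵢvⱼ = 2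
  -- Q(v); symmetrizing costs another factor 2, hence the 4.
  refine ⟨Matrix.toBilin' (Matrix.of fun i j => (c i j + c j i) / 4), fun u v => ?_, fun v => ?_⟩
  · rw [Matrix.toBilin'_apply, Matrix.toBilin'_apply, Finset.sum_comm]
    refine Finset.sum_congr rfl fun i _ => Finset.sum_congr rfl fun j _ => ?_
    simp only [Matrix.of_apply]
    ring
  · have h := congrArg (eval v) hQ.sum_X_mul_pderiv
    simp only [hc, map_sum, map_mul, eval_X, nsmul_eq_mul, Nat.cast_ofNat, map_ofNat,
      smul_eq_C_mul, eval_C, Finset.mul_sum] at h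
    have h' := h
    rw [Finset.sum_comm] at h'
    rw [Matrix.toBilin'_apply]
    have h4 : (4 : K) ≠ 0 := by norm_num
    rw [← mul_right_inj' h4]
    have e : (4 : K) * eval v Q = 2 * eval v Q + 2 * eval v Q := by ring
    rw [e]
    nth_rewrite 1 [← h]
    rw [← h', ← Finset.sum_add_distrib, Finset.mul_sum]
    refine Finset.sum_congr rfl fun i _ => ?_
    rw [← Finset.sum_add_distrib, Finset.mul_sum]
    refine Finset.sum_congr rfl fun j _ => ?_
    simp only [Matrix.of_apply]
    field_simp

/-- Two quadratic forms have a common zero which is not a vertex of both of them, unless the first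
one is reducible. -/
theorem exists_base_point [IsAlgClosed K] [CharZero K] {n : ℕ} {Q₁ Q₂ : MvPolynomial (Fin n) K}
    (hQ₁ : Q₁.IsHomogeneous 2) (hQ₂ : Q₂.IsHomogeneous 2) :
    (∃ p, eval p Q₁ = 0 ∧ eval p Q₂ = 0 ∧
      ∃ u, eval (u + p) Q₁ ≠ eval u Q₁ ∨ eval (u + p) Q₂ ≠ eval u Q₂) ∨
    ∃ x y, IsHomogeneous x 1 ∧ IsHomogeneous y 1 ∧ Q₁ = x * y := by
  obtain ⟨b₁, hs₁, hb₁⟩ := hQ₁.exists_bilinForm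
  obtain ⟨b₂, hs₂, hb₂⟩ := hQ₂.exists_bilinForm
  rcases exists_common_zero b₁ b₂ hs₁ hs₂ with ⟨p, hp₁, hp₂, u, hu⟩ | ⟨u₁, u₂, h⟩
  · refine .inl ⟨p, by rw [hb₁, hp₁], by rw [hb₂, hp₂], u, hu.imp ?_ ?_⟩
    · intro hne heq
      rw [hb₁, hb₁] at heq
      simp only [map_add, LinearMap.add_apply, hp₁, hs₁ u p] at heq
      refine hne ?_
      have : (2 : K) * b₁ p u = 0 := by linear_combination heq
      simpa using this
    · intro hne heq
      rw [hb₂, hb₂] at heq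
      simp only [map_add, LinearMap.add_apply, hp₂, hs₂ u p] at heq
      refine hne ?_
      have : (2 : K) * b₂ p u = 0 := by linear_combination heq
      simpa using this
  · right
    choose s t hst using h
    let e : Fin n → Fin n → K := fun i => Pi.single i 1
    -- The chosen s, t need not be linear in v, so linear forms are rebuilt from their values on
    -- basis vectors. Then Q₁ is a binary quadratic form in S and T, which splits over an
    -- algebraically closed field.
    set S : MvPolynomial (Fin n) K := ∑ i, C (s (e i)) * X i with hS
    set T : MvPolynomial (Fin n) K := ∑ i, C (t (e i)) * X i with hT
    have hShom : S.IsHomogeneous 1 :=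
      IsHomogeneous.sum _ _ _ fun i _ => (isHomogeneous_X _ _).C_mul _
    have hThom : T.IsHomogeneous 1 :=
      IsHomogeneous.sum _ _ _ fun i _ => (isHomogeneous_X _ _).C_mul _
    obtain ⟨α, β, γ, δ, h₁, h₂, h₃⟩ := exists_binary_quadratic_factor (b₁ u₁ u₁) (2 * b₁ u₁ u₂)
      (b₁ u₂ u₂)
    refine ⟨C α * S + C β * T, C γ * S + C δ * T, (hShom.C_mul _).add (hThom.C_mul _),
      (hShom.C_mul _).add (hThom.C_mul _), funext fun v => ?_⟩
    have hker : ∀ w, b₁ (v - (eval v S • u₁ + eval v T • u₂)) w = 0 := by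
      intro w
      have hv : v - (eval v S • u₁ + eval v T • u₂) =
          ∑ i, v i • (e i - (s (e i) • u₁ + t (e i) • u₂)) := by
        simp only [hS, hT, map_sum, map_mul, eval_C, eval_X, smul_sub, smul_add,
          Finset.sum_sub_distrib, Finset.sum_add_distrib, Finset.sum_smul, smul_smul]
        congr 1
        · ext j
          simp [e, Finset.sum_apply, Pi.single_apply]
        · simp only [mul_comm]
      rw [hv, map_sum, LinearMap.sum_apply]
      refine Finset.sum_eq_zero fun i _ => ?_
      rw [map_smul, LinearMap.smul_apply, hst, smul_zero]
    set r := eval v S • u₁ + eval v T • u₂ with hr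
    have h4 : b₁ v v = b₁ r r := by
      have e₁ := hker v
      have e₂ := hker r
      rw [map_sub, LinearMap.sub_apply] at e₁ e₂
      rw [hs₁ v r] at e₂
      linear_combination e₁ + e₂
    rw [hb₁, h4, hr]
    simp only [map_add, map_smul, LinearMap.add_apply, LinearMap.smul_apply, smul_eq_mul,
      map_mul, eval_C, hs₁ u₂ u₁]
    linear_combination -(eval v S) ^ 2 * h₁ - eval v S * eval v T * h₂ - (eval v T) ^ 2 * h₃

end MvPolynomial

/-! ### Projection from a base point. -/

namespace MvPolynomial

variable {K : Type*} [Field K]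

theorem finSuccEquiv_rename_succ {m : ℕ} (a : MvPolynomial (Fin m) K) :
    Polynomial.C a = finSuccEquiv K m (rename Fin.succ a) := by
  induction a using MvPolynomial.induction_on with
  | C r => rw [rename_C]; exact ((finSuccEquiv K m).commutes r).symm
  | add p q hp hq => rw [map_add, map_add, map_add, hp, hq]
  | mul_X p i hp => rw [map_mul, map_mul, map_mul, hp, rename_X, finSuccEquiv_X_succ]

/-- Coordinates adapted to a point `p ≠ 0`: an identification of `K[x₀, …, xₘ]` with
`K[y₁, …, yₘ][X]` such that translation by `p` is `X ↦ X + 1`. -/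
structure PointCoordinates {m : ℕ} (p : Fin (m + 1) → K) where
  e : MvPolynomial (Fin (m + 1)) K ≃ₐ[K] Polynomial (MvPolynomial (Fin m) K)
  coeff_hom : ∀ {f d}, f.IsHomogeneous d → ∀ {i j}, i + j = d → ((e f).coeff i).IsHomogeneous j
  coeff_eq_zero : ∀ {f d}, f.IsHomogeneous d → ∀ {i}, d < i → (e f).coeff i = 0
  symm_X_hom : (e.symm Polynomial.X).IsHomogeneous 1
  symm_C_hom : ∀ {a d}, IsHomogeneous a d → (e.symm (Polynomial.C a)).IsHomogeneous d
  x : (Fin (m + 1) → K) → K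
  y : (Fin (m + 1) → K) → Fin m → K
  eval_eq : ∀ u f, eval u f = Polynomial.eval (x u) ((e f).map (eval (y u)))
  y_add : ∀ u, y (u + p) = y u
  x_self : x p = 1
  y_self : y p = 0

theorem exists_pointCoordinates {m : ℕ} {p : Fin (m + 1) → K} (hp : p ≠ 0) :
    Nonempty (PointCoordinates p) := by
  obtain ⟨i, hi⟩ : ∃ i, p i ≠ 0 := by
    by_contra! h
    exact hp (_root_.funext h)
  -- This is the linear change of coordinates making p the first basis vector, with the coordinate
  -- where p does not vanish giving the new X; g' is its inverse.
  let g : Fin (m + 1) → MvPolynomial (Fin (m + 1)) K :=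
    i.insertNth (C (p i) * X 0) fun j => C (p (i.succAbove j)) * X 0 + X j.succ
  let g' : Fin (m + 1) → MvPolynomial (Fin (m + 1)) K :=
    Fin.cons (C (p i)⁻¹ * X i) fun j => X (i.succAbove j) - C (p (i.succAbove j) * (p i)⁻¹) * X i
  have hg : ∀ j, (g j).IsHomogeneous 1 := fun j => by
    rcases Fin.eq_self_or_eq_succAbove i j with rfl | ⟨j, rfl⟩
    · simpa [g] using (isHomogeneous_X K (0 : Fin (m + 1))).C_mul _
    · simpa [g] using ((isHomogeneous_X K (0 : Fin (m + 1))).C_mul _).add (isHomogeneous_X _ _)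
  have hg' : ∀ j, (g' j).IsHomogeneous 1 := fun j => by
    refine Fin.cases ?_ (fun j => ?_) j
    · simpa [g'] using (isHomogeneous_X K i).C_mul _
    · simpa only [g', Fin.cons_succ] using
        (isHomogeneous_X _ _).sub ((isHomogeneous_X K i).C_mul _)
  have hC : ∀ {n : ℕ} (f : MvPolynomial (Fin n) K →ₐ[K] MvPolynomial (Fin (m + 1)) K) (r : K),
    f (C r) = C r := fun f r => f.commutes r
  have hinv : (C (p i)⁻¹ * C (p i) : MvPolynomial (Fin (m + 1)) K) = 1 := by
    rw [← map_mul, inv_mul_cancel₀ hi, map_one]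
  let σ : MvPolynomial (Fin (m + 1)) K ≃ₐ[K] MvPolynomial (Fin (m + 1)) K :=
    AlgEquiv.ofAlgHom (aeval g) (aeval g')
      (by
        ext j : 1
        refine Fin.cases ?_ (fun j => ?_) j
        · simp only [AlgHom.comp_apply, aeval_X, g', Fin.cons_zero, map_mul, hC, g,
            Fin.insertNth_apply_same, AlgHom.id_apply]
          linear_combination X 0 * hinv
        · simp only [AlgHom.comp_apply, aeval_X, g', Fin.cons_succ, map_sub, map_mul, hC, g,
            Fin.insertNth_apply_same, Fin.insertNth_apply_succAbove, AlgHom.id_apply]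
          linear_combination -C (p (i.succAbove j)) * X 0 * hinv)
      (by
        ext j : 1
        rcases Fin.eq_self_or_eq_succAbove i j with rfl | ⟨j, rfl⟩
        · simp only [AlgHom.comp_apply, aeval_X, g, Fin.insertNth_apply_same, map_mul, hC, g',
            Fin.cons_zero, AlgHom.id_apply]
          linear_combination X j * hinv
        · simp only [AlgHom.comp_apply, aeval_X, g, Fin.insertNth_apply_succAbove, map_mul, hC,
            map_add, g', Fin.cons_zero, Fin.cons_succ, AlgHom.id_apply]
          ring)
  have hσ : ∀ {f d}, IsHomogeneous f d → (σ f).IsHomogeneous d := fun {f d} hf => by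
    have := hf.aeval (n := 1) g hg
    rwa [one_mul] at this
  have hσ' : ∀ {f d}, IsHomogeneous f d → (σ.symm f).IsHomogeneous d := fun {f d} hf => by
    have := hf.aeval (n := 1) g' hg'
    rwa [one_mul] at this
  let e := σ.trans (finSuccEquiv K m)
  let v : (Fin (m + 1) → K) → Fin (m + 1) → K := fun u j => eval u (g' j)
  have hv0 : ∀ u, v u 0 = (p i)⁻¹ * u i := fun u => by simp [v, g']
  have hvs : ∀ u j, v u (Fin.succ j) = u (i.succAbove j) - p (i.succAbove j) * (p i)⁻¹ * u i :=
    fun u j => by simp [v, g']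
  refine ⟨⟨e, fun {f d} hf {i j} hij => ?_, fun {f d} hf {i} hi => ?_, ?_, fun {a d} ha => ?_,
    fun u => v u 0, fun u => Fin.tail (v u), fun u f => ?_, fun u => ?_, ?_, ?_⟩⟩
  · exact (hσ hf).finSuccEquiv_coeff_isHomogeneous _ _ hij
  · refine Polynomial.coeff_eq_zero_of_natDegree_lt (lt_of_le_of_lt ?_ hi)
    change (finSuccEquiv K m (σ f)).natDegree ≤ d
    rw [natDegree_finSuccEquiv]
    exact (degreeOf_le_totalDegree _ _).trans (hσ hf).totalDegree_le
  · refine hσ' (f := (finSuccEquiv K m).symm Polynomial.X) ?_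
    rw [show (finSuccEquiv K m).symm Polynomial.X = X 0 by
      rw [AlgEquiv.symm_apply_eq, finSuccEquiv_X_zero]]
    exact isHomogeneous_X _ _
  · refine hσ' (f := (finSuccEquiv K m).symm (Polynomial.C a)) ?_
    rw [show (finSuccEquiv K m).symm (Polynomial.C a) = rename Fin.succ a by
      rw [AlgEquiv.symm_apply_eq, finSuccEquiv_rename_succ]]
    exact ha.rename_isHomogeneous
  · have h1 : eval u f = eval (v u) (σ f) := by
      have h2 : f = σ.symm (σ f) := (σ.symm_apply_apply f).symm
      conv_lhs => rw [h2]
      change eval u (aeval g' (σ f)) = _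
      rw [← coe_aeval_eq_eval, ← coe_aeval_eq_eval]
      change (aeval u) (aeval g' (σ f)) = aeval (v u) (σ f)
      rw [← AlgHom.comp_apply, comp_aeval]
      rfl
    rw [h1]
    conv_lhs => rw [← Fin.cons_self_tail (v u)]
    exact eval_eq_eval_mv_eval' _ _ _
  · ext j
    simp only [Fin.tail, hvs, Pi.add_apply]
    field_simp
    ring
  · simp only [hv0]
    field_simp
  · ext j
    simp only [Fin.tail, hvs, Pi.zero_apply]
    field_simp
    ring

namespace PointCoordinates

variable {m : ℕ} {p : Fin (m + 1) → K} (c : PointCoordinates p)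

include c

/-- The coefficient of X² is a constant, and it is the value of Q at p, where X = 1 and y = 0. -/
theorem e_eq_line {Q : MvPolynomial (Fin (m + 1)) K} (hQ : Q.IsHomogeneous 2)
    (hp : eval p Q = 0) : c.e Q = line ((c.e Q).coeff 1) ((c.e Q).coeff 0) := by
  have h2 : (c.e Q).coeff 2 = 0 := by
    obtain ⟨r, hr⟩ := (c.coeff_hom hQ (add_zero 2)).exists_eq_C
    have h0 : ∀ {a : MvPolynomial (Fin m) K} {d : ℕ}, a.IsHomogeneous d → d ≠ 0 →
        eval (0 : Fin m → K) a = 0 := fun {a d} ha hd => by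
      rw [eval_zero]
      exact ha.coeff_eq_zero (by simpa using hd.symm)
    rw [c.eval_eq, c.x_self, c.y_self, Polynomial.eval_eq_sum_range' (n := 3)] at hp
    · simp only [Finset.sum_range_succ, Finset.sum_range_zero, Polynomial.coeff_map, one_pow,
        mul_one, zero_add, h0 (c.coeff_hom hQ (zero_add 2)) two_ne_zero,
        h0 (c.coeff_hom hQ (rfl : 1 + 1 = 2)) one_ne_zero, hr, eval_C] at hp
      rw [hr, hp, C_0]
    · refine Nat.lt_succ_of_le ((Polynomial.natDegree_map_le).trans ?_)
      rw [Polynomial.natDegree_le_iff_coeff_eq_zero]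
      exact fun i hi => c.coeff_eq_zero hQ hi
  ext1 i
  match i with
  | 0 => simp [line]
  | 1 => simp [line]
  | 2 => simp [line, h2]
  | i + 3 =>
    rw [c.coeff_eq_zero hQ (by omega)]
    simp [line]

/-- A vanishing coefficient of X makes Q invariant under translation by p. So at a base point that
is not a vertex of both quadrics, A₁ or A₂ is nonzero. -/
theorem eval_add_eq {Q : MvPolynomial (Fin (m + 1)) K} {G : MvPolynomial (Fin m) K}
    (h : c.e Q = line 0 G) (u : Fin (m + 1) → K) : eval (u + p) Q = eval u Q := by
  rw [c.eval_eq, c.eval_eq, h, c.y_add]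
  simp [line]

theorem symm_line_hom {A G : MvPolynomial (Fin m) K} {d : ℕ} (hA : A.IsHomogeneous d)
    (hG : G.IsHomogeneous (d + 1)) : (c.e.symm (line A G)).IsHomogeneous (d + 1) := by
  rw [line, map_add, map_mul]
  exact ((c.symm_C_hom hA).mul c.symm_X_hom).add (c.symm_C_hom hG)

end PointCoordinates

open Ideal

/-- A pencil of quadratic forms without reducible members: its base locus is irreducible or
contains a linear subspace of codimension two. -/
theorem pencil_of_forall_irreducible [IsAlgClosed K] [CharZero K] {n : ℕ}
    {Q₁ Q₂ : MvPolynomial (Fin n) K} (hQ₁ : Q₁.IsHomogeneous 2) (hQ₂ : Q₂.IsHomogeneous 2)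
    (H : ∀ s t : K, s ≠ 0 ∨ t ≠ 0 → ∀ x y, IsHomogeneous x 1 → IsHomogeneous y 1 →
      C s * Q₁ + C t * Q₂ ≠ x * y) :
    (span {Q₁, Q₂}).IsPrime ∨
    ((∃ x y, IsHomogeneous x 1 ∧ IsHomogeneous y 1 ∧ LinearIndependent K ![x, y] ∧
        span {Q₁, Q₂} ≤ span {x, y}) ∧
      ((span {Q₁, Q₂}).IsRadical ∨
        ∃ x y, IsHomogeneous x 1 ∧ IsHomogeneous y 1 ∧ LinearIndependent K ![x, y] ∧
        span {Q₁, Q₂} ≤ span {x, y} ∧ NotReducedAt (span {Q₁, Q₂}) (span {x, y}))) := by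
  rcases exists_base_point hQ₁ hQ₂ with ⟨p, hp₁, hp₂, u, hu⟩ | ⟨x, y, hx, hy, hxy⟩
  swap
  · exact absurd (by simpa using hxy) (H 1 0 (by simp) x y hx hy)
  have hp0 : p ≠ 0 := by
    rintro rfl
    simp at hu
  obtain ⟨m, rfl⟩ : ∃ m, n = m + 1 := by
    cases n with
    | zero => exact absurd (Subsingleton.elim _ _) hp0
    | succ m => exact ⟨m, rfl⟩
  obtain ⟨c⟩ := exists_pointCoordinates hp0
  have e₁ := c.e_eq_line hQ₁ hp₁
  have e₂ := c.e_eq_line hQ₂ hp₂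
  have hA₁ := c.coeff_hom hQ₁ (rfl : 1 + 1 = 2)
  have hA₂ := c.coeff_hom hQ₂ (rfl : 1 + 1 = 2)
  have hG₁ := c.coeff_hom hQ₁ (zero_add 2)
  have hG₂ := c.coeff_hom hQ₂ (zero_add 2)
  generalize (c.e Q₁).coeff 1 = A₁ at *
  generalize (c.e Q₂).coeff 1 = A₂ at *
  generalize (c.e Q₁).coeff 0 = G₁ at *
  generalize (c.e Q₂).coeff 0 = G₂ at *
  have hA : A₁ ≠ 0 ∨ A₂ ≠ 0 := by
    refine hu.imp (fun h h0 => h ?_) (fun h h0 => h ?_)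
    · exact c.eval_add_eq (h0 ▸ e₁) u
    · exact c.eval_add_eq (h0 ▸ e₂) u
  have hsC : ∀ s : K, c.e (C s) = Polynomial.C (C s) := fun s => c.e.commutes s
  -- A linear factor a = a(y) of a member would split it as a · (bX + d) with b constant and d
  -- linear, contrary to `H`.
  have hlin : NoLinearFactor A₁ G₁ A₂ G₂ := by
    rintro s t hst a ha ha0 ⟨b, hb⟩ ⟨d, hd⟩
    have hbhom : b.IsHomogeneous 0 := IsHomogeneous.mul_right_cancel (i := 1)
      (hb ▸ (hA₁.C_mul s).add (hA₂.C_mul t)) ha ha0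
    have hdhom : d.IsHomogeneous 1 := IsHomogeneous.mul_right_cancel (i := 1)
      (hd ▸ (hG₁.C_mul s).add (hG₂.C_mul t)) ha ha0
    refine H s t hst _ _ (c.symm_C_hom ha) (c.symm_line_hom hbhom hdhom) (c.e.injective ?_)
    rw [map_add, map_mul, map_mul, map_mul, AlgEquiv.apply_symm_apply, AlgEquiv.apply_symm_apply,
      e₁, e₂, hsC, hsC]
    have hb' := congrArg Polynomial.C hb
    have hd' := congrArg Polynomial.C hd
    simp only [Polynomial.C_add, Polynomial.C_mul] at hb' hd'
    simp only [line]
    linear_combination Polynomial.X * hb' + hd'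
  have hcomap : ∀ f g, (span {c.e f, c.e g}).comap c.e = span {f, g} := by
    intro f g
    ext h
    rw [mem_comap, mem_span_pair, mem_span_pair]
    constructor
    · rintro ⟨a, b, hab⟩
      refine ⟨c.e.symm a, c.e.symm b, c.e.injective ?_⟩
      simpa using hab
    · rintro ⟨a, b, rfl⟩
      exact ⟨c.e a, c.e b, by simp⟩
  have hI : (span {line A₁ G₁, line A₂ G₂}).comap c.e = span {Q₁, Q₂} := by
    rw [← hcomap, e₁, e₂]
  have hpair : ∀ a b, IsLinearPair a b → ∃ x y, IsHomogeneous x 1 ∧ IsHomogeneous y 1 ∧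
      LinearIndependent K ![x, y] ∧ (span {a, b}).comap c.e = span {x, y} := by
    rintro a b ⟨ha0, hab, ⟨r, ℓ, hℓ, ha⟩, r', ℓ', hℓ', hb⟩
    refine ⟨c.e.symm a, c.e.symm b, ?_, ?_, linearIndependent_pair_of_not_dvd ?_ ?_, ?_⟩
    · rw [ha]; exact c.symm_line_hom (isHomogeneous_C _ _) hℓ
    · rw [hb]; exact c.symm_line_hom (isHomogeneous_C _ _) hℓ'
    · simpa using ha0
    · intro h
      refine hab ?_
      have := map_dvd c.e h
      rwa [AlgEquiv.apply_symm_apply, AlgEquiv.apply_symm_apply] at this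
    · rw [← hcomap, AlgEquiv.apply_symm_apply, AlgEquiv.apply_symm_apply]
  rw [← hI]
  rcases linearPrimeAlternative hA₁ hA₂ hG₁ hG₂ hA hlin with h | ⟨⟨a, b, hab, hle⟩, h⟩
  · exact .inl (comap_isPrime _ _)
  · refine .inr ⟨?_, h.imp (fun h => h.comap _) ?_⟩
    · obtain ⟨x, y, hx, hy, hxy, he⟩ := hpair a b hab
      exact ⟨x, y, hx, hy, hxy, he ▸ comap_mono hle⟩
    · rintro ⟨a, b, hab, hle, f, hf, hs⟩
      obtain ⟨x, y, hx, hy, hxy, he⟩ := hpair a b hab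
      refine ⟨x, y, hx, hy, hxy, he ▸ comap_mono hle, c.e.symm f, ?_, fun s h => ?_⟩
      · rw [← he, mem_comap, AlgEquiv.apply_symm_apply]
        exact hf
      · rw [← he, mem_comap]
        refine hs _ ?_
        rw [mem_comap, map_mul, AlgEquiv.apply_symm_apply] at h
        exact h

end MvPolynomial

/-! ### Minimal primes and isolated components. -/

namespace Ideal

variable {R : Type*} [CommRing R]

/-- Krull's height theorem: a prime ideal with two generators is minimal over the ideal of two
coprime elements which it contains. -/
theorem span_pair_mem_minimalPrimes [IsDomain R] [IsNoetherianRing R]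
    [UniqueFactorizationMonoid R] {f g a b : R} (hfg : IsRelPrime f g) (hf : f ≠ 0)
    (hP : (span {a, b}).IsPrime) (hle : span {f, g} ≤ span {a, b}) :
    span {a, b} ∈ (span {f, g}).minimalPrimes := by
  refine ⟨⟨hP, hle⟩, fun P' ⟨hP', hle'⟩ hP'P => ?_⟩
  by_contra hcon
  have hlt : P' < span {a, b} := hP'P.lt_of_not_ge hcon
  have hf' : f ∈ P' := hle' (subset_span (by simp))
  have hg' : g ∈ P' := hle' (subset_span (by simp))
  obtain ⟨π, hπP', hπ⟩ := hP'.exists_mem_prime_of_ne_bot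
    (fun h => hf ((Submodule.mem_bot R).mp (h ▸ hf')))
  have hπprime := (span_singleton_prime hπ.ne_zero).mpr hπ
  have h₁ : (⊥ : Ideal R) < span {π} := by
    rw [bot_lt_iff_ne_bot, Ne, span_singleton_eq_bot]
    exact hπ.ne_zero
  have h₂ : span {π} < P' := by
    refine lt_of_le_of_ne ((span_singleton_le_iff_mem _).mpr hπP') fun h => hπ.not_isUnit ?_
    exact hfg (mem_span_singleton.mp (h ▸ hf')) (mem_span_singleton.mp (h ▸ hg'))
  have hbot : (⊥ : Ideal R).IsPrime := isPrime_bot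
  have e₁ := height_add_one_le_of_lt_of_isPrime h₁
  have e₂ := height_add_one_le_of_lt_of_isPrime h₂
  have e₃ := height_add_one_le_of_lt_of_isPrime hlt
  have e₄ : (span {a, b}).height ≤ ({a, b} : Set R).ncard :=
    height_le_card_of_mem_minimalPrimes_span (Set.toFinite _)
      (by rw [minimalPrimes_eq_subsingleton_self]; rfl)
  have e₅ : (({a, b} : Set R).ncard : ℕ∞) ≤ 2 := by
    have := Set.ncard_insert_le a {b}
    rw [Set.ncard_singleton] at this
    exact_mod_cast this
  -- The chain 0 < (π) < P' < (a, b) is too long for a prime with two generators; (π) ≠ P' because f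
  -- and g are coprime.
  have e₆ : (3 : ℕ∞) ≤ (span {a, b}).height := by
    calc (3 : ℕ∞) = 0 + 1 + 1 + 1 := by norm_num
      _ ≤ (⊥ : Ideal R).height + 1 + 1 + 1 := by gcongr; exact zero_le
      _ ≤ (span {π}).height + 1 + 1 := by gcongr
      _ ≤ P'.height + 1 := by gcongr
      _ ≤ _ := e₃
  have := e₆.trans (e₄.trans e₅)
  norm_num at this

/-- The isolated primary component at a minimal prime `P` of `I`. -/
theorem exists_isolated_component [IsNoetherianRing R] {I P : Ideal R}
    (hP : P ∈ I.minimalPrimes) :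
    ∃ (t : Finset (Ideal R)) (q : Ideal R), Submodule.IsMinimalPrimaryDecomposition I t ∧
      q ∈ t ∧ q.IsPrimary ∧ q.radical = P ∧ ∀ f, f ∈ q ↔ ∃ s ∉ P, s * f ∈ I := by
  classical
  obtain ⟨t, ht⟩ := Submodule.IsLasker.exists_isMinimalPrimaryDecomposition
    (Submodule.isLasker R R) I
  obtain ⟨q, hqt, hq⟩ := IsMinimalPrimaryDecomposition.minimalPrimes_subset_image_radical ht hP
  have hIle : ∀ J ∈ t, I ≤ J := fun J hJ => ht.inf_eq ▸ Finset.inf_le hJ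
  have hqprim : q.IsPrimary := ht.primary hqt
  refine ⟨t, q, ht, hqt, hqprim, hq, fun f => ⟨fun hf => ?_, ?_⟩⟩
  -- By minimality of P and distinctness of radicals, no other component lies in P. The product of
  -- elements of these components outside P multiplies q into I.
  · have hs : ∀ J : Ideal R, ∃ s, J ∈ t.erase q → s ∈ J ∧ s ∉ P := by
      intro J
      by_cases hJ : J ∈ t.erase q
      · obtain ⟨hJq, hJt⟩ := Finset.mem_erase.mp hJ
        have hJP : ¬ J ≤ P := by
          intro hle
          have hprime : J.radical.IsPrime := isPrime_radical (ht.primary hJt)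
          have h1 : J.radical ≤ P := hP.1.1.radical_le_iff.mpr hle
          have h2 : P ≤ J.radical := hP.2 ⟨hprime, (hIle J hJt).trans le_radical⟩ h1
          have h3 := ht.distinct hJt hqt hJq
          simp only [Function.onFun, Submodule.colon_univ] at h3
          exact h3 (by rw [hq]; exact le_antisymm h1 h2)
        obtain ⟨s, hs, hsP⟩ := SetLike.not_le_iff_exists.mp hJP
        exact ⟨s, fun _ => ⟨hs, hsP⟩⟩
      · exact ⟨0, fun h => absurd h hJ⟩
    choose s hs using hs
    refine ⟨∏ J ∈ t.erase q, s J, fun h => ?_, ?_⟩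
    · obtain ⟨J, hJ, hJP⟩ := (hP.1.1.prod_mem_iff).mp h
      exact (hs J hJ).2 hJP
    · rw [← ht.inf_eq, Submodule.mem_finsetInf]
      intro J hJ
      by_cases hJq : J = q
      · subst hJq
        exact mul_mem_left _ _ hf
      · have hJ' := Finset.mem_erase.mpr ⟨hJq, hJ⟩
        exact mul_mem_right _ _ (mem_of_dvd _ (Finset.dvd_prod_of_mem s hJ') (hs J hJ').1)
  · rintro ⟨s, hsP, hs⟩
    rw [← hq] at hsP
    have hsf : f * s ∈ q := mul_comm s f ▸ hIle q hqt hs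
    exact ((isPrimary_iff.mp hqprim).2 hsf).resolve_right hsP

end Ideal

/-! ### Homogeneity of the isolated component. -/

/-- If a polynomial expression in `r` with coefficients in a module lies in a subspace for all
`r ≠ 0`, then so do the coefficients. -/
theorem Submodule.mem_of_forall_sum_pow_smul_mem {K V : Type*} [Field K] [Infinite K]
    [AddCommGroup V] [Module K V] (W : Submodule K V) (N : ℕ) (v : ℕ → V)
    (h : ∀ r : K, r ≠ 0 → ∑ i ∈ Finset.range N, r ^ i • v i ∈ W) {j : ℕ} (hj : j < N) :
    v j ∈ W := by
  by_contra hcon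
  -- A functional that vanishes on W but not on the j-th coefficient would give a nonzero polynomial
  -- in r with infinitely many roots.
  obtain ⟨φ, hφ, hW⟩ := W.exists_le_ker_of_notMem hcon
  refine hφ ?_
  let p : Polynomial K := ∑ i ∈ Finset.range N, Polynomial.monomial i (φ (v i))
  have hp : p = 0 := by
    refine Polynomial.eq_zero_of_infinite_isRoot p (Set.Infinite.mono ?_
      (Set.Finite.infinite_compl (Set.finite_singleton (0 : K))))
    intro r hr
    have h1 : φ (∑ i ∈ Finset.range N, r ^ i • v i) = 0 := hW (h r hr)
    rw [Set.mem_ofPred_eq, Polynomial.IsRoot, Polynomial.eval_finsetSum, ← h1, map_sum]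
    refine Finset.sum_congr rfl fun i _ => ?_
    rw [Polynomial.eval_monomial, map_smul, smul_eq_mul, mul_comm]
  have h2 : p.coeff j = φ (v j) := by
    simp [p, Polynomial.coeff_monomial, hj]
  rw [← h2, hp, Polynomial.coeff_zero]

namespace MvPolynomial

open Ideal

variable {K : Type*} [Field K] {n : ℕ}

/-- The substitution `Xᵢ ↦ r Xᵢ`. -/
noncomputable def scale (r : K) : MvPolynomial (Fin n) K →ₐ[K] MvPolynomial (Fin n) K :=
  aeval fun i => r • X i

theorem IsHomogeneous.scale_apply {f : MvPolynomial (Fin n) K} {d : ℕ} (hf : f.IsHomogeneous d)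
    (r : K) : scale r f = r ^ d • f := by
  rw [f.as_sum, map_sum, Finset.smul_sum]
  refine Finset.sum_congr rfl fun s hs => ?_
  rw [scale, aeval_monomial, hf.degree_eq_sum_deg_support hs, monomial_eq]
  simp only [smul_pow, Finsupp.prod, Finset.prod_smul, Finset.prod_pow_eq_pow_sum,
    algebraMap_eq, mul_smul_comm]

theorem scale_eq_sum (r : K) (f : MvPolynomial (Fin n) K) :
    scale r f = ∑ i ∈ Finset.range (f.totalDegree + 1), r ^ i • homogeneousComponent i f := by
  conv_lhs => rw [← sum_homogeneousComponent f]
  rw [map_sum]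
  exact Finset.sum_congr rfl fun i _ => (homogeneousComponent_isHomogeneous i f).scale_apply r

theorem scale_scale_inv {r : K} (hr : r ≠ 0) (f : MvPolynomial (Fin n) K) :
    scale r⁻¹ (scale r f) = f := by
  have : (scale r⁻¹).comp (scale r) = AlgHom.id K (MvPolynomial (Fin n) K) := by
    ext i : 1
    simp [scale, smul_smul, mul_inv_cancel₀ hr]
  exact DFunLike.congr_fun this f

theorem scale_mem_span_pair {f g h : MvPolynomial (Fin n) K} {d : ℕ} (hf : f.IsHomogeneous d)
    (hg : g.IsHomogeneous d) (r : K) (hh : h ∈ span {f, g}) : scale r h ∈ span {f, g} := by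
  obtain ⟨a, b, rfl⟩ := mem_span_pair.mp hh
  rw [map_add, map_mul, map_mul, hf.scale_apply, hg.scale_apply, smul_eq_C_mul, smul_eq_C_mul]
  exact mem_span_pair.mpr ⟨scale r a * C (r ^ d), scale r b * C (r ^ d), by ring⟩

/-- The contraction of a localization of a homogeneous ideal at a homogeneous prime is
homogeneous. -/
theorem homogeneousComponent_mem_of_localization [Infinite K]
    {Q₁ Q₂ x y : MvPolynomial (Fin n) K} {d d' : ℕ}
    (hQ₁ : Q₁.IsHomogeneous d) (hQ₂ : Q₂.IsHomogeneous d) (hx : x.IsHomogeneous d')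
    (hy : y.IsHomogeneous d') {q : Ideal (MvPolynomial (Fin n) K)}
    (hq : ∀ f, f ∈ q ↔ ∃ s ∉ span {x, y}, s * f ∈ span {Q₁, Q₂})
    {f : MvPolynomial (Fin n) K} (hf : f ∈ q) (i : ℕ) : homogeneousComponent i f ∈ q := by
  by_cases hi : i < f.totalDegree + 1
  · refine (q.restrictScalars K).mem_of_forall_sum_pow_smul_mem (f.totalDegree + 1)
      (fun i => homogeneousComponent i f) (fun r hr => ?_) hi
    rw [← scale_eq_sum, Submodule.restrictScalars_mem, hq]
    obtain ⟨s, hs, hsf⟩ := (hq f).mp hf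
    refine ⟨scale r s, fun h => hs ?_, ?_⟩
    · rw [← scale_scale_inv hr s]
      exact scale_mem_span_pair hx hy _ h
    · rw [← map_mul]
      exact scale_mem_span_pair hQ₁ hQ₂ _ hsf
  · rw [homogeneousComponent_eq_zero _ _ (by omega)]
    exact zero_mem _

end MvPolynomial

/-! ### Comparing lengths over K, over S and over the local ring. -/

section Length

variable {K S : Type*} [Field K] [CommRing S] [Algebra K S]

/-- Over an algebra `S` with an ideal `p` such that `K → S / p` is surjective, the dimension of
a module annihilated by a power of `p` is at most its length. -/
theorem Module.length_field_le_length {p : Ideal S}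
    (hp : ∀ s : S, ∃ c : K, s - algebraMap K S c ∈ p) (k : ℕ) :
    ∀ (N : Type*) [AddCommGroup N] [Module K N] [Module S N] [IsScalarTower K S N],
      (∀ s ∈ p ^ k, ∀ x : N, s • x = 0) → Module.length K N ≤ Module.length S N := by
  induction k with
  | zero =>
    intro N _ _ _ _ h
    have : Subsingleton N := ⟨fun x y => by
      rw [← one_smul S x, ← one_smul S y, h 1 (by simp), h 1 (by simp)]⟩
    rw [Module.length_eq_zero]
    exact zero_le
  | succ k ih =>
    intro N _ _ _ _ h
    let N' : Submodule S N := p • ⊤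
    have h₁ : Module.length K N' ≤ Module.length S N' := by
      refine ih N' fun s hs x => Subtype.ext ?_
      obtain ⟨x, hx⟩ := x
      change s • x = 0
      induction hx using Submodule.smul_induction_on' with
      | smul r hr y _ =>
        rw [← mul_smul]
        exact h _ (by rw [pow_succ]; exact Ideal.mul_mem_mul hs hr) y
      | add y _ z _ hy hz => rw [smul_add, hy, hz, add_zero]
    have hquot : ∀ s ∈ p, ∀ x : N ⧸ N', s • x = 0 := by
      intro s hs x
      obtain ⟨x, rfl⟩ := N'.mkQ_surjective x
      rw [← map_smul, Submodule.mkQ_apply, Submodule.Quotient.mk_eq_zero]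
      exact Submodule.smul_mem_smul hs Submodule.mem_top
    have h₂ : Module.length K (N ⧸ N') ≤ Module.length S (N ⧸ N') := by
      rw [← WithBot.coe_le_coe, Module.coe_length, Module.coe_length]
      -- On N/pN the ring S acts through K, so every subspace is an S-submodule; pN is covered by
      -- induction.
      let g : Submodule K (N ⧸ N') → Submodule S (N ⧸ N') := fun U =>
        { U with
          smul_mem' := fun s x hx => by
            obtain ⟨c, hc⟩ := hp s
            have : s • x = c • x := by
              rw [← sub_eq_zero, ← algebraMap_smul S c x, ← sub_smul, hquot _ hc]
            rw [this]
            exact U.smul_mem c hx }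
      exact Order.krullDim_le_of_strictMono g fun U V h => h
    rw [Module.length_eq_add_of_exact N'.subtype N'.mkQ N'.subtype_injective N'.mkQ_surjective
        (LinearMap.exact_subtype_mkQ N'),
      Module.length_eq_add_of_exact (R := K) (N'.subtype.restrictScalars K)
        (N'.mkQ.restrictScalars K) N'.subtype_injective N'.mkQ_surjective
        (LinearMap.exact_subtype_mkQ N')]
    exact add_le_add h₁ h₂

end Length

section Localization

variable {S : Type*} [CommRing S] (p : Ideal S) [p.IsPrime]

/-- The length of `S / (q + pᵏ)` is at most the value at `k` of the Hilbert-Samuel function of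
`(S / q)_p`. -/
theorem length_quotient_le_hilbertSamuelFunction [p.IsMaximal] (q : Ideal S) (k : ℕ) :
    Module.length S (S ⧸ (q ⊔ p ^ k)) ≤
      hilbertSamuelFunction (Localization.AtPrime p) (LocalizedModule p.primeCompl (S ⧸ q)) k := by
  let R := Localization.AtPrime p
  let M := LocalizedModule p.primeCompl (S ⧸ q)
  let T := S ⧸ (q ⊔ p ^ k)
  have hpT : ∀ s ∈ p ^ k, ∀ x : T, s • x = 0 := by
    intro s hs x
    obtain ⟨x, rfl⟩ := Ideal.Quotient.mk_surjective x
    change Ideal.Quotient.mk _ (s * x) = 0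
    rw [Ideal.Quotient.eq_zero_iff_mem]
    exact Ideal.mul_mem_right _ _ (Ideal.mem_sup_right hs)
  have hinv : ∀ s ∉ p, ∃ s' : S, s' * s - 1 ∈ p ^ k := by
    intro s hs
    obtain ⟨a, b, hb, hab⟩ := Ideal.IsMaximal.exists_inv (inferInstance : p.IsMaximal) hs
    obtain ⟨c, hc⟩ := sub_dvd_pow_sub_pow (1 : S) b k
    refine ⟨a * c, ?_⟩
    have : a * c * s - 1 = -b ^ k := by
      rw [one_pow] at hc
      linear_combination -hc + c * hab
    rw [this]
    exact neg_mem (Ideal.pow_mem_pow hb k)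
  have hinvT : ∀ s ∉ p, ∃ s' : S, ∀ x : T, s' • s • x = x := by
    intro s hs
    obtain ⟨s', hs'⟩ := hinv s hs
    refine ⟨s', fun x => ?_⟩
    rw [← mul_smul, ← sub_eq_zero]
    have := hpT _ hs' x
    rwa [sub_smul, one_smul] at this
  let f : (S ⧸ q) →ₗ[S] T := Submodule.factor (le_sup_left : q ≤ q ⊔ p ^ k)
  -- Elements outside the maximal ideal p are invertible modulo pᵏ, so the quotient map to T extends
  -- to the localization.
  have hunit : ∀ x : p.primeCompl, IsUnit (algebraMap S (Module.End S T) x) := by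
    intro x
    obtain ⟨s', hs'⟩ := hinvT x x.2
    rw [Module.End.isUnit_iff]
    refine ⟨fun a b hab => ?_, fun a => ⟨s' • a, ?_⟩⟩
    · rw [← hs' a, ← hs' b]
      exact congrArg (s' • ·) hab
    · change (x : S) • s' • a = a
      rw [smul_comm, hs']
  let F : M →ₗ[S] T := LocalizedModule.lift p.primeCompl f hunit
  have hF : ∀ m, F (LocalizedModule.mkLinearMap p.primeCompl (S ⧸ q) m) = f m := fun m => by
    exact DFunLike.congr_fun (LocalizedModule.lift_comp p.primeCompl f hunit) m
  have hFsurj : Function.Surjective F := fun x => by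
    obtain ⟨y, rfl⟩ := Submodule.factor_surjective (le_sup_left : q ≤ q ⊔ p ^ k) x
    exact ⟨_, hF y⟩
  have hdiv : ∀ (U : Submodule S T) (r : R) (m : M), F m ∈ U → F (r • m) ∈ U := by
    intro U r m hm
    obtain ⟨⟨a, s⟩, hr⟩ := IsLocalization.surj p.primeCompl r
    obtain ⟨s', hs'⟩ := hinvT s s.2
    have h1 : (s : S) • F (r • m) = a • F m := by
      rw [← map_smul, ← map_smul, ← algebraMap_smul R (s : S), ← mul_smul, mul_comm, hr,
        algebraMap_smul]
    rw [← hs' (F (r • m)), h1]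
    exact U.smul_mem _ (U.smul_mem _ hm)
  let I : Submodule R M := IsLocalRing.maximalIdeal R ^ k • ⊤
  have hI : ∀ m ∈ I, F m = 0 := by
    intro m hm
    induction hm using Submodule.smul_induction_on' with
    | smul r hr m _ =>
      rw [← Localization.AtPrime.map_eq_maximalIdeal, ← Ideal.map_pow,
        IsLocalization.mem_map_algebraMap_iff p.primeCompl] at hr
      obtain ⟨⟨⟨a, ha⟩, s⟩, hr⟩ := hr
      obtain ⟨s', hs'⟩ := hinvT s s.2
      have h1 : (s : S) • F (r • m) = a • F m := by
        rw [← map_smul, ← map_smul, ← algebraMap_smul R (s : S), ← mul_smul, mul_comm, hr,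
          algebraMap_smul]
      rw [← hs' (F (r • m)), h1, hpT a ha, smul_zero]
    | add y _ z _ hy hz => rw [map_add, hy, hz, add_zero]
  -- Preimages under the surjection F embed the submodules of T strictly monotonically into those of
  -- M / 𝔪ᵏM; only this inequality of lengths is needed.
  let g : Submodule S T → Submodule R (M ⧸ I) := fun U =>
    Submodule.map I.mkQ
      { carrier := F ⁻¹' U
        add_mem' := fun {a b} ha hb => by
          rw [Set.mem_preimage, map_add]; exact add_mem ha hb
        zero_mem' := by rw [Set.mem_preimage, map_zero]; exact zero_mem U
        smul_mem' := fun r m hm => hdiv U r m hm }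
  have hg : ∀ U m, I.mkQ m ∈ g U ↔ F m ∈ U := by
    intro U m
    constructor
    · rintro ⟨m', hm', h⟩
      have : F (m' - m) = 0 := hI _ ((Submodule.Quotient.eq I).mp h)
      rw [map_sub, sub_eq_zero] at this
      exact this ▸ hm'
    · exact fun h => ⟨m, h, rfl⟩
  have hgle : ∀ U V, g U ≤ g V ↔ U ≤ V := by
    intro U V
    constructor
    · intro h x hx
      obtain ⟨m, rfl⟩ := hFsurj x
      exact (hg V m).mp (h ((hg U m).mpr hx))
    · rintro h _ ⟨m, hm, rfl⟩
      exact ⟨m, h hm, rfl⟩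
  rw [hilbertSamuelFunction, ← WithBot.coe_le_coe, Module.coe_length, Module.coe_length]
  exact Order.krullDim_le_of_strictMono g (strictMono_of_le_iff_le fun U V => (hgle U V).symm)

end Localization

/-! ### Retraction onto the coordinate ring of a linear subspace, and dimension. -/

namespace MvPolynomial

section GradedRetraction

variable {K : Type*} [Field K] {n : ℕ}

/-- A graded retraction `π` of `K[x₁, …, xₙ]` onto a polynomial ring in `d` variables with kernel
`P`, and a graded section `ι` of it. -/
structure GradedRetraction (P : Ideal (MvPolynomial (Fin n) K)) (d : ℕ) where
  π : MvPolynomial (Fin n) K →ₐ[K] MvPolynomial (Fin d) K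
  ι : MvPolynomial (Fin d) K →ₐ[K] MvPolynomial (Fin n) K
  π_ι : ∀ a, π (ι a) = a
  π_eq_zero_iff : ∀ f, π f = 0 ↔ f ∈ P
  π_hom : ∀ {f d}, f.IsHomogeneous d → (π f).IsHomogeneous d
  ι_hom : ∀ {f d}, f.IsHomogeneous d → (ι f).IsHomogeneous d

theorem exists_gradedRetraction {x y : MvPolynomial (Fin n) K} (hx : x.IsHomogeneous 1)
    (hy : y.IsHomogeneous 1) (h : LinearIndependent K ![x, y]) :
    ∃ d, Nonempty (GradedRetraction (Ideal.span {x, y}) d) := by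
  obtain ⟨m, -, ⟨E⟩⟩ := exists_elimination' hx (h.ne_zero 0)
  obtain ⟨d, -, ⟨E'⟩⟩ := exists_elimination' (E.π_hom hy) (E.π_ne_zero hx hy h)
  refine ⟨d, ⟨⟨E'.π.comp E.π, E.ι.comp E'.ι, fun a => ?_, fun f => ?_, fun hf =>
    E'.π_hom (E.π_hom hf), fun hf => E.ι_hom (E'.ι_hom hf)⟩⟩⟩
  · simp [E.π_ι, E'.π_ι]
  · rw [AlgHom.comp_apply, E'.π_eq_zero_iff, ← Ideal.mem_span_singleton, ← E.comap_span_π,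
      Ideal.mem_comap]

namespace GradedRetraction

variable {P : Ideal (MvPolynomial (Fin n) K)} {d : ℕ} (E : GradedRetraction P d)

include E

theorem sub_mem (f : MvPolynomial (Fin n) K) : f - E.ι (E.π f) ∈ P := by
  rw [← E.π_eq_zero_iff, map_sub, E.π_ι, sub_self]

theorem π_mem_pow {f : MvPolynomial (Fin n) K} {k : ℕ} (hf : f ∈ idealOfVars (Fin n) K ^ k) :
    E.π f ∈ idealOfVars (Fin d) K ^ k := by
  have h : (idealOfVars (Fin n) K).map E.π ≤ idealOfVars (Fin d) K := by
    rw [idealOfVars, Ideal.map_span, Ideal.span_le]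
    rintro _ ⟨_, ⟨i, rfl⟩, rfl⟩
    rw [SetLike.mem_coe, ← pow_one (idealOfVars (Fin d) K), mem_pow_idealOfVars_iff']
    intro s hs
    exact (E.π_hom (isHomogeneous_X K i)).coeff_eq_zero (by omega)
  have := Ideal.mem_map_of_mem E.π hf
  rw [Ideal.map_pow] at this
  exact Ideal.pow_right_mono h k this

/-- The dimension of a localization of `S / q` with `q ≤ P ≤ √q` is at most that of `S / P`. -/
theorem supportDim_le {q p : Ideal (MvPolynomial (Fin n) K)} [p.IsPrime] (hq : P ≤ q.radical) :
    Module.supportDim (Localization.AtPrime p)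
      (LocalizedModule p.primeCompl (MvPolynomial (Fin n) K ⧸ q)) ≤ d := by
  let S := MvPolynomial (Fin n) K
  let R := Localization.AtPrime p
  let M := LocalizedModule p.primeCompl (S ⧸ q)
  have hsupp : ∀ 𝔭 ∈ Module.support R M, ∀ f ∈ P, algebraMap S R f ∈ 𝔭.asIdeal := by
    intro 𝔭 h𝔭 f hf
    obtain ⟨k, hk⟩ := hq hf
    refine 𝔭.isPrime.mem_of_pow_mem k ?_
    rw [← map_pow]
    refine Module.annihilator_le_of_mem_support h𝔭 ?_
    rw [Module.mem_annihilator]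
    intro m
    induction m using LocalizedModule.induction_on with
    | h m s =>
      obtain ⟨m, rfl⟩ := Ideal.Quotient.mk_surjective m
      rw [algebraMap_smul, LocalizedModule.smul'_mk]
      have : f ^ k • Ideal.Quotient.mk q m = 0 := by
        change Ideal.Quotient.mk q (f ^ k * m) = 0
        rw [Ideal.Quotient.eq_zero_iff_mem]
        exact Ideal.mul_mem_right _ _ hk
      rw [this, LocalizedModule.zero_mk]
  -- Primes in the support contain P, and f ≡ ι (π f) modulo P, so such a prime is determined by its
  -- contraction along ι.
  let g : Module.support R M → PrimeSpectrum (MvPolynomial (Fin d) K) := fun 𝔭 =>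
    PrimeSpectrum.comap ((algebraMap S R).comp E.ι.toRingHom) 𝔭.1
  have hg : ∀ 𝔭 𝔭', g 𝔭 ≤ g 𝔭' ↔ 𝔭 ≤ 𝔭' := by
    rintro ⟨𝔭, h𝔭⟩ ⟨𝔭', h𝔭'⟩
    refine ⟨fun h r hr => ?_, fun h a ha => h ha⟩
    obtain ⟨⟨a, s⟩, hrs⟩ := IsLocalization.surj p.primeCompl r
    have h1 : algebraMap S R a ∈ 𝔭.asIdeal := by
      rw [← hrs]
      exact Ideal.mul_mem_right _ _ hr
    have h2 : algebraMap S R (E.ι (E.π a)) ∈ 𝔭.asIdeal := by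
      have := _root_.sub_mem h1 (hsupp _ h𝔭 _ (E.sub_mem a))
      rwa [← map_sub, sub_sub_cancel] at this
    have h3 : algebraMap S R (E.ι (E.π a)) ∈ 𝔭'.asIdeal :=
      h (show E.π a ∈ (g ⟨𝔭, h𝔭⟩).asIdeal from h2)
    have h4 : algebraMap S R a ∈ 𝔭'.asIdeal := by
      have := add_mem h3 (hsupp _ h𝔭' _ (E.sub_mem a))
      rwa [← map_add, add_sub_cancel] at this
    rw [← hrs] at h4
    refine (𝔭'.isPrime.mem_or_mem h4).resolve_right fun h5 => 𝔭'.isPrime.ne_top ?_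
    exact Ideal.eq_top_of_isUnit_mem _ h5 (IsLocalization.map_units R s)
  calc Module.supportDim R M ≤ ringKrullDim (MvPolynomial (Fin d) K) :=
        Order.krullDim_le_of_strictMono g
          (strictMono_of_le_iff_le fun 𝔭 𝔭' => (hg 𝔭 𝔭').symm)
    _ = d := by
        rw [ringKrullDim_of_isNoetherianRing, ringKrullDim_eq_zero_of_field]
        simp

end GradedRetraction

theorem idealOfVars_isMaximal : (idealOfVars (Fin n) K).IsMaximal := by
  have h : idealOfVars (Fin n) K = RingHom.ker (constantCoeff (σ := Fin n) (R := K)) := by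
    ext p
    rw [← pow_one (idealOfVars (Fin n) K), mem_pow_idealOfVars_iff']
    simp [RingHom.mem_ker, constantCoeff_eq, Finsupp.degree_eq_zero_iff]
  rw [h]
  exact RingHom.ker_isMaximal_of_surjective _ fun c => ⟨C c, constantCoeff_C _ _⟩

theorem sub_C_constantCoeff_mem_idealOfVars (f : MvPolynomial (Fin n) K) :
    f - C (constantCoeff f) ∈ idealOfVars (Fin n) K := by
  rw [← pow_one (idealOfVars (Fin n) K), mem_pow_idealOfVars_iff']
  intro s hs
  have : s = 0 := by rwa [Nat.lt_one_iff, Finsupp.degree_eq_zero_iff] at hs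
  simp [this, constantCoeff_eq]

end GradedRetraction

/-! ### Counting monomials. -/

section Count

/-- The number of monomials of degree less than `k + 1` in `d` variables. -/
theorem choose_le_card_degree_lt (d k : ℕ) :
    ((d + k).choose k : ℕ∞) ≤ ENat.card {s : Fin d →₀ ℕ | s.degree < k + 1} := by
  classical
  -- An extra variable of index 0 absorbs the slack: monomials of degree at most k in d variables
  -- correspond to those of degree k in d + 1.
  let F := (Finset.univ : Finset (Fin (d + 1))).finsuppAntidiag k
  have hF : ((d + k).choose k : ℕ∞) = ENat.card F := by
    rw [ENat.card_eq_coe_fintype_card, Fintype.card_coe,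
      Finset.card_finsuppAntidiag_nat_eq_choose, Finset.card_univ, Fintype.card_fin]
    congr 2
    omega
  have hsum : ∀ s ∈ F, s 0 + s.tail.degree = k := by
    intro s hs
    rw [Finset.mem_finsuppAntidiag] at hs
    rw [← hs.1, Fin.sum_univ_succ, Finsupp.degree_eq_sum]
    rfl
  rw [hF]
  refine ENat.card_le_card_of_injective (f := fun s => ⟨s.1.tail, ?_⟩) ?_
  · have := hsum _ s.2
    exact Nat.lt_succ_of_le (by omega)
  · rintro ⟨s, hs⟩ ⟨t, ht⟩ h
    have h1 : s.tail = t.tail := congrArg Subtype.val h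
    have h2 := hsum s hs
    have h3 := hsum t ht
    refine Subtype.ext ?_
    change s = t
    rw [← Finsupp.cons_tail s, ← Finsupp.cons_tail t, h1, show s 0 = t 0 by rw [h1] at h2; omega]

theorem choose_le_length_restrictSupport (K : Type*) [Field K] (d k : ℕ) :
    ((d + k).choose k : ℕ∞) ≤
      Module.length K (restrictSupport K {s : Fin d →₀ ℕ | s.degree < k + 1}) := by
  refine (choose_le_card_degree_lt d k).trans (le_of_eq ?_)
  rw [(basisRestrictSupport K {s : Fin d →₀ ℕ | s.degree < k + 1}).repr.length_eq,
    Module.length_finsupp, Module.length_eq_one, mul_one]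

end Count

end MvPolynomial

/-! ### Nonreduced linear components have multiplicity at least two. -/

namespace MvPolynomial

section Multiplicity

variable {K : Type*} [Field K] {n : ℕ}

/-- Applying π kills q and t, and the degree bound gives a = 0. The low-degree components of ι b · t
then lie in q by homogeneity; as t ∉ q and q is primary, each component of ι b lies in P, so b = 0.
-/
theorem GradedRetraction.eq_zero_of_add_mul_mem {P q : Ideal (MvPolynomial (Fin n) K)} {d : ℕ}
    (E : GradedRetraction P d) (hqP : q ≤ P)
    (hprim : ∀ a b, a * b ∈ q → b ∉ q → a ∈ P)
    (hhom : ∀ f ∈ q, ∀ i, homogeneousComponent i f ∈ q)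
    {t : MvPolynomial (Fin n) K} (ht : t.IsHomogeneous 1) (htP : t ∈ P) (htq : t ∉ q)
    {k : ℕ} {a b : MvPolynomial (Fin d) K} (ha : ∀ s ∈ a.support, s.degree < k + 2)
    (hb : ∀ s ∈ b.support, s.degree < k + 1)
    (h : E.ι a + E.ι b * t ∈ q ⊔ idealOfVars (Fin n) K ^ (k + 2)) : a = 0 ∧ b = 0 := by
  obtain ⟨u, hu, v, hv, huv⟩ := Submodule.mem_sup.mp h
  have ha0 : a = 0 := by
    have h1 := congrArg E.π huv
    rw [map_add, map_add, map_mul, E.π_ι, (E.π_eq_zero_iff u).mpr (hqP hu),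
      (E.π_eq_zero_iff t).mpr htP, mul_zero, add_zero, zero_add] at h1
    have h2 := E.π_mem_pow hv
    rw [h1, mem_pow_idealOfVars_iff'] at h2
    ext s
    by_cases hs : s ∈ a.support
    · rw [h2 s (ha s hs), coeff_zero]
    · rw [notMem_support_iff.mp hs, coeff_zero]
  refine ⟨ha0, ?_⟩
  rw [ha0, map_zero, zero_add] at huv
  rw [mem_pow_idealOfVars_iff'] at hv
  have hcomp : ∀ j, homogeneousComponent (j + 1) (E.ι b * t) =
      E.ι (homogeneousComponent j b) * t := by
    intro j
    conv_lhs => rw [← sum_homogeneousComponent b]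
    rw [map_sum, Finset.sum_mul, map_sum, Finset.sum_congr rfl fun i _ =>
      homogeneousComponent_of_mem (m := j + 1) (n := i + 1)
        ((E.ι_hom (homogeneousComponent_isHomogeneous i b)).mul ht)]
    simp only [add_left_inj]
    rw [Finset.sum_ite_eq]
    split_ifs with hj
    · rfl
    · rw [homogeneousComponent_eq_zero _ _ (by simpa using hj), map_zero, zero_mul]
  have hzero : ∀ j, homogeneousComponent j b = 0 := by
    intro j
    by_cases hj : j < k + 1
    -- Multiplication by t raises the degree by one, and j + 1 < k + 2 is below the order of v.
    · have h1 : homogeneousComponent (j + 1) v = 0 := by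
        ext s
        rw [coeff_homogeneousComponent, coeff_zero]
        split_ifs with hs
        · exact hv s (by omega)
        · rfl
      have h2 := hhom u hu (j + 1)
      rw [show u = E.ι b * t - v by rw [← huv]; ring, map_sub, h1, sub_zero, hcomp] at h2
      rw [← E.π_ι (homogeneousComponent j b), E.π_eq_zero_iff]
      exact hprim _ _ h2 htq
    · ext s
      rw [coeff_homogeneousComponent, coeff_zero]
      split_ifs with hs
      · by_contra h0
        have := hb s (mem_support_iff.mpr h0)
        omega
      · rfl
  rw [← sum_homogeneousComponent b]
  exact Finset.sum_eq_zero fun i _ => hzero i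

/-- Polynomials a in degrees at most k + 1 and b in degrees at most k embed together through a + b
t; these are the two copies of S/P, the second shifted by one. -/
theorem GradedRetraction.choose_add_choose_le_length {P q : Ideal (MvPolynomial (Fin n) K)} {d : ℕ}
    (E : GradedRetraction P d) (hqP : q ≤ P)
    (hprim : ∀ a b, a * b ∈ q → b ∉ q → a ∈ P)
    (hhom : ∀ f ∈ q, ∀ i, homogeneousComponent i f ∈ q)
    {t : MvPolynomial (Fin n) K} (ht : t.IsHomogeneous 1) (htP : t ∈ P) (htq : t ∉ q) (k : ℕ) :
    ((d + (k + 1)).choose (k + 1) + (d + k).choose k : ℕ∞) ≤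
      Module.length (MvPolynomial (Fin n) K)
        (MvPolynomial (Fin n) K ⧸ (q ⊔ idealOfVars (Fin n) K ^ (k + 2))) := by
  let S := MvPolynomial (Fin n) K
  let J := q ⊔ idealOfVars (Fin n) K ^ (k + 2)
  let V := restrictSupport K {s : Fin d →₀ ℕ | s.degree < k + 1 + 1}
  let V' := restrictSupport K {s : Fin d →₀ ℕ | s.degree < k + 1}
  let φ : V × V' →ₗ[K] S ⧸ J := (Ideal.Quotient.mkₐ K J).toLinearMap ∘ₗ
    LinearMap.coprod (E.ι.toLinearMap ∘ₗ V.subtype)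
      (LinearMap.mulRight K t ∘ₗ E.ι.toLinearMap ∘ₗ V'.subtype)
  have hφ : Function.Injective φ := by
    rw [← LinearMap.ker_eq_bot, LinearMap.ker_eq_bot']
    rintro ⟨⟨a, ha⟩, ⟨b, hb⟩⟩ h
    have h' : E.ι a + E.ι b * t ∈ J := Ideal.Quotient.eq_zero_iff_mem.mp h
    rw [mem_restrictSupport_iff] at ha hb
    obtain ⟨rfl, rfl⟩ := E.eq_zero_of_add_mul_mem hqP hprim hhom ht htP htq
      (fun s hs => ha hs) (fun s hs => hb hs) h'
    rfl
  calc ((d + (k + 1)).choose (k + 1) + (d + k).choose k : ℕ∞)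
      ≤ Module.length K (V × V') := by
        rw [Module.length_prod]
        exact add_le_add (choose_le_length_restrictSupport K d (k + 1))
          (choose_le_length_restrictSupport K d k)
    _ ≤ Module.length K (S ⧸ J) := Module.length_le_of_injective φ hφ
    _ ≤ Module.length S (S ⧸ J) := by
        refine Module.length_field_le_length (p := idealOfVars (Fin n) K)
          (fun s => ⟨_, sub_C_constantCoeff_mem_idealOfVars s⟩) (k + 2) _ fun s hs x => ?_
        obtain ⟨x, rfl⟩ := Ideal.Quotient.mk_surjective x
        change Ideal.Quotient.mk _ (s * x) = 0
        rw [Ideal.Quotient.eq_zero_iff_mem]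
        exact Ideal.mul_mem_right _ _ (Ideal.mem_sup_right hs)

end Multiplicity

section Limit

theorem pow_le_factorial_mul_choose (d k : ℕ) :
    (k + 1) ^ d ≤ d.factorial * (d + k).choose k := by
  rw [add_comm d k, Nat.choose_symm_add, ← Nat.ascFactorial_eq_factorial_mul_choose]
  exact Nat.pow_succ_le_ascFactorial _ _

open Filter Topology in
-- The exponent e is the support dimension, for which only e ≤ d is needed: binomials grow with d,
-- so each of the two copies contributes at least (k + 1)ᵉ / e!.
theorem two_le_limsup {d e : ℕ} (hed : e ≤ d) {H : ℕ → ℕ∞}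
    (hH : ∀ k, ((d + (k + 1)).choose (k + 1) + (d + k).choose k : ℕ∞) ≤ H (k + 2)) :
    2 ≤ limsup (fun k : ℕ => (e.factorial : ℝ≥0∞) * (H k : ℝ≥0∞) / (k : ℝ≥0∞) ^ e) atTop := by
  have hchoose : ∀ k, (k + 1) ^ e ≤ e.factorial * (d + k).choose k := fun k =>
    (pow_le_factorial_mul_choose e k).trans
      (Nat.mul_le_mul_left _ (Nat.choose_le_choose _ (by omega)))
  have hlow : ∀ k : ℕ, ((2 * (k + 1) ^ e : ℕ) : ℝ≥0∞) ≤
      (e.factorial : ℝ≥0∞) * (H (k + 2) : ℝ≥0∞) := by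
    intro k
    have h1 : 2 * (k + 1) ^ e ≤
        e.factorial * ((d + (k + 1)).choose (k + 1) + (d + k).choose k) := by
      have h2 : (k + 1) ^ e ≤ (k + 1 + 1) ^ e := Nat.pow_le_pow_left (by omega) e
      linarith [hchoose k, hchoose (k + 1)]
    have h3 : ((((d + (k + 1)).choose (k + 1) + (d + k).choose k : ℕ) : ℕ∞) : ℝ≥0∞) ≤
        (H (k + 2) : ℝ≥0∞) := ENat.toENNReal_mono (by exact_mod_cast hH k)
    calc ((2 * (k + 1) ^ e : ℕ) : ℝ≥0∞)
        ≤ ((e.factorial * ((d + (k + 1)).choose (k + 1) + (d + k).choose k) : ℕ) : ℝ≥0∞) := by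
          exact_mod_cast h1
      _ ≤ _ := by
          rw [Nat.cast_mul]
          gcongr
          simpa using h3
  have hlim : Tendsto (fun k : ℕ => ENNReal.ofReal (2 * (((k : ℝ) + 1) / (k + 2)) ^ e)) atTop
      (𝓝 2) := by
    have h1 : Tendsto (fun k : ℕ => ((k : ℝ) + 1) / (k + 2)) atTop (𝓝 1) := by
      have h2 := (tendsto_const_nhds (x := (1 : ℝ))).sub
        ((tendsto_one_div_add_atTop_nhds_zero_nat (𝕜 := ℝ)).comp (tendsto_add_atTop_nat 1))
      rw [sub_zero] at h2
      refine h2.congr fun k => ?_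
      have : (k : ℝ) + 2 ≠ 0 := by positivity
      have h3 : (k : ℝ) + 1 + 1 = k + 2 := by ring
      simp only [Function.comp, Nat.cast_add, Nat.cast_one, h3]
      field_simp
      ring
    have h2 := ENNReal.tendsto_ofReal ((h1.pow e).const_mul 2)
    simpa using h2
  rw [← limsup_nat_add _ 2, ← hlim.limsup_eq]
  refine limsup_le_limsup (Eventually.of_forall fun k => ?_)
  have hk : (0 : ℝ) < (k + 2 : ℝ) ^ e := by positivity
  calc ENNReal.ofReal (2 * (((k : ℝ) + 1) / (k + 2)) ^ e)
      = ((2 * (k + 1) ^ e : ℕ) : ℝ≥0∞) / ((k + 2 : ℕ) : ℝ≥0∞) ^ e := by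
        rw [div_pow, ← mul_div_assoc, ENNReal.ofReal_div_of_pos hk]
        congr 1
        · rw [← ENNReal.ofReal_natCast]
          push_cast
          rfl
        · rw [← ENNReal.ofReal_natCast, ← ENNReal.ofReal_pow (by positivity)]
          push_cast
          rfl
    _ ≤ _ := by
        simp only
        gcongr
        exact hlow k

end Limit

section Multiplicity

variable {K : Type*} [Field K] {n : ℕ}

theorem two_le_quotientMultiplicity {x y : MvPolynomial (Fin n) K} (hx : x.IsHomogeneous 1)
    (hy : y.IsHomogeneous 1) (hxy : LinearIndependent K ![x, y])
    {q : Ideal (MvPolynomial (Fin n) K)} (hq : q.IsPrimary) (hqr : q.radical = Ideal.span {x, y})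
    (hhom : ∀ f ∈ q, ∀ i, homogeneousComponent i f ∈ q) (hne : q ≠ Ideal.span {x, y}) :
    2 ≤ quotientMultiplicity q := by
  obtain ⟨d, ⟨E⟩⟩ := exists_gradedRetraction hx hy hxy
  have hqP : q ≤ Ideal.span {x, y} := hqr ▸ Ideal.le_radical
  -- Since q is strictly smaller than (x, y), one of x and y lies outside q and serves as t.
  obtain ⟨t, ht, htP, htq⟩ : ∃ t : MvPolynomial (Fin n) K, t.IsHomogeneous 1 ∧
      t ∈ Ideal.span {x, y} ∧ t ∉ q := by
    by_contra! h
    refine hne (le_antisymm hqP (Ideal.span_le.mpr ?_))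
    rintro z (rfl | rfl)
    · exact h _ hx (Ideal.subset_span (by simp))
    · exact h _ hy (Ideal.subset_span (by simp))
  have hprim : ∀ a b, a * b ∈ q → b ∉ q → a ∈ Ideal.span {x, y} := by
    intro a b hab hb
    rw [mul_comm] at hab
    rw [← hqr]
    exact ((Ideal.isPrimary_iff.mp hq).2 hab).resolve_left hb
  have := idealOfVars_isMaximal (K := K) (n := n)
  refine two_le_limsup (d := d) ?_ fun k =>
    (E.choose_add_choose_le_length hqP hprim hhom ht htP htq k).trans
      (length_quotient_le_hilbertSamuelFunction _ q _)
  have hdim := E.supportDim_le (q := q) (p := idealOfVars (Fin n) K) hqr.ge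
  revert hdim
  generalize Module.supportDim (Localization.AtPrime (idealOfVars (Fin n) K))
    (LocalizedModule (idealOfVars (Fin n) K).primeCompl (MvPolynomial (Fin n) K ⧸ q)) = D
  intro hD
  induction D using WithBot.recBotCoe with
  | bot => simp
  | coe D =>
    rw [WithBot.unbotD_coe]
    exact ENat.toNat_le_of_le_natCast (by exact_mod_cast hD)

/-- A linear minimal prime at which two coprime quadratic forms define a nonreduced scheme belongs
to a primary component of multiplicity at least two. -/
theorem exists_component_two_le [Infinite K] {Q₁ Q₂ x y : MvPolynomial (Fin n) K}
    (hQ₁ : Q₁.IsHomogeneous 2) (hQ₂ : Q₂.IsHomogeneous 2) (hrel : IsRelPrime Q₁ Q₂) (h₁ : Q₁ ≠ 0)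
    (hx : x.IsHomogeneous 1) (hy : y.IsHomogeneous 1) (hxy : LinearIndependent K ![x, y])
    (hle : Ideal.span {Q₁, Q₂} ≤ Ideal.span {x, y})
    (hred : (Ideal.span {Q₁, Q₂}).NotReducedAt (Ideal.span {x, y})) :
    Ideal.span {x, y} ∈ (Ideal.span {Q₁, Q₂}).minimalPrimes ∧
      ∃ (t : Finset (Ideal (MvPolynomial (Fin n) K))) (q : Ideal (MvPolynomial (Fin n) K)),
        Submodule.IsMinimalPrimaryDecomposition (Ideal.span {Q₁, Q₂}) t ∧ q ∈ t ∧
        q.radical = Ideal.span {x, y} ∧ 2 ≤ quotientMultiplicity q := by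
  have hP := Ideal.span_pair_mem_minimalPrimes hrel h₁ (isPrime_span_linear_pair hx hy hxy) hle
  obtain ⟨t, q, ht, hqt, hq, hqr, hmem⟩ := Ideal.exists_isolated_component hP
  refine ⟨hP, t, q, ht, hqt, hqr, two_le_quotientMultiplicity hx hy hxy hq hqr
    (fun f hf i => homogeneousComponent_mem_of_localization hQ₁ hQ₂ hx hy hmem hf i) ?_⟩
  -- If q were P, the witness f of nonreducedness would be multiplied into I by some s outside P.
  rintro rfl
  obtain ⟨f, hf, hs⟩ := hred
  obtain ⟨s, hsP, hsf⟩ := (hmem f).mp hf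
  exact hsP (hs s hsf)

end Multiplicity

end MvPolynomial

/-! ### Pencils with a common factor. -/

namespace MvPolynomial

section CommonFactor

variable {K : Type*} [Field K] {n : ℕ}

/-- Two quadratic forms with a common factor are proportional or share exactly a linear factor. -/
theorem exists_of_not_isRelPrime {Q₁ Q₂ : MvPolynomial (Fin n) K} (hQ₁ : Q₁.IsHomogeneous 2)
    (hQ₂ : Q₂.IsHomogeneous 2) (h : ¬ IsRelPrime Q₁ Q₂) :
    (∃ (Q : MvPolynomial (Fin n) K) (α β : K), Q.IsHomogeneous 2 ∧ (α ≠ 0 ∨ β ≠ 0) ∧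
      Q₁ = C α * Q ∧ Q₂ = C β * Q) ∨
    ∃ x y z : MvPolynomial (Fin n) K, x.IsHomogeneous 1 ∧ y.IsHomogeneous 1 ∧
      z.IsHomogeneous 1 ∧ x ≠ 0 ∧ LinearIndependent K ![y, z] ∧ Q₁ = x * y ∧ Q₂ = x * z := by
  rcases eq_or_ne Q₁ 0 with rfl | h₁
  · exact .inl ⟨Q₂, 0, 1, hQ₂, .inr one_ne_zero, by simp, by simp⟩
  rw [IsRelPrime] at h
  push Not at h
  obtain ⟨x, ⟨y, rfl⟩, hx₂, hxu⟩ := h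
  have hx0 : x ≠ 0 := left_ne_zero_of_mul h₁
  have hy0 : y ≠ 0 := right_ne_zero_of_mul h₁
  obtain ⟨i, j, hij, hx, hy⟩ := hQ₁.exists_of_mul h₁
  have hi : i ≠ 0 := by
    rintro rfl
    exact hxu (hx.isUnit hx0)
  rcases (by omega : i = 1 ∧ j = 1 ∨ i = 2 ∧ j = 0) with ⟨rfl, rfl⟩ | ⟨rfl, rfl⟩
  · obtain ⟨z, rfl⟩ := hx₂
    have hz : z.IsHomogeneous 1 := IsHomogeneous.mul_right_cancel (i := 1) hQ₂ hx hx0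
    by_cases hyz : y ∣ z
    · obtain ⟨c, rfl⟩ := hy.exists_C_mul_of_dvd hz hy0 hyz
      exact .inl ⟨x * y, 1, c, hQ₁, .inl one_ne_zero, by simp, by ring⟩
    · exact .inr ⟨x, y, z, hx, hy, hz, hx0, linearIndependent_pair_of_not_dvd hy0 hyz, rfl, rfl⟩
  · obtain ⟨c, rfl⟩ := hx.exists_C_mul_of_dvd hQ₂ hx0 hx₂
    obtain ⟨b, rfl⟩ := hy.exists_eq_C
    exact .inl ⟨x, b, c, hx, .inl (by simpa using hy0), mul_comm _ _, rfl⟩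

theorem span_C_mul_pair {Q : MvPolynomial (Fin n) K} {α β : K} (h : α ≠ 0 ∨ β ≠ 0) :
    Ideal.span {C α * Q, C β * Q} = Ideal.span {Q} ∧
      Q ∈ Submodule.span K {C α * Q, C β * Q} := by
  have hQ : Q ∈ Submodule.span K {C α * Q, C β * Q} := by
    rw [Submodule.mem_span_pair]
    rcases h with h | h
    · exact ⟨α⁻¹, 0, by rw [zero_smul, add_zero, ← smul_eq_C_mul, inv_smul_smul₀ h]⟩
    · exact ⟨0, β⁻¹, by rw [zero_smul, zero_add, ← smul_eq_C_mul, inv_smul_smul₀ h]⟩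
  refine ⟨le_antisymm ?_ ?_, hQ⟩
  · rw [Ideal.span_le]
    rintro _ (rfl | rfl) <;>
      exact Ideal.mul_mem_left _ _ (Ideal.mem_span_singleton_self _)
  · rw [Ideal.span_singleton_le_iff_mem]
    exact Submodule.span_le_restrictScalars K _ _ hQ

/-- A linear form in the ideal generated by two independent linear forms is a linear combination
of them. -/
theorem IsHomogeneous.exists_eq_of_mem_span_pair {x y z : MvPolynomial (Fin n) K}
    (hx : x.IsHomogeneous 1) (hy : y.IsHomogeneous 1) (hz : z.IsHomogeneous 1)
    (hyz : LinearIndependent K ![y, z]) (h : x ∈ Ideal.span {y, z}) :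
    ∃ a b : K, x = C a * y + C b * z := by
  obtain ⟨m, -, ⟨E⟩⟩ := exists_elimination' hy (hyz.ne_zero 0)
  rw [← E.comap_span_π, Ideal.mem_comap, Ideal.mem_span_singleton] at h
  obtain ⟨b, hb⟩ := (E.π_hom hz).exists_C_mul_of_dvd (E.π_hom hx) (E.π_ne_zero hy hz hyz) h
  have h2 : y ∣ x - C b * z := by
    rw [← E.π_eq_zero_iff, map_sub, map_mul, E.π_C, hb, sub_self]
  obtain ⟨a, ha⟩ := hy.exists_C_mul_of_dvd (hx.sub (hz.C_mul b)) (hyz.ne_zero 0) h2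
  exact ⟨a, b, by rw [← ha]; ring⟩

/-- Since x avoids the prime (y, z), the ideal is the intersection of the primes (x) and (y, z). -/
theorem span_mul_pair_isRadical {x y z : MvPolynomial (Fin n) K} (hx : x.IsHomogeneous 1)
    (hy : y.IsHomogeneous 1) (hz : z.IsHomogeneous 1) (hx0 : x ≠ 0)
    (hyz : LinearIndependent K ![y, z]) (h : x ∉ Ideal.span {y, z}) :
    (Ideal.span {x * y, x * z}).IsRadical := by
  have hP := isPrime_span_linear_pair hy hz hyz
  rintro f ⟨k, hk⟩
  have h1 : x ∣ f := by
    refine (hx.prime hx0).dvd_of_dvd_pow (n := k) ?_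
    obtain ⟨a, b, hab⟩ := Ideal.mem_span_pair.mp hk
    rw [← hab]
    exact ⟨a * y + b * z, by ring⟩
  have h2 : f ∈ Ideal.span {y, z} := by
    refine hP.mem_of_pow_mem k (Ideal.span_le.mpr ?_ hk)
    rintro _ (rfl | rfl)
    · exact Ideal.mul_mem_left _ _ (Ideal.subset_span (by simp))
    · exact Ideal.mul_mem_left _ _ (Ideal.subset_span (by simp))
  obtain ⟨g, rfl⟩ := h1
  obtain ⟨a, b, hab⟩ := Ideal.mem_span_pair.mp ((hP.mem_or_mem h2).resolve_left h)
  exact Ideal.mem_span_pair.mpr ⟨a, b, by rw [← hab]; ring⟩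

/-- For proportional forms the question is whether their generator is squarefree. For xy, xz with y,
z independent, it is whether x lies in (y, z): if x = a y + b z, multiplication by x puts x² in the
span, and solving for y or z gives the required shape. -/
theorem pencil_of_not_isRelPrime {Q₁ Q₂ : MvPolynomial (Fin n) K} (hQ₁ : Q₁.IsHomogeneous 2)
    (hQ₂ : Q₂.IsHomogeneous 2) (hrel : ¬ IsRelPrime Q₁ Q₂)
    (hprime : ¬ (Ideal.span {Q₁, Q₂}).IsPrime) :
    ((Ideal.span {Q₁, Q₂}).IsRadical ∧ ∃ x y : MvPolynomial (Fin n) K, x.IsHomogeneous 1 ∧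
      y.IsHomogeneous 1 ∧ LinearIndependent K ![x, y] ∧ x * y ∈ Submodule.span K {Q₁, Q₂}) ∨
    (¬ (Ideal.span {Q₁, Q₂}).IsRadical ∧
      ∃ x y : MvPolynomial (Fin n) K, x.IsHomogeneous 1 ∧ y.IsHomogeneous 1 ∧ x ≠ 0 ∧
        (∃ α β : K, (Q₁ = x * y ∧ Q₂ = x * (α • x + β • y)) ∨
          (Q₂ = x * y ∧ Q₁ = x * (α • x + β • y))) ∧
        x ^ 2 ∈ Submodule.span K {Q₁, Q₂}) := by
  rcases exists_of_not_isRelPrime hQ₁ hQ₂ hrel with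
    ⟨Q, α, β, hQ, hαβ, rfl, rfl⟩ | ⟨x, y, z, hx, hy, hz, hx0, hyz, rfl, rfl⟩
  · obtain ⟨hspan, hmem⟩ := span_C_mul_pair (Q := Q) hαβ
    rw [hspan] at hprime ⊢
    have hQ0 : Q ≠ 0 := by
      rintro rfl
      rw [Ideal.span_singleton_zero] at hprime
      exact hprime Ideal.isPrime_bot
    obtain ⟨x, y, hx, hy, rfl⟩ := IsHomogeneous.exists_linear_mul_of_not_irreducible (d := 1) hQ
      (by norm_num) hQ0
      fun h => hprime ((Ideal.span_singleton_prime hQ0).mpr h.prime)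
    have hx0 := left_ne_zero_of_mul hQ0
    have hy0 := right_ne_zero_of_mul hQ0
    by_cases hdvd : x ∣ y
    · obtain ⟨c, rfl⟩ := hx.exists_C_mul_of_dvd hy hx0 hdvd
      have hc : c ≠ 0 := by
        rintro rfl
        simp at hy0
      refine .inr ⟨fun hrad => ?_, x, C (α * c) * x, hx, hx.C_mul _, hx0,
        ⟨β * c, 0, .inl ⟨by rw [C_mul]; ring, ?_⟩⟩, ?_⟩
      · have : x ∈ Ideal.span {x * (C c * x)} := hrad ⟨2, by
          rw [Ideal.mem_span_singleton]
          refine ⟨C c⁻¹, ?_⟩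
          have : (C c * C c⁻¹ : MvPolynomial (Fin n) K) = 1 := by
            rw [← C_mul, mul_inv_cancel₀ hc, C_1]
          linear_combination (-x ^ 2) * this⟩
        obtain ⟨w, hw⟩ := Ideal.mem_span_singleton.mp this
        refine (hx.C_mul c).not_isUnit one_ne_zero (IsUnit.of_mul_eq_one w ?_)
        refine mul_left_cancel₀ hx0 ?_
        linear_combination -hw
      · rw [zero_smul, add_zero, smul_eq_C_mul, C_mul]
        ring
      · have h1 : x ^ 2 = c⁻¹ • (x * (C c * x)) := by
          rw [mul_left_comm, ← smul_eq_C_mul, inv_smul_smul₀ hc, sq]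
        rw [h1]
        exact Submodule.smul_mem _ _ hmem
    · have hLI := linearIndependent_pair_of_not_dvd hx0 hdvd
      refine .inl ⟨span_singleton_isRadical_of_squarefree ?_, x, y, hx, hy, hLI, hmem⟩
      rw [squarefree_mul_iff]
      exact ⟨((hx.irreducible hx0).isRelPrime_iff_not_dvd).mpr hdvd,
        (hx.irreducible hx0).squarefree, (hy.irreducible hy0).squarefree⟩
  · by_cases hmem : x ∈ Ideal.span {y, z}
    · obtain ⟨a, b, hab⟩ := hx.exists_eq_of_mem_span_pair hy hz hyz hmem
      have hsq : x ^ 2 ∈ Submodule.span K {x * y, x * z} :=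
        Submodule.mem_span_pair.mpr ⟨a, b, by
          rw [smul_eq_C_mul, smul_eq_C_mul]
          linear_combination (-x) * hab⟩
      by_cases hrad : (Ideal.span {x * y, x * z}).IsRadical
      · left
        -- The form x cannot divide both independent forms y and z, so xy or xz is a product of
        -- independent forms.
        by_cases hxy : x ∣ y
        · have hxz : ¬ x ∣ z := fun hxz => by
            obtain ⟨c, rfl⟩ := hx.exists_C_mul_of_dvd hy hx0 hxy
            obtain ⟨c', rfl⟩ := hx.exists_C_mul_of_dvd hz hx0 hxz
            have hc : IsUnit (C c : MvPolynomial (Fin n) K) :=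
              (isHomogeneous_C _ c).isUnit (left_ne_zero_of_mul (hyz.ne_zero 0))
            exact hy.not_dvd_of_linearIndependent hz hyz
              (hc.mul_left_dvd.mpr (dvd_mul_left _ _))
          exact ⟨hrad, x, z, hx, hz, linearIndependent_pair_of_not_dvd hx0 hxz,
            Submodule.subset_span (by simp)⟩
        · exact ⟨hrad, x, y, hx, hy, linearIndependent_pair_of_not_dvd hx0 hxy,
            Submodule.subset_span (by simp)⟩
      · right
        have hab0 : a ≠ 0 ∨ b ≠ 0 := by
          by_contra! h
          exact hx0 (by rw [hab, h.1, h.2, C_0]; ring)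
        rcases hab0 with ha | hb
        · have h1 : (C a⁻¹ * C a : MvPolynomial (Fin n) K) = 1 := by
            rw [← C_mul, inv_mul_cancel₀ ha, C_1]
          refine ⟨hrad, x, z, hx, hz, hx0, ⟨a⁻¹, -(a⁻¹ * b), .inr ⟨rfl, ?_⟩⟩, hsq⟩
          rw [smul_eq_C_mul, smul_eq_C_mul, C_neg, C_mul]
          linear_combination (-x * C a⁻¹) * hab - x * y * h1
        · have h1 : (C b⁻¹ * C b : MvPolynomial (Fin n) K) = 1 := by
            rw [← C_mul, inv_mul_cancel₀ hb, C_1]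
          refine ⟨hrad, x, y, hx, hy, hx0, ⟨b⁻¹, -(b⁻¹ * a), .inl ⟨rfl, ?_⟩⟩, hsq⟩
          rw [smul_eq_C_mul, smul_eq_C_mul, C_neg, C_mul]
          linear_combination (-x * C b⁻¹) * hab - x * z * h1
    · refine .inl ⟨span_mul_pair_isRadical hx hy hz hx0 hyz hmem, x, y, hx, hy, ?_,
        Submodule.subset_span (by simp)⟩
      refine linearIndependent_pair_of_not_dvd hx0 fun h => hmem ?_
      obtain ⟨c, rfl⟩ := hx.exists_C_mul_of_dvd hy hx0 h
      have hc : c ≠ 0 := by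
        rintro rfl
        exact hyz.ne_zero 0 (by simp)
      rw [Ideal.mem_span_pair]
      refine ⟨C c⁻¹, 0, ?_⟩
      rw [← mul_assoc, ← C_mul, inv_mul_cancel₀ hc, C_1]
      ring

end CommonFactor

/-! ### Coprime generators and bases of the pencil. -/

section Coprime

variable {K : Type*} [Field K] {n : ℕ}

theorem IsHomogeneous.left_ne_zero_of_isRelPrime {Q₁ Q₂ : MvPolynomial (Fin n) K} {d : ℕ}
    (hQ₂ : Q₂.IsHomogeneous d) (hd : d ≠ 0) (h : IsRelPrime Q₁ Q₂) : Q₁ ≠ 0 := by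
  rintro rfl
  exact hQ₂.not_isUnit hd (h (dvd_zero _) dvd_rfl)

/-- An ideal generated by two quadratic forms contains no nonzero linear form. -/
theorem IsHomogeneous.eq_zero_of_mem_span_pair {Q₁ Q₂ x : MvPolynomial (Fin n) K}
    (hQ₁ : Q₁.IsHomogeneous 2) (hQ₂ : Q₂.IsHomogeneous 2) (hx : x.IsHomogeneous 1)
    (h : x ∈ Ideal.span {Q₁, Q₂}) : x = 0 := by
  have hle : Ideal.span {Q₁, Q₂} ≤ idealOfVars (Fin n) K ^ 2 := by
    rw [Ideal.span_le]
    rintro Q (rfl | rfl)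
    · exact (mem_pow_idealOfVars_iff' 2 _).mpr fun s hs => hQ₁.coeff_eq_zero (by omega)
    · exact (mem_pow_idealOfVars_iff' 2 _).mpr fun s hs => hQ₂.coeff_eq_zero (by omega)
  ext s
  rw [coeff_zero]
  by_cases hs : s.degree = 1
  · exact (mem_pow_idealOfVars_iff' 2 x).mp (hle h) s (by omega)
  · exact hx.coeff_eq_zero hs

theorem exists_span_pair_eq {Q₁ Q₂ : MvPolynomial (Fin n) K} {s t : K} (h : s ≠ 0 ∨ t ≠ 0) :
    ∃ Q, (Q = Q₁ ∨ Q = Q₂) ∧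
      Ideal.span {Q₁, Q₂} = Ideal.span {C s * Q₁ + C t * Q₂, Q} := by
  rcases h with h | h
  · refine ⟨Q₂, .inr rfl, ?_⟩
    have h1 : (C s⁻¹ * C s : MvPolynomial (Fin n) K) = 1 := by
      rw [← C_mul, inv_mul_cancel₀ h, C_1]
    refine le_antisymm (Ideal.span_le.mpr ?_) (Ideal.span_le.mpr ?_)
    · rintro F (rfl | rfl)
      · exact Ideal.mem_span_pair.mpr ⟨C s⁻¹, -(C s⁻¹ * C t), by linear_combination F * h1⟩
      · exact Ideal.subset_span (by simp)
    · rintro _ (rfl | rfl)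
      · exact Ideal.mem_span_pair.mpr ⟨_, _, rfl⟩
      · exact Ideal.subset_span (by simp)
  · refine ⟨Q₁, .inl rfl, ?_⟩
    have h1 : (C t⁻¹ * C t : MvPolynomial (Fin n) K) = 1 := by
      rw [← C_mul, inv_mul_cancel₀ h, C_1]
    refine le_antisymm (Ideal.span_le.mpr ?_) (Ideal.span_le.mpr ?_)
    · rintro F (rfl | rfl)
      · exact Ideal.subset_span (by simp)
      · exact Ideal.mem_span_pair.mpr ⟨C t⁻¹, -(C t⁻¹ * C s), by linear_combination F * h1⟩
    · rintro _ (rfl | rfl)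
      · exact Ideal.mem_span_pair.mpr ⟨_, _, rfl⟩
      · exact Ideal.subset_span (by simp)

end Coprime

end MvPolynomial

/-! ### The classification. -/

theorem proposition1p2 {K : Type*} [Field K] [IsAlgClosed K] [CharZero K] (n : ℕ)
    (Q₁ Q₂ : MvPolynomial (Fin n) K) (hQ₁ : Q₁.IsHomogeneous 2) (hQ₂ : Q₂.IsHomogeneous 2) :
    -- 1. the ideal is prime
    (Ideal.span {Q₁, Q₂}).IsPrime ∨
    -- 2. the ideal is radical, but not prime
    ((Ideal.span {Q₁, Q₂}).IsRadical ∧ ¬ (Ideal.span {Q₁, Q₂}).IsPrime ∧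
      ((∃ x y : MvPolynomial (Fin n) K, x.IsHomogeneous 1 ∧ y.IsHomogeneous 1 ∧
          LinearIndependent K ![x, y] ∧ x * y ∈ Submodule.span K {Q₁, Q₂}) ∨
        (∃ x y : MvPolynomial (Fin n) K, x.IsHomogeneous 1 ∧ y.IsHomogeneous 1 ∧
          LinearIndependent K ![x, y] ∧
          Ideal.span {x, y} ∈ (Ideal.span {Q₁, Q₂}).minimalPrimes))) ∨
    -- 3. the ideal is not radical
    (¬ (Ideal.span {Q₁, Q₂}).IsRadical ∧
      -- (a)
      ((¬ IsRelPrime Q₁ Q₂ ∧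
          ∃ x y : MvPolynomial (Fin n) K, x.IsHomogeneous 1 ∧ y.IsHomogeneous 1 ∧ x ≠ 0 ∧
            (∃ α β : K,
              (Q₁ = x * y ∧ Q₂ = x * (α • x + β • y)) ∨
              (Q₂ = x * y ∧ Q₁ = x * (α • x + β • y))) ∧
            x ^ 2 ∈ Submodule.span K {Q₁, Q₂}) ∨
      -- (b)
        (IsRelPrime Q₁ Q₂ ∧
          ∃ x Q : MvPolynomial (Fin n) K, x.IsHomogeneous 1 ∧ x ≠ 0 ∧ Q.IsHomogeneous 2 ∧
            Irreducible (Ideal.Quotient.mk (Ideal.span {x}) Q) ∧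
            Ideal.span {x, Q} ∈ (Ideal.span {Q₁, Q₂}).minimalPrimes ∧
            x ^ 2 ∈ Submodule.span K {Q₁, Q₂}) ∨
      -- (c)
        (IsRelPrime Q₁ Q₂ ∧
          ∃ x y : MvPolynomial (Fin n) K, x.IsHomogeneous 1 ∧ y.IsHomogeneous 1 ∧
            LinearIndependent K ![x, y] ∧
            Ideal.span {x, y} ∈ (Ideal.span {Q₁, Q₂}).minimalPrimes ∧
            ∃ (t : Finset (Ideal (MvPolynomial (Fin n) K))) (q : Ideal (MvPolynomial (Fin n) K)),
              Submodule.IsMinimalPrimaryDecomposition (Ideal.span {Q₁, Q₂}) t ∧ q ∈ t ∧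
              q.radical = Ideal.span {x, y} ∧ 2 ≤ quotientMultiplicity q))) := by
  by_cases hprime : (Ideal.span {Q₁, Q₂}).IsPrime
  · exact .inl hprime
  refine .inr ?_
  by_cases hrel : IsRelPrime Q₁ Q₂
  swap
  · rcases MvPolynomial.pencil_of_not_isRelPrime hQ₁ hQ₂ hrel hprime with ⟨hrad, h⟩ | ⟨hrad, h⟩
    · exact .inl ⟨hrad, hprime, .inl h⟩
    · exact .inr ⟨hrad, .inl ⟨hrel, h⟩⟩
  have h₁ := hQ₂.left_ne_zero_of_isRelPrime two_ne_zero hrel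
  by_cases H : ∀ s t : K, s ≠ 0 ∨ t ≠ 0 → ∀ x y : MvPolynomial (Fin n) K, x.IsHomogeneous 1 →
      y.IsHomogeneous 1 → MvPolynomial.C s * Q₁ + MvPolynomial.C t * Q₂ ≠ x * y
  · obtain ⟨⟨x, y, hx, hy, hxy, hle⟩, h⟩ :=
      (MvPolynomial.pencil_of_forall_irreducible hQ₁ hQ₂ H).resolve_left hprime
    by_cases hrad : (Ideal.span {Q₁, Q₂}).IsRadical
    · exact .inl ⟨hrad, hprime, .inr ⟨x, y, hx, hy, hxy, Ideal.span_pair_mem_minimalPrimes hrel h₁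
        (MvPolynomial.isPrime_span_linear_pair hx hy hxy) hle⟩⟩
    · obtain ⟨x, y, hx, hy, hxy, hle, hred⟩ := h.resolve_left hrad
      exact .inr ⟨hrad, .inr (.inr ⟨hrel, x, y, hx, hy, hxy,
        MvPolynomial.exists_component_two_le hQ₁ hQ₂ hrel h₁ hx hy hxy hle hred⟩)⟩
  push Not at H
  obtain ⟨s, t, hst, x, y, hx, hy, hxy⟩ := H
  obtain ⟨Q, hQ', hspan⟩ := MvPolynomial.exists_span_pair_eq (Q₁ := Q₁) (Q₂ := Q₂) hst
  have hQ : Q.IsHomogeneous 2 := by rcases hQ' with rfl | rfl <;> assumption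
  have hmem : x * y ∈ Submodule.span K {Q₁, Q₂} :=
    Submodule.mem_span_pair.mpr ⟨s, t, by
      rw [← hxy, MvPolynomial.smul_eq_C_mul, MvPolynomial.smul_eq_C_mul]⟩
  rw [hxy] at hspan
  have hrel' : IsRelPrime (x * y) Q := by
    rwa [isRelPrime_iff_span, ← hspan, ← isRelPrime_iff_span]
  have hxy0 := hQ.left_ne_zero_of_isRelPrime two_ne_zero hrel'
  have hx0 := left_ne_zero_of_mul hxy0
  by_cases hdvd : x ∣ y
  · obtain ⟨c, rfl⟩ := hx.exists_C_mul_of_dvd hy hx0 hdvd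
    have hc : c ≠ 0 := by
      rintro rfl
      simp at hxy0
    have hxx : x * x = c⁻¹ • (x * (MvPolynomial.C c * x)) := by
      rw [mul_left_comm, ← MvPolynomial.smul_eq_C_mul, inv_smul_smul₀ hc]
    have hmem' : x * x ∈ Submodule.span K {Q₁, Q₂} := hxx ▸ Submodule.smul_mem _ _ hmem
    have hspan' : Ideal.span {Q₁, Q₂} = Ideal.span {x * x, Q} := by
      rw [hspan, mul_left_comm, Ideal.span_insert, Ideal.span_insert,
        Ideal.span_singleton_mul_left_unit ((isUnit_iff_ne_zero.mpr hc).map MvPolynomial.C)]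
    have hrel'' : IsRelPrime (x * x) Q := by
      rwa [isRelPrime_iff_span, ← hspan', ← isRelPrime_iff_span]
    -- The ideal contains x², but no nonzero linear form because its generators are quadratic.
    have hrad : ¬ (Ideal.span {Q₁, Q₂}).IsRadical := fun hrad =>
      hx0 (MvPolynomial.IsHomogeneous.eq_zero_of_mem_span_pair hQ₁ hQ₂ hx (hrad ⟨2, by
        rw [sq]
        exact Submodule.span_le_restrictScalars K _ _ hmem'⟩))
    refine .inr ⟨hrad, .inr ?_⟩
    rcases MvPolynomial.pencil_sq hx hx0 hQ hrel'' with ⟨hirr, hP⟩ | ⟨u, hu, hxu, hle, hred⟩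
    · refine .inl ⟨hrel, x, Q, hx, hx0, hQ, hirr, ?_, by rwa [sq]⟩
      rw [hspan']
      refine Ideal.span_pair_mem_minimalPrimes hrel'' (mul_ne_zero hx0 hx0) hP
        (Ideal.span_le.mpr ?_)
      rintro _ (rfl | rfl)
      · exact Ideal.mul_mem_left _ _ (Ideal.subset_span (by simp))
      · exact Ideal.subset_span (by simp)
    · rw [← hspan'] at hle hred
      exact .inr ⟨hrel, x, u, hx, hu, hxu,
        MvPolynomial.exists_component_two_le hQ₁ hQ₂ hrel h₁ hx hu hxu hle hred⟩
  · have hLI := MvPolynomial.linearIndependent_pair_of_not_dvd hx0 hdvd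
    by_cases hrad : (Ideal.span {Q₁, Q₂}).IsRadical
    · exact .inl ⟨hrad, hprime, .inl ⟨x, y, hx, hy, hLI, hmem⟩⟩
    · have h := MvPolynomial.pencil_mul hx hy hLI hQ hrel'
      rw [← hspan] at h
      obtain ⟨u, v, hu, hv, huv, hle, hred⟩ := h.resolve_left hrad
      exact .inr ⟨hrad, .inr (.inr ⟨hrel, u, v, hu, hv, huv,
        MvPolynomial.exists_component_two_le hQ₁ hQ₂ hrel h₁ hu hv huv hle hred⟩)⟩
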